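/- **Setting.** Let $k\in\mathbb R$, $k\neq 0,1$, and $h(q)=\frac{q^k}{k(k-1)}$. Let $M=\{(x,y,p,q,z)\in\mathbb R^5: q>0\}$ and let $\mathcal D_k$ be the $(2,3,5)$-distribution on $M$ spanned by $\xi_1=\partial_x+p\partial_y+q\partial_p+h(q)\partial_z$ and $\partial_q$; its derived rank 3 distribution $[\mathcal D_k,\mathcal D_k]$ is spanned by $\xi_1,\ \partial_q,\ \partial_p+h'\partial_z$. The twistor bundle is the connected 7-manifold $$\widetilde M=\mathbb P([\mathcal D_k,\mathcal D_k])\setminus\mathbb P(\mathcal D_k)$$ of lines in $[\mathcal D_k,\mathcal D_k]$ that are not contained in $\mathcal D_k$. It has global coordinates $(x,y,p,q,z,s,t)$ with $q>0$, for which the line is spanned by $t\,\xi_1+s\,\partial_q+(\partial_p+h'\partial_z)$. On the dense open set $t\ne0$ we use instead the coordinates $(x,y,p,q,z,v,w)$, $q>0$, $w\neq 0$, with $s=v/w$, $t=h''/w$, so that the line is spanned by $\xi_1+\frac{v}{h''}\partial_q+\frac{w}{h''}(\partial_p+h'\partial_z)$. The induced Lie contact structure $([\lambda],[\Upsilon])$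 on $\widetilde M$ is given on this dense chart by the contact form $$\lambda=dz-\Big(w+\frac{q^{k-1}}{k-1}\Big)dp+v\,dy+\Big(wq-vp+\frac{q^k}{k}\Big)dx$$ and the symmetric rank 4 tensor (with symmetric products) $$\begin{aligned}\Upsilon={}&2\theta^2(\theta^3)^2\theta^6-3(\theta^1)^2(\theta^6)^2-2\theta^1\theta^3\theta^4\theta^6-6\theta^1\theta^2\theta^5\theta^6\\&+2\theta^2\theta^3\theta^4\theta^5-2\theta^1(\theta^4)^2\theta^5-3(\theta^2)^2(\theta^5)^2,\end{aligned}$$ where $$\begin{aligned} \theta^1&=-\frac{p {h''}^{4/3}}{27 w^4} {\rm d} x+\frac{ {h''}^{4/3}}{27 w^4}{\rm d} y\\ \theta^2&=\frac{v {h''}^{5/3}}{27 w^5}{\rm d} y+\frac{ {h''}^{5/3}}{27 w^5}{\rm d} z-\frac{ h' {h''}^{5/3}}{27 w^5}{\rm d} p-\frac{ \left(v p+h-q h'\right) {h''}^{5/3}}{27 w^5}{\rm d} x \\ \theta^3&=\frac{v h''}{3 w^3}{\rm d} y-\frac{ \big(-20 {h''}^4-4 w^2 {h^{(3)}}^2+3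 w^2 h'' h^{(4)}\big)}{90 w^3 {h''}^3}{\rm d} z-\\&\frac{ \big(40 w {h''}^4+20 h' {h''}^4+10 w^2 {h''}^2 h^{(3)}+4 w^2 h' {h^{(3)}}^2-3 w^2 h' h'' h^{(4)}\big)}{90 w^3 {h''}^3}{\rm d} p+\\&\frac{1}{90 w^3 {h''}^3} \big(30 w^2 {h''}^3-30 v p {h''}^4+40 w q {h''}^4-20 h {h''}^4+20 q h' {h''}^4+10 w^2 q {h''}^2 h^{(3)}-\\&4 w^2 h {h^{(3)}}^2+4 w^2 q h' {h^{(3)}}^2+3 w^2 h h'' h^{(4)}-3 w^2 q h' h'' h^{(4)}\big){\rm d} x\\ \theta^4&=-\frac{{h''}^{4/3}}{3 w^2}{\rm d} q+\frac{v^2 {h''}^{4/3}}{9 w^4}{\rm d} y-\frac{v \big(-10 {h''}^4-4 w^2 {h^{(3)}}^2+3 w^2 h'' h^{(4)}\big)}{90 w^4 {h''}^{8/3}}{\rm d} z+\\&\frac{v \big(-10 h' {h''}^4-10 w^2 {h''}^2 h^{(3)}-4 w^2 h' {h^{(3)}}^2+3 w^2 h' h'' h^{(4)}\big)}{90 w^4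 {h''}^{8/3}}{\rm d} p-\\&\frac{v}{90 w^4 {h''}^{8/3}} \big(-30 w^2 {h''}^3+10 v p {h''}^4+10 h {h''}^4-10 q h' {h''}^4-10 w^2 q {h''}^2 h^{(3)} +\\&4 w^2 h {h^{(3)}}^2-4 w^2 q h' {h^{(3)}}^2-3 w^2 h h'' h^{(4)}+3 w^2 q h' h'' h^{(4)}\big){\rm d} x\\ \theta^5&=\frac{{\rm d} w }{{h''}^{1/3}}+\frac{\big(10 {h''}^4-10 w {h''}^2 h^{(3)}+4 w^2 {h^{(3)}}^2-3 w^2 h'' h^{(4)}\big)}{30 {h''}^{10/3}}{\rm d} q+\\&\frac{v \big(-5 {h''}^6+40 w^3 {h^{(3)}}^3-45 w^3 h'' h^{(3)} h^{(4)}+9 w^3 {h''}^2 h^{(5)}\big)}{90 w^2 {h''}^{16/3}}{\rm d} z+\\&\frac{v}{90 w^2 {h''}^{16/3}} \big(-15 w {h''}^6+5 h' {h''}^6-12 w^3 {h''}^2 {h^{(3)}}^2-40 w^3 h' {h^{(3)}}^3+9 w^3 {h''}^3 h^{(4)}+\\&45 w^3 h' h'' h^{(3)} h^{(4)}-9 w^3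 h' {h''}^2 h^{(5)}\big){\rm d} p-\frac{v}{90 w^2 {h''}^{16/3}} \big(-15 w q {h''}^6-5 h {h''}^6+5 q h' {h''}^6-\\&12 w^3 q {h''}^2 {h^{(3)}}^2+40 w^3 h {h^{(3)}}^3-40 w^3 q h' {h^{(3)}}^3+9 w^3 q {h''}^3 h^{(4)}-45 w^3 h h'' h^{(3)} h^{(4)}+\\&45 w^3 q h' h'' h^{(3)} h^{(4)}+9 w^3 h {h''}^2 h^{(5)}-9 w^3 q h' {h''}^2 h^{(5)}\big){\rm d} x\\ \theta^6&=-{\rm d} v +\frac{v^2 \big(-4 {h^{(3)}}^2+3 h'' h^{(4)}\big)}{90 w {h''}^3}{\rm d} z +\frac{v \big(10 {h''}^4-4 w^2 {h^{(3)}}^2+3 w^2 h'' h^{(4)}\big)}{30 w {h''}^3}{\rm d} q+\\&\frac{v^3 \big(40 {h^{(3)}}^3-45 h'' h^{(3)} h^{(4)}+9 {h''}^2 h^{(5)}\big)}{90 {h''}^5}{\rm d} y-\frac{v^2}{90 w^2 {h''}^5} \big(5 {h''}^6-10 w {h''}^4 h^{(3)}-\\&12 w^2 {h''}^2 {h^{(3)}}^2-4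 w h' {h''}^2 {h^{(3)}}^2+40 w^3 {h^{(3)}}^3+9 w^2 {h''}^3 h^{(4)}+3 w h' {h''}^3 h^{(4)}-45 w^3 h'' h^{(3)} h^{(4)}+\\&9 w^3 {h''}^2 h^{(5)}\big){\rm d} p-\frac{v^2}{90 w^2 {h''}^5} \big(30 w {h''}^5-5 q {h''}^6+10 w q {h''}^4 h^{(3)}+12 w^2 q {h''}^2 {h^{(3)}}^2-\\&4 w h {h''}^2 {h^{(3)}}^2+4 w q h' {h''}^2 {h^{(3)}}^2+40 v w^2 p {h^{(3)}}^3-40 w^3 q {h^{(3)}}^3-9 w^2 q {h''}^3 h^{(4)}+3 w h {h''}^3 h^{(4)}-\\&3 w q h' {h''}^3 h^{(4)}-45 v w^2 p h'' h^{(3)} h^{(4)}+45 w^3 q h'' h^{(3)} h^{(4)}+9 v w^2 p {h''}^2 h^{(5)}-9 w^3 q {h''}^2 h^{(5)}\big){\rm d} x. \end{aligned}$$ An infinitesimal symmetry of $([\lambda],[\Upsilon])$ on an open set $W\subseteq\widetilde M$ is a smooth vector field $X$ on $W$ with $(\mathcal L_X\lambda)\wedge\lambda=0$ and $\mathcal L_X\Upsilon=f\,\Upsilon+\lambda\odot\tau$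 for some function $f$ and some rank 3 tensor $\tau$ (on the part of $W$ in the dense chart). An infinitesimal symmetry of $\mathcal D_k$ is a smooth vector field $X$ on $M$ with $[X,\Gamma(\mathcal D_k)]\subseteq\Gamma(\mathcal D_k)$. The prolongation of a vector field $X$ on $M$ preserving $[\mathcal D_k,\mathcal D_k]$ and $\mathcal D_k$ is the vector field on $\widetilde M$ whose value at $(m,\ell)$ is the velocity at time $0$ of the curve $(\phi_t(m),(\phi_t)_*\ell)$, where $\phi_t$ is the flow of $X$. **Proposition.** Let $k\in\mathbb R\setminus\{2,\tfrac23,\tfrac13,0,1,-1\}$. For every non-empty connected open set $W\subseteq\widetilde M$, in particular for $W=\widetilde M$, the algebra of infinitesimal symmetries of $([\lambda],[\Upsilon])$ on $W$ is exactly 7-dimensional. It is spanned by (the restrictions to $W$ of) the vector fields $\widetilde X_1,\dots,\widetilde X_7$ on $\widetilde M$ whose expressions in the coordinates $(x,y,p,q,z,v,w)$ are $$\begin{aligned} \widetilde X_1&=\partial_x,\quad \widetilde X_2=\partial_y,\quad \widetilde X_3=\partial_z,\quad \widetilde X_4=\partial_p+x\partial_y,\\ \widetilde X_5&=x\partial_x-p\partial_p-2q\partial_q+(1-2k)z\partial_z+(1-2k)v\partial_v+2(1-k)w\partial_w,\\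 \widetilde X_6&=y\partial_y+p\partial_p+q\partial_q+kz\partial_z+(k-1)v\partial_v+(k-1)w\partial_w,\\ \widetilde X_7&=q^{k-1}\partial_x+\big(pq^{k-1}+(1-k)z\big)\partial_y+\tfrac{k-1}{k}q^k\partial_p+c_k(q)\,\partial_z+(1-k)v^2\partial_v+(1-k)vw\,\partial_w, \end{aligned}$$ where $c_k(q)=\frac{q^{2k-1}}{k(2k-1)}$ if $k\neq\frac12$, and $c_{1/2}(q)=2\log q$. Moreover, let $X_1,\dots,X_7$ be the vector fields on $M$ obtained from $\widetilde X_1,\dots,\widetilde X_7$ by omitting the $\partial_v$ and $\partial_w$ terms. Then the algebra of infinitesimal symmetries of $\mathcal D_k$ is spanned by $X_1,\dots,X_7$, and (at every point of the dense chart) $\widetilde X_i$ is the prolongation of $X_i$ for $i=1,\dots,7$. -/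

import Mathlib

open scoped ContDiff Topology

noncomputable section

namespace TwistorLieContact

/-- Coordinates `(x, y, p, q, z)` on the five-manifold `M`, in this order. -/
abbrev E5 := Fin 5 → ℝ

/-- Seven coordinates: `(x, y, p, q, z)` followed by two fibre coordinates. -/
abbrev E7 := Fin 7 → ℝ

/-- `h(q) = q ^ k / (k (k - 1))`. -/
def profile (k : ℝ) : ℝ → ℝ := fun q => q ^ k / (k * (k - 1))

/-- The five-manifold `M`, where `q > 0`, so that the real powers of `q` are smooth. -/
def base : Set E5 := {m | 0 < m 3}

/-! ### The distribution `D_h`, its derived distribution, and the twistor bundle -/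

/-- The vector field `∂_x + p ∂_y + q ∂_p + h(q) ∂_z`. -/
def xi1 (h : ℝ → ℝ) (m : E5) : E5 := ![1, m 2, m 3, 0, h (m 3)]

/-- The vector field `∂_q`. -/
def xi2 : E5 → E5 := fun _ => ![0, 0, 0, 1, 0]

/-- The rank two distribution `D_h`. -/
def distribution (h : ℝ → ℝ) (m : E5) : Submodule ℝ E5 :=
  Submodule.span ℝ {xi1 h m, xi2 m}

/-- The derived rank three distribution `[D_h, D_h]`. -/
def derivedDistribution (h : ℝ → ℝ) (m : E5) : Submodule ℝ E5 :=
  Submodule.span ℝ {xi1 h m, xi2 m, VectorField.lieBracket ℝ (xi1 h) xi2 m}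

/-- The points of `P([D_h, D_h]) \ P(D_h)` over `M`: pairs of a point `m` and a line in
`[D_h, D_h]_m` which is not contained in `(D_h)_m`. -/
def twistorBundle (h : ℝ → ℝ) : Set (E5 × Submodule ℝ E5) :=
  {a | a.1 ∈ base ∧ Module.finrank ℝ a.2 = 1 ∧ a.2 ≤ derivedDistribution h a.1 ∧
    ¬ a.2 ≤ distribution h a.1}

/-- The projection to `M` in coordinates. -/
def proj (n : E7) : E5 := ![n 0, n 1, n 2, n 3, n 4]

/-- The vector `ξ(v, w)` in `[D_h, D_h]` at the point `(x, y, p, q, z)`, for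
`n = (x, y, p, q, z, v, w)`. -/
def direction (h : ℝ → ℝ) (n : E7) : E5 :=
  xi1 h (proj n) + (n 5 / iteratedDeriv 2 h (n 3)) • ![0, 0, 0, 1, 0]
    + (n 6 / iteratedDeriv 2 h (n 3)) • ![0, 0, 1, 0, deriv h (n 3)]

/-- The point of the twistor bundle with coordinates `n = (x, y, p, q, z, v, w)`, `w ≠ 0`. -/
def twistorPoint (h : ℝ → ℝ) (n : E7) : E5 × Submodule ℝ E5 :=
  (proj n, Submodule.span ℝ {direction h n})

/-- The coordinates `(v, w)`, `w ≠ 0`, miss the lines spanned by a combination of `∂_q` and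
`∂_p + h' ∂_z` only. All of the twistor bundle is covered by the coordinates
`u = (x, y, p, q, z, s, t)`, for which the line is spanned by
`t (∂_x + p ∂_y + q ∂_p + h ∂_z) + s ∂_q + (∂_p + h' ∂_z)`. -/
def globalTwistorPoint (h : ℝ → ℝ) (u : E7) : E5 × Submodule ℝ E5 :=
  (proj u, Submodule.span ℝ
    {u 6 • xi1 h (proj u) + u 5 • ![0, 0, 0, 1, 0] + ![0, 0, 1, 0, deriv h (u 3)]})

/-- The range of the coordinates `(x, y, p, q, z, s, t)`: the whole twistor bundle. -/
def twistorDomain : Set E7 := {u | 0 < u 3}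

/-- The change of coordinates from `(x, y, p, q, z, v, w)` to `(x, y, p, q, z, s, t)`:
`s = v / w`, `t = h'' / w`. -/
def transition (h : ℝ → ℝ) (n : E7) : E7 :=
  ![n 0, n 1, n 2, n 3, n 4, n 5 / n 6, iteratedDeriv 2 h (n 3) / n 6]

/-- The part of an open subset `W` of the twistor bundle which lies in the domain of the
coordinates `(x, y, p, q, z, v, w)`; it is open and dense in `W`. -/
def chartPart (h : ℝ → ℝ) (W : Set E7) : Set E7 :=
  {n | 0 < n 3 ∧ n 6 ≠ 0 ∧ transition h n ∈ W}

theorem isOpen_twistorDomain : IsOpen twistorDomain :=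
  isOpen_lt continuous_const (continuous_apply 3)

theorem isConnected_twistorDomain : IsConnected twistorDomain := by
  have hc : Convex ℝ twistorDomain := by
    intro a ha b hb s t hs ht hst
    simp only [twistorDomain, Set.mem_ofPred_eq, Pi.add_apply, Pi.smul_apply, smul_eq_mul] at *
    rcases hs.eq_or_lt with rfl | hs
    · simp_all
    · positivity
  exact ⟨⟨fun _ => 1, by simp [twistorDomain]⟩, hc.isPreconnected⟩

/-- `transition` is the change between the two systems of coordinates. -/
theorem twistorPoint_eq (h : ℝ → ℝ) (n : E7) (hw : n 6 ≠ 0)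
    (hh : iteratedDeriv 2 h (n 3) ≠ 0) :
    twistorPoint h n = globalTwistorPoint h (transition h n) := by
  have hp : proj (transition h n) = proj n := by
    funext i; fin_cases i <;> rfl
  have hd : transition h n 6 • xi1 h (proj (transition h n))
      + transition h n 5 • ![0, 0, 0, 1, 0] + ![0, 0, 1, 0, deriv h (transition h n 3)]
      = (iteratedDeriv 2 h (n 3) / n 6) • direction h n := by
    rw [hp]
    funext i
    fin_cases i <;> simp [transition, direction, xi1, proj] <;> field_simp
  have hc : IsUnit (iteratedDeriv 2 h (n 3) / n 6) := (div_ne_zero hh hw).isUnit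
  simp only [twistorPoint, globalTwistorPoint]
  rw [hd, Submodule.span_singleton_smul_eq hc, hp]

theorem lieBracket_xi (h : ℝ → ℝ) (m : E5) (hh : DifferentiableAt ℝ h (m 3)) :
    VectorField.lieBracket ℝ (xi1 h) xi2 m = -![0, 0, 1, 0, deriv h (m 3)] := by
  have h2 : fderiv ℝ xi2 m = 0 := by
    unfold xi2; simp
  have hpr : ∀ i : Fin 5, HasFDerivAt (fun m : E5 => m i)
      (ContinuousLinearMap.proj (R := ℝ) (φ := fun _ : Fin 5 => ℝ) i) m :=
    fun i => hasFDerivAt_apply i m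
  have h1 : HasFDerivAt (xi1 h) (ContinuousLinearMap.pi
      ![0, ContinuousLinearMap.proj 2, ContinuousLinearMap.proj 3, 0,
        deriv h (m 3) • (ContinuousLinearMap.proj (R := ℝ) (φ := fun _ : Fin 5 => ℝ) 3)]) m := by
    rw [hasFDerivAt_pi']
    intro i
    fin_cases i
    · simpa [xi1] using hasFDerivAt_const (1 : ℝ) m
    · simpa [xi1] using hpr 2
    · simpa [xi1] using hpr 3
    · simpa [xi1] using hasFDerivAt_const (0 : ℝ) m
    · exact hh.hasDerivAt.comp_hasFDerivAt m (hpr 3)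
  rw [VectorField.lieBracket, h2, h1.fderiv]
  funext i
  fin_cases i <;> simp [xi2]

/-- The coordinates `(x, y, p, q, z, s, t)` parametrize the whole twistor bundle. -/
theorem bijOn_globalTwistorPoint (h : ℝ → ℝ) (hh : ∀ q, 0 < q → DifferentiableAt ℝ h q) :
    Set.BijOn (globalTwistorPoint h) twistorDomain (twistorBundle h) := by
  have hder : ∀ m ∈ base, derivedDistribution h m =
      Submodule.span ℝ {xi1 h m, xi2 m, ![0, 0, 1, 0, deriv h (m 3)]} := by
    intro m hm
    rw [derivedDistribution, lieBracket_xi h m (hh _ hm)]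
    simp only [Submodule.span_insert, ← Set.neg_singleton, Submodule.span_neg]
  have hq : ∀ u : E7, proj u 3 = u 3 := fun _ => rfl
  refine ⟨?_, ?_, ?_⟩
  · intro u hu
    have hb : proj u ∈ base := hu
    refine ⟨hb, ?_, ?_, ?_⟩
    · refine finrank_span_singleton (fun h0 => ?_)
      have a0 := congrFun h0 0
      have a2 := congrFun h0 2
      simp [xi1] at a0 a2
      simp [a0] at a2
    · simp only [globalTwistorPoint]
      rw [hder _ hb, Submodule.span_singleton_le_iff_mem]
      refine add_mem (add_mem ?_ ?_) ?_
      · exact Submodule.smul_mem _ _ (Submodule.subset_span (by simp))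
      · exact Submodule.smul_mem _ _ (Submodule.subset_span (by simp [xi2]))
      · exact Submodule.subset_span (by simp [hq])
    · simp only [globalTwistorPoint, distribution]
      rw [Submodule.span_singleton_le_iff_mem, Submodule.mem_span_pair]
      rintro ⟨a, b, hab⟩
      have a0 := congrFun hab 0
      have a2 := congrFun hab 2
      simp [xi1, xi2] at a0 a2
      rw [a0] at a2
      linarith
  · intro u _ u' _ he
    simp only [globalTwistorPoint, Prod.mk.injEq] at he
    obtain ⟨he, hs⟩ := he
    have e3 : u 3 = u' 3 := congrFun he 3
    have hm := hs ▸ Submodule.mem_span_singleton_self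
      (u 6 • xi1 h (proj u) + u 5 • ![0, 0, 0, 1, 0] + ![0, 0, 1, 0, deriv h (u 3)] : E5)
    rw [← he, ← e3] at hm
    obtain ⟨c, hc⟩ := Submodule.mem_span_singleton.1 hm
    have c0 := congrFun hc 0
    have c2 := congrFun hc 2
    have c3 := congrFun hc 3
    simp only [xi1, proj, Pi.add_apply, Pi.smul_apply, smul_eq_mul, Matrix.cons_val] at c0 c2 c3
    have hc1 : c = 1 := by linear_combination c2 - u 3 * c0
    subst hc1
    funext i
    fin_cases i
    · exact congrFun he 0
    · exact congrFun he 1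
    · exact congrFun he 2
    · exact congrFun he 3
    · exact congrFun he 4
    · change u 5 = u' 5
      linear_combination -c3
    · change u 6 = u' 6
      linear_combination -c0
  · rintro ⟨m, l⟩ ⟨hm, hl, hle, hnle⟩
    simp only at hm hl hle hnle
    obtain ⟨⟨v, hv⟩, -, hspan⟩ := finrank_eq_one_iff'.1 hl
    have hlv : l = Submodule.span ℝ {v} := by
      refine le_antisymm (fun y hy => ?_) ((Submodule.span_singleton_le_iff_mem _ _).2 hv)
      obtain ⟨c, hc⟩ := hspan ⟨y, hy⟩
      exact Submodule.mem_span_singleton.2 ⟨c, congrArg Subtype.val hc⟩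
    have hv' := hle hv
    rw [hder m hm, Submodule.mem_span_triple] at hv'
    obtain ⟨a, b, c, habc⟩ := hv'
    have hc : c ≠ 0 := by
      rintro rfl
      apply hnle
      rw [hlv, Submodule.span_singleton_le_iff_mem, distribution, Submodule.mem_span_pair]
      exact ⟨a, b, by simpa using habc⟩
    have hp : proj ![m 0, m 1, m 2, m 3, m 4, b / c, a / c] = m := by
      funext i; fin_cases i <;> rfl
    refine ⟨![m 0, m 1, m 2, m 3, m 4, b / c, a / c], hm, ?_⟩
    simp only [globalTwistorPoint]
    rw [hp, hlv, ← habc]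
    refine Prod.ext rfl ?_
    simp only
    rw [← Submodule.span_singleton_smul_eq hc.isUnit]
    congr 2
    simp only [smul_add, smul_smul, xi2, Matrix.cons_val]
    rw [mul_div_cancel₀ _ hc, mul_div_cancel₀ _ hc]

/-! ### The tensors `λ` and `Υ`

A symmetric tensor field of rank `r` is given by the functions `(n, ξ) ↦ F n ξ`, homogeneous
polynomials of degree `r` in the tangent vector `ξ`; so `dx, dy, dp, dq, dz, dv, dw` are
`ξ 0, …, ξ 6`, and symmetric products of forms are products of functions. -/

/-- The contact form
`λ = dz - (w + q^(k-1)/(k-1)) dp + v dy + (w q - v p + q^k/k) dx`. -/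
def lam (k : ℝ) (n ξ : E7) : ℝ :=
  let p := n 2; let q := n 3; let v := n 5; let w := n 6;
  ξ 4 - (w + q ^ (k - 1) / (k - 1)) * ξ 2 + v * ξ 1 + (w * q - v * p + q ^ k / k) * ξ 0

def theta1 (h : ℝ → ℝ) (n ξ : E7) : ℝ :=
  let p := n 2; let w := n 6; let h2 := iteratedDeriv 2 h (n 3);
  -(p * h2 ^ (4 / 3 : ℝ) / (27 * w ^ 4)) * ξ 0 + h2 ^ (4 / 3 : ℝ) / (27 * w ^ 4) * ξ 1

def theta2 (h : ℝ → ℝ) (n ξ : E7) : ℝ :=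
  let p := n 2; let q := n 3; let v := n 5; let w := n 6
  let h0 := h q; let h1 := deriv h q; let h2 := iteratedDeriv 2 h q;
  v * h2 ^ (5 / 3 : ℝ) / (27 * w ^ 5) * ξ 1 + h2 ^ (5 / 3 : ℝ) / (27 * w ^ 5) * ξ 4
    - h1 * h2 ^ (5 / 3 : ℝ) / (27 * w ^ 5) * ξ 2
    - (v * p + h0 - q * h1) * h2 ^ (5 / 3 : ℝ) / (27 * w ^ 5) * ξ 0

def theta3 (h : ℝ → ℝ) (n ξ : E7) : ℝ :=
  let p := n 2; let q := n 3; let v := n 5; let w := n 6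
  let h0 := h q; let h1 := deriv h q; let h2 := iteratedDeriv 2 h q
  let h3 := iteratedDeriv 3 h q; let h4 := iteratedDeriv 4 h q;
  v * h2 / (3 * w ^ 3) * ξ 1
    - (-20 * h2 ^ 4 - 4 * w ^ 2 * h3 ^ 2 + 3 * w ^ 2 * h2 * h4) / (90 * w ^ 3 * h2 ^ 3) * ξ 4
    - (40 * w * h2 ^ 4 + 20 * h1 * h2 ^ 4 + 10 * w ^ 2 * h2 ^ 2 * h3 + 4 * w ^ 2 * h1 * h3 ^ 2
        - 3 * w ^ 2 * h1 * h2 * h4) / (90 * w ^ 3 * h2 ^ 3) * ξ 2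
    + 1 / (90 * w ^ 3 * h2 ^ 3) * (30 * w ^ 2 * h2 ^ 3 - 30 * v * p * h2 ^ 4 + 40 * w * q * h2 ^ 4
        - 20 * h0 * h2 ^ 4 + 20 * q * h1 * h2 ^ 4 + 10 * w ^ 2 * q * h2 ^ 2 * h3
        - 4 * w ^ 2 * h0 * h3 ^ 2 + 4 * w ^ 2 * q * h1 * h3 ^ 2 + 3 * w ^ 2 * h0 * h2 * h4
        - 3 * w ^ 2 * q * h1 * h2 * h4) * ξ 0

def theta4 (h : ℝ → ℝ) (n ξ : E7) : ℝ :=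
  let p := n 2; let q := n 3; let v := n 5; let w := n 6
  let h0 := h q; let h1 := deriv h q; let h2 := iteratedDeriv 2 h q
  let h3 := iteratedDeriv 3 h q; let h4 := iteratedDeriv 4 h q;
  -(h2 ^ (4 / 3 : ℝ) / (3 * w ^ 2)) * ξ 3 + v ^ 2 * h2 ^ (4 / 3 : ℝ) / (9 * w ^ 4) * ξ 1
    - v * (-10 * h2 ^ 4 - 4 * w ^ 2 * h3 ^ 2 + 3 * w ^ 2 * h2 * h4)
        / (90 * w ^ 4 * h2 ^ (8 / 3 : ℝ)) * ξ 4
    + v * (-10 * h1 * h2 ^ 4 - 10 * w ^ 2 * h2 ^ 2 * h3 - 4 * w ^ 2 * h1 * h3 ^ 2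
        + 3 * w ^ 2 * h1 * h2 * h4) / (90 * w ^ 4 * h2 ^ (8 / 3 : ℝ)) * ξ 2
    - v / (90 * w ^ 4 * h2 ^ (8 / 3 : ℝ)) * (-30 * w ^ 2 * h2 ^ 3 + 10 * v * p * h2 ^ 4
        + 10 * h0 * h2 ^ 4 - 10 * q * h1 * h2 ^ 4 - 10 * w ^ 2 * q * h2 ^ 2 * h3
        + 4 * w ^ 2 * h0 * h3 ^ 2 - 4 * w ^ 2 * q * h1 * h3 ^ 2 - 3 * w ^ 2 * h0 * h2 * h4
        + 3 * w ^ 2 * q * h1 * h2 * h4) * ξ 0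

def theta5 (h : ℝ → ℝ) (n ξ : E7) : ℝ :=
  let q := n 3; let v := n 5; let w := n 6
  let h0 := h q; let h1 := deriv h q; let h2 := iteratedDeriv 2 h q
  let h3 := iteratedDeriv 3 h q; let h4 := iteratedDeriv 4 h q; let h5 := iteratedDeriv 5 h q;
  1 / h2 ^ (1 / 3 : ℝ) * ξ 6
    + (10 * h2 ^ 4 - 10 * w * h2 ^ 2 * h3 + 4 * w ^ 2 * h3 ^ 2 - 3 * w ^ 2 * h2 * h4)
        / (30 * h2 ^ (10 / 3 : ℝ)) * ξ 3
    + v * (-5 * h2 ^ 6 + 40 * w ^ 3 * h3 ^ 3 - 45 * w ^ 3 * h2 * h3 * h4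
        + 9 * w ^ 3 * h2 ^ 2 * h5) / (90 * w ^ 2 * h2 ^ (16 / 3 : ℝ)) * ξ 4
    + v / (90 * w ^ 2 * h2 ^ (16 / 3 : ℝ)) * (-15 * w * h2 ^ 6 + 5 * h1 * h2 ^ 6
        - 12 * w ^ 3 * h2 ^ 2 * h3 ^ 2 - 40 * w ^ 3 * h1 * h3 ^ 3 + 9 * w ^ 3 * h2 ^ 3 * h4
        + 45 * w ^ 3 * h1 * h2 * h3 * h4 - 9 * w ^ 3 * h1 * h2 ^ 2 * h5) * ξ 2
    - v / (90 * w ^ 2 * h2 ^ (16 / 3 : ℝ)) * (-15 * w * q * h2 ^ 6 - 5 * h0 * h2 ^ 6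
        + 5 * q * h1 * h2 ^ 6 - 12 * w ^ 3 * q * h2 ^ 2 * h3 ^ 2 + 40 * w ^ 3 * h0 * h3 ^ 3
        - 40 * w ^ 3 * q * h1 * h3 ^ 3 + 9 * w ^ 3 * q * h2 ^ 3 * h4
        - 45 * w ^ 3 * h0 * h2 * h3 * h4 + 45 * w ^ 3 * q * h1 * h2 * h3 * h4
        + 9 * w ^ 3 * h0 * h2 ^ 2 * h5 - 9 * w ^ 3 * q * h1 * h2 ^ 2 * h5) * ξ 0

def theta6 (h : ℝ → ℝ) (n ξ : E7) : ℝ :=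
  let p := n 2; let q := n 3; let v := n 5; let w := n 6
  let h0 := h q; let h1 := deriv h q; let h2 := iteratedDeriv 2 h q
  let h3 := iteratedDeriv 3 h q; let h4 := iteratedDeriv 4 h q; let h5 := iteratedDeriv 5 h q;
  -ξ 5 + v ^ 2 * (-4 * h3 ^ 2 + 3 * h2 * h4) / (90 * w * h2 ^ 3) * ξ 4
    + v * (10 * h2 ^ 4 - 4 * w ^ 2 * h3 ^ 2 + 3 * w ^ 2 * h2 * h4) / (30 * w * h2 ^ 3) * ξ 3
    + v ^ 3 * (40 * h3 ^ 3 - 45 * h2 * h3 * h4 + 9 * h2 ^ 2 * h5) / (90 * h2 ^ 5) * ξ 1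
    - v ^ 2 / (90 * w ^ 2 * h2 ^ 5) * (5 * h2 ^ 6 - 10 * w * h2 ^ 4 * h3
        - 12 * w ^ 2 * h2 ^ 2 * h3 ^ 2 - 4 * w * h1 * h2 ^ 2 * h3 ^ 2 + 40 * w ^ 3 * h3 ^ 3
        + 9 * w ^ 2 * h2 ^ 3 * h4 + 3 * w * h1 * h2 ^ 3 * h4 - 45 * w ^ 3 * h2 * h3 * h4
        + 9 * w ^ 3 * h2 ^ 2 * h5) * ξ 2
    - v ^ 2 / (90 * w ^ 2 * h2 ^ 5) * (30 * w * h2 ^ 5 - 5 * q * h2 ^ 6 + 10 * w * q * h2 ^ 4 * h3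
        + 12 * w ^ 2 * q * h2 ^ 2 * h3 ^ 2 - 4 * w * h0 * h2 ^ 2 * h3 ^ 2
        + 4 * w * q * h1 * h2 ^ 2 * h3 ^ 2 + 40 * v * w ^ 2 * p * h3 ^ 3 - 40 * w ^ 3 * q * h3 ^ 3
        - 9 * w ^ 2 * q * h2 ^ 3 * h4 + 3 * w * h0 * h2 ^ 3 * h4 - 3 * w * q * h1 * h2 ^ 3 * h4
        - 45 * v * w ^ 2 * p * h2 * h3 * h4 + 45 * w ^ 3 * q * h2 * h3 * h4
        + 9 * v * w ^ 2 * p * h2 ^ 2 * h5 - 9 * w ^ 3 * q * h2 ^ 2 * h5) * ξ 0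

/-- The symmetric rank four tensor `Υ`. -/
def upsilon (h : ℝ → ℝ) (n ξ : E7) : ℝ :=
  let t1 := theta1 h n ξ; let t2 := theta2 h n ξ; let t3 := theta3 h n ξ
  let t4 := theta4 h n ξ; let t5 := theta5 h n ξ; let t6 := theta6 h n ξ;
  2 * t2 * t3 ^ 2 * t6 - 3 * t1 ^ 2 * t6 ^ 2 - 2 * t1 * t3 * t4 * t6 - 6 * t1 * t2 * t5 * t6
    + 2 * t2 * t3 * t4 * t5 - 2 * t1 * t4 ^ 2 * t5 - 3 * t2 ^ 2 * t5 ^ 2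

/-! ### Infinitesimal symmetries -/

/-- The Lie derivative along `X` of a symmetric tensor field `F` (as above, of any rank):
`(L_X F)(ξ) = X (F(ξ)) + r F(D_ξ X, ξ, …, ξ)` for constant `ξ`. -/
def lieDerivative (X : E7 → E7) (F : E7 → E7 → ℝ) (n ξ : E7) : ℝ :=
  fderiv ℝ (fun n' => F n' ξ) n (X n) + fderiv ℝ (F n) ξ (fderiv ℝ X n ξ)

/-- The symmetry equations of `([λ], [Υ])` at a point:
`(L_X λ) ∧ λ = 0` and `L_X Υ = f Υ + λ ⊙ τ` for a number `f` and a rank three tensor `τ`. -/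
def SymmetryEquationsAt (k : ℝ) (X : E7 → E7) (n : E7) : Prop :=
  (∀ ξ η : E7,
    lieDerivative X (lam k) n ξ * lam k n η - lieDerivative X (lam k) n η * lam k n ξ = 0) ∧
  ∃ (f : ℝ) (τ : MultilinearMap ℝ (fun _ : Fin 3 => E7) ℝ), ∀ ξ : E7,
    lieDerivative X (upsilon (profile k)) n ξ =
      f * upsilon (profile k) n ξ + lam k n ξ * τ (fun _ => ξ)

theorem lieDerivative_add {X Y : E7 → E7} {F : E7 → E7 → ℝ} {n : E7}
    (hX : DifferentiableAt ℝ X n) (hY : DifferentiableAt ℝ Y n) (ξ : E7) :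
    lieDerivative (X + Y) F n ξ = lieDerivative X F n ξ + lieDerivative Y F n ξ := by
  simp only [lieDerivative, Pi.add_apply, map_add, fderiv_add hX hY,
    add_apply]
  ring

theorem lieDerivative_smul {X : E7 → E7} {F : E7 → E7 → ℝ} {n : E7}
    (hX : DifferentiableAt ℝ X n) (c : ℝ) (ξ : E7) :
    lieDerivative (c • X) F n ξ = c * lieDerivative X F n ξ := by
  simp only [lieDerivative, Pi.smul_apply, map_smul, fderiv_const_smul hX c,
    smul_apply, smul_eq_mul]
  ring

/-- The infinitesimal symmetries of `([λ], [Υ])` on an open subset `W` of the twistor bundle (in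
the coordinates `(x, y, p, q, z, s, t)`). A vector field on `W` is given by its expression `X` in
the coordinates `(x, y, p, q, z, v, w)`, extended by zero outside `chartPart`; the condition that
it is a smooth vector field on all of `W` says that its expression in the coordinates
`(x, y, p, q, z, s, t)` extends to a smooth `Y` on `W`. As `chartPart` is dense in `W`, it is enough
to impose the symmetry equations there. -/
def symmetryAlgebra (k : ℝ) (W : Set E7) : Submodule ℝ (E7 → E7) where
  carrier := {X | (∀ n ∉ chartPart (profile k) W, X n = 0) ∧
    (∀ n ∈ chartPart (profile k) W, ContDiffAt ℝ ∞ X n) ∧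
    (∃ Y : E7 → E7, ContDiffOn ℝ ∞ Y W ∧ ∀ n ∈ chartPart (profile k) W,
      fderiv ℝ (transition (profile k)) n (X n) = Y (transition (profile k) n)) ∧
    ∀ n ∈ chartPart (profile k) W, SymmetryEquationsAt k X n}
  zero_mem' := by
    refine ⟨fun _ _ => rfl, fun _ _ => contDiffAt_const, ⟨0, contDiffOn_const, by simp⟩, ?_⟩
    intro n _
    have h0 : ∀ (F : E7 → E7 → ℝ) (ξ : E7), lieDerivative 0 F n ξ = 0 := by
      intro F ξ
      simp [lieDerivative]
    exact ⟨by simp [h0], 0, 0, by simp [h0]⟩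
  add_mem' := by
    rintro X X' ⟨h1, h2, ⟨Y, h3, h3'⟩, h4⟩ ⟨g1, g2, ⟨Y', g3, g3'⟩, g4⟩
    refine ⟨fun n hn => by simp [h1 n hn, g1 n hn], fun n hn => (h2 n hn).add (g2 n hn),
      ⟨Y + Y', h3.add g3, fun n hn => by simp [h3' n hn, g3' n hn]⟩, ?_⟩
    intro n hn
    have dX := (h2 n hn).differentiableAt (by simp)
    have dX' := (g2 n hn).differentiableAt (by simp)
    obtain ⟨a1, f, τ, a2⟩ := h4 n hn
    obtain ⟨b1, f', τ', b2⟩ := g4 n hn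
    refine ⟨fun ξ η => ?_, f + f', τ + τ', fun ξ => ?_⟩
    · rw [lieDerivative_add dX dX', lieDerivative_add dX dX']
      linear_combination a1 ξ η + b1 ξ η
    · rw [lieDerivative_add dX dX', a2, b2, add_apply]
      ring
  smul_mem' := by
    rintro c X ⟨h1, h2, ⟨Y, h3, h3'⟩, h4⟩
    refine ⟨fun n hn => by simp [h1 n hn], fun n hn => (h2 n hn).const_smul c,
      ⟨c • Y, h3.const_smul c, fun n hn => by simp [h3' n hn]⟩, ?_⟩
    intro n hn
    have dX := (h2 n hn).differentiableAt (by simp)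
    obtain ⟨a1, f, τ, a2⟩ := h4 n hn
    refine ⟨fun ξ η => ?_, c * f, c • τ, fun ξ => ?_⟩
    · rw [lieDerivative_smul dX, lieDerivative_smul dX]
      linear_combination c * a1 ξ η
    · rw [lieDerivative_smul dX, a2, smul_apply, smul_eq_mul]
      ring

/-- The infinitesimal symmetries of the distribution `D_h` on `M` (extended by zero outside `M`):
smooth vector fields whose bracket with every section of `D_h` is a section of `D_h`. -/
def distributionSymmetries (h : ℝ → ℝ) : Submodule ℝ (E5 → E5) where
  carrier := {X | (∀ m ∉ base, X m = 0) ∧ (∀ m ∈ base, ContDiffAt ℝ ∞ X m) ∧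
    ∀ Z : E5 → E5, ContDiffOn ℝ ∞ Z base → (∀ m ∈ base, Z m ∈ distribution h m) →
      ∀ m ∈ base, VectorField.lieBracket ℝ X Z m ∈ distribution h m}
  zero_mem' := by
    refine ⟨fun _ _ => rfl, fun _ _ => contDiffAt_const, fun Z _ _ m _ => ?_⟩
    simp [VectorField.lieBracket]
  add_mem' := by
    rintro X X' ⟨h1, h2, h3⟩ ⟨g1, g2, g3⟩
    refine ⟨fun n hn => by simp [h1 n hn, g1 n hn], fun n hn => (h2 n hn).add (g2 n hn), ?_⟩
    intro Z hZ hZ' m hm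
    rw [VectorField.lieBracket_add_left ((h2 m hm).differentiableAt (by simp))
      ((g2 m hm).differentiableAt (by simp))]
    exact add_mem (h3 Z hZ hZ' m hm) (g3 Z hZ hZ' m hm)
  smul_mem' := by
    rintro c X ⟨h1, h2, h3⟩
    refine ⟨fun n hn => by simp [h1 n hn], fun n hn => (h2 n hn).const_smul c, ?_⟩
    intro Z hZ hZ' m hm
    rw [VectorField.lieBracket_const_smul_left ((h2 m hm).differentiableAt (by simp))]
    exact Submodule.smul_mem _ _ (h3 Z hZ hZ' m hm)

/-! ### The explicit vector fields and the prolongation -/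

/-- The antiderivative `q^(2k-1) / (k (2k-1))` of `q^(2k-2) / k`, which is `log q / k` if
`k = 1/2`. -/
def zCoeff (k q : ℝ) : ℝ :=
  if k = 1 / 2 then Real.log q / k else q ^ (2 * k - 1) / (k * (2 * k - 1))

/-- The vector fields `X_1, …, X_7` on `M`. -/
def fieldX (k : ℝ) (i : Fin 7) (m : E5) : E5 :=
  let x := m 0; let y := m 1; let p := m 2; let q := m 3; let z := m 4;
  match i with
  | 0 => ![1, 0, 0, 0, 0]
  | 1 => ![0, 1, 0, 0, 0]
  | 2 => ![0, 0, 0, 0, 1]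
  | 3 => ![0, x, 1, 0, 0]
  | 4 => ![x, 0, -p, -2 * q, (1 - 2 * k) * z]
  | 5 => ![0, y, p, q, k * z]
  | 6 => ![q ^ (k - 1), p * q ^ (k - 1) + (1 - k) * z, (k - 1) / k * q ^ k, 0, zCoeff k q]

/-- The vector fields `X̃_1, …, X̃_7` on the twistor bundle, in the coordinates
`(x, y, p, q, z, v, w)`. -/
def fieldXt (k : ℝ) (i : Fin 7) (n : E7) : E7 :=
  let x := n 0; let y := n 1; let p := n 2; let q := n 3; let z := n 4; let v := n 5; let w := n 6;
  match i with
  | 0 => ![1, 0, 0, 0, 0, 0, 0]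
  | 1 => ![0, 1, 0, 0, 0, 0, 0]
  | 2 => ![0, 0, 0, 0, 1, 0, 0]
  | 3 => ![0, x, 1, 0, 0, 0, 0]
  | 4 => ![x, 0, -p, -2 * q, (1 - 2 * k) * z, (1 - 2 * k) * v, 2 * (1 - k) * w]
  | 5 => ![0, y, p, q, k * z, (k - 1) * v, (k - 1) * w]
  | 6 => ![q ^ (k - 1), p * q ^ (k - 1) + (1 - k) * z, (k - 1) / k * q ^ k, 0, zCoeff k q,
      (1 - k) * v ^ 2, (1 - k) * v * w]

/-- `Φ` is a local flow of the vector field `X` near `m`. -/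
structure IsLocalFlow (X : E5 → E5) (Φ : ℝ → E5 → E5) (m : E5) : Prop where
  smooth : ContDiffAt ℝ ∞ (fun a : ℝ × E5 => Φ a.1 a.2) (0, m)
  initial : ∀ᶠ m' in 𝓝 m, Φ 0 m' = m'
  hasDerivAt : ∀ᶠ a in 𝓝 ((0 : ℝ), m), HasDerivAt (fun t => Φ t a.2) (X (Φ a.1 a.2)) a.1

/-- The value at `n = (x, y, p, q, z, v, w)` of the prolongation of `X` is the tangent vector `Y`:
transport the line at `n` by the flow of `X`, and take the velocity at time `0` of the resulting
curve in the twistor bundle. -/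
def IsProlongationAt (h : ℝ → ℝ) (X : E5 → E5) (n Y : E7) : Prop :=
  ∃ (Φ : ℝ → E5 → E5) (γ : ℝ → E7), IsLocalFlow X Φ (proj n) ∧ γ 0 = n ∧ HasDerivAt γ Y 0 ∧
    ∀ᶠ t in 𝓝 (0 : ℝ), twistorPoint h (γ t) =
      (Φ t (proj n),
        (twistorPoint h n).2.map (fderiv ℝ (Φ t) (proj n) : E5 →ₗ[ℝ] E5))

end TwistorLieContact

end

open scoped ContDiff Topology

noncomputable section

namespace TwistorLieContact


/-! Write η₁ = dy − p dx, η₂ = dp − q dx, η₃ = dz − h' dp + (q^k/k) dx. These forms annihilate D_k,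
and λ = η₃ + vη₁ − wη₂. A vector field X on the twistor bundle is studied through a = η₃(X), b =
η₁(X), c = η₂(X) (`compA`, `compB`, `compC`).

On the six-dimensional space ker λ the tensor Υ is, up to a nonvanishing factor, 2m P₀₁P₁₂ − P₀₂²
with m = 1/t, where the P are the 2 × 2 minors of a 2 × 3 matrix of one-forms, the `coframe`
(`upsilon_of_mem_contact`). A symmetry is therefore a contact field whose action on the coframe
modulo λ is a matrix preserving this quartic infinitesimally up to scale. Comparison of coefficients
in the quartic forces several entries of that matrix to vanish or to coincide
(`stabilizer_equations`, `structure_equations`).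

The entries on vertical vectors, with the contact condition, show that a, b, c do not depend on v
and w. Differentiating the contact condition in v and w then splits it (`reduced_equations`): with
ξ₁ = ∂_x + p∂_y + q∂_p + h∂_z, b_q = 0, ξ₁a = 0, a_q = −h'' ξ₁b, while the components of X are
expressed by a, b, c and their derivatives. A symmetry of D_k satisfies the same three equations and
moreover c = ξ₁b.

To solve the system, the q-dependence of a is integrated explicitly, because b does not involve q.
Then ξ₁a = 0 is a linear relation between powers of q, with logarithms when k = 1/2, and for the
admitted k its coefficients can be compared (`power_coefficients`). The resulting equations leave
seven constants, realized by X̃₁, …, X̃₇ (`exists_coefficients`).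

After subtraction of a combination of the X̃ᵢ one has a = b = 0, and c must be shown to vanish. For
D_k this is immediate from c = ξ₁b. On the twistor bundle one more entry of the stabilizer matrix is
needed: its part quadratic in s = v/w is a relation between c and c_qq, and its dependence on w
leaves c times a multiple of (k − 2)(k + 1)(3k − 1)(3k − 2), so c = 0 (`compC_eq_zero`). This
settles the question on boxes in the dense chart.

The coefficients are locally constant and are continued across the hypersurface t = 0, which the (v,
w)-chart misses, by continuity and by the fact that the Xᵢ do not involve the fibre coordinates
(`exists_agreesNear_of_eq_zero`). Conversely, the X̃ᵢ act on the coframe by matrices scaling the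
quartic, and they extend smoothly over t = 0. The prolongations are computed from explicit flows. -/

/-! ### Partial derivatives -/

/-- The `i`-th partial derivative. -/
def pd (i : Fin 7) (g : E7 → ℝ) (n : E7) : ℝ := fderiv ℝ g n (Pi.single i 1)

theorem fderiv_eq_sum_pd (g : E7 → ℝ) (n ξ : E7) :
    fderiv ℝ g n ξ = ∑ i, ξ i * pd i g n := by
  conv_lhs => rw [← Finset.univ_sum_single ξ, map_sum]
  refine Finset.sum_congr rfl fun i _ => ?_
  have : (Pi.single i (ξ i) : E7) = ξ i • Pi.single i (1 : ℝ) := by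
    rw [← Pi.single_smul, smul_eq_mul, mul_one]
  rw [this, map_smul, pd, smul_eq_mul]

theorem fderiv_eq_pd (g : E7 → ℝ) (n ξ : E7) :
    fderiv ℝ g n ξ = ξ 0 * pd 0 g n + ξ 1 * pd 1 g n + ξ 2 * pd 2 g n + ξ 3 * pd 3 g n
      + ξ 4 * pd 4 g n + ξ 5 * pd 5 g n + ξ 6 * pd 6 g n := by
  rw [fderiv_eq_sum_pd, Fin.sum_univ_seven]

/-- Smoothness at every point of a set. -/
def SmoothOn (B : Set E7) (g : E7 → ℝ) : Prop := ∀ n ∈ B, ContDiffAt ℝ ∞ g n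

theorem SmoothOn.differentiableAt {B : Set E7} {g : E7 → ℝ} (h : SmoothOn B g) {n : E7}
    (hn : n ∈ B) : DifferentiableAt ℝ g n :=
  (h n hn).differentiableAt (by simp)

theorem SmoothOn.pd {B : Set E7} {g : E7 → ℝ} (h : SmoothOn B g) (i : Fin 7) :
    SmoothOn B (pd i g) := by
  intro n hn
  have h1 : ContDiffAt ℝ ∞ (fderiv ℝ g) n := (h n hn).fderiv_right le_rfl
  exact h1.clm_apply contDiffAt_const

theorem SmoothOn.pd_comm {B : Set E7} {g : E7 → ℝ} (h : SmoothOn B g) (i j : Fin 7) {n : E7}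
    (hn : n ∈ B) : TwistorLieContact.pd i (TwistorLieContact.pd j g) n =
      TwistorLieContact.pd j (TwistorLieContact.pd i g) n := by
  have h1 : DifferentiableAt ℝ (fderiv ℝ g) n :=
    ((h n hn).fderiv_right (m := ∞) le_rfl).differentiableAt (by simp)
  have key : ∀ ξ η : E7, fderiv ℝ (fun n => fderiv ℝ g n η) n ξ = fderiv ℝ (fderiv ℝ g) n ξ η := by
    intro ξ η
    have := (h1.hasFDerivAt.clm_apply (hasFDerivAt_const η n)).fderiv
    rw [this]
    simp
  have hs : IsSymmSndFDerivAt ℝ g n := (h n hn).isSymmSndFDerivAt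
    (by simpa using WithTop.coe_le_coe.2 (le_top : (2 : ℕ∞) ≤ ⊤))
  change fderiv ℝ (fun n => fderiv ℝ g n _) n _ = fderiv ℝ (fun n => fderiv ℝ g n _) n _
  rw [key, key]
  exact hs _ _

theorem pd_congr {B : Set E7} (hB : IsOpen B) {f g : E7 → ℝ} (h : ∀ n ∈ B, f n = g n) (i : Fin 7)
    {n : E7} (hn : n ∈ B) : pd i f n = pd i g n := by
  have : f =ᶠ[𝓝 n] g := Filter.eventuallyEq_of_mem (hB.mem_nhds hn) h
  rw [pd, pd, this.fderiv_eq]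

theorem pd_eq_zero_of_const {B : Set E7} (hB : IsOpen B) {f : E7 → ℝ} {c : ℝ}
    (h : ∀ n ∈ B, f n = c) (i : Fin 7) {n : E7} (hn : n ∈ B) : pd i f n = 0 := by
  rw [pd_congr hB h i hn]
  simp [pd]

@[simp] theorem pd_const (i : Fin 7) (c : ℝ) (n : E7) : pd i (fun _ => c) n = 0 := by
  simp [pd]

theorem pd_add {i : Fin 7} {f g : E7 → ℝ} {n : E7} (hf : DifferentiableAt ℝ f n)
    (hg : DifferentiableAt ℝ g n) : pd i (fun n => f n + g n) n = pd i f n + pd i g n := by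
  simp [pd, fderiv_fun_add hf hg]

theorem pd_sub {i : Fin 7} {f g : E7 → ℝ} {n : E7} (hf : DifferentiableAt ℝ f n)
    (hg : DifferentiableAt ℝ g n) : pd i (fun n => f n - g n) n = pd i f n - pd i g n := by
  simp [pd, fderiv_fun_sub hf hg]

theorem pd_mul {i : Fin 7} {f g : E7 → ℝ} {n : E7} (hf : DifferentiableAt ℝ f n)
    (hg : DifferentiableAt ℝ g n) :
    pd i (fun n => f n * g n) n = f n * pd i g n + g n * pd i f n := by
  simp [pd, fderiv_fun_mul hf hg]

theorem pd_const_mul {i : Fin 7} {f : E7 → ℝ} {n : E7} (c : ℝ) (hf : DifferentiableAt ℝ f n) :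
    pd i (fun n => c * f n) n = c * pd i f n := by
  rw [pd_mul (differentiableAt_const c) hf]; simp

theorem pd_coord (i j : Fin 7) (n : E7) : pd i (fun n => n j) n = if j = i then 1 else 0 := by
  have : HasFDerivAt (fun n : E7 => n j)
    (ContinuousLinearMap.proj (R := ℝ) (φ := fun _ : Fin 7 => ℝ) j) n := hasFDerivAt_apply j n
  rw [pd, this.fderiv]
  simp [Pi.single_apply]

theorem pd_comp {i j : Fin 7} {φ : ℝ → ℝ} {d : ℝ} {n : E7} (h : HasDerivAt φ d (n j)) :
    pd i (fun n => φ (n j)) n = if j = i then d else 0 := by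
  have h1 : HasFDerivAt (fun n : E7 => n j)
    (ContinuousLinearMap.proj (R := ℝ) (φ := fun _ : Fin 7 => ℝ) j) n := hasFDerivAt_apply j n
  have h2 : HasFDerivAt (fun n : E7 => φ (n j)) _ n := h.comp_hasFDerivAt n h1
  rw [pd, h2.fderiv]
  simp [Pi.single_apply]

theorem differentiableAt_coord (j : Fin 7) (n : E7) :
    DifferentiableAt ℝ (fun n : E7 => n j) n :=
  (hasFDerivAt_apply j n).differentiableAt

theorem SmoothOn.coord {B : Set E7} (j : Fin 7) : SmoothOn B fun n => n j :=
  fun _ _ => contDiffAt_apply ℝ ℝ j _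

/-- A function is unchanged between two points of a convex set which only differ in coordinates
along which its derivative vanishes. -/
theorem eq_of_pd_eq_zero {B : Set E7} (hB : Convex ℝ B) {g : E7 → ℝ} (hg : SmoothOn B g)
    {m n : E7} (hm : m ∈ B) (hn : n ∈ B)
    (h : ∀ i, m i = n i ∨ ∀ x ∈ B, TwistorLieContact.pd i g x = 0) : g m = g n := by
  obtain ⟨z, hz, hz'⟩ := domain_mvt (f := g) (s := B) (f' := fun x => fderiv ℝ g x)
    (fun x hx => (hg.differentiableAt hx).hasFDerivAt.hasFDerivWithinAt) hB hn hm
  have hzB := hB.segment_subset hn hm hz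
  rw [fderiv_eq_sum_pd, Finset.sum_eq_zero] at hz'
  · linarith
  · intro i _
    rcases h i with h | h
    · simp [h]
    · simp [h z hzB]

theorem exists_const {B : Set E7} (hB : Convex ℝ B) {g : E7 → ℝ} (hg : SmoothOn B g)
    (h : ∀ n ∈ B, ∀ i, TwistorLieContact.pd i g n = 0) : ∃ c, ∀ n ∈ B, g n = c := by
  rcases B.eq_empty_or_nonempty with rfl | ⟨m, hm⟩
  · exact ⟨0, by simp⟩
  · exact ⟨g m, fun n hn => eq_of_pd_eq_zero hB hg hn hm fun i => Or.inr fun x hx => h x hx i⟩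

/-- An open convex set which is a product of intervals. -/
structure IsBox (B : Set E7) : Prop where
  isOpen : IsOpen B
  convex : Convex ℝ B
  nonempty : B.Nonempty
  update_mem : ∀ m ∈ B, ∀ n ∈ B, ∀ i, Function.update m i (n i) ∈ B

/-! ### Independence of powers and logarithms -/

/-- Induction on the number of exponents. Division by the exponential of the new exponent makes its
term affine in t, and two derivatives annihilate it. The same operation multiplies the leading
coefficient of every other term by (r i − r j)² ≠ 0, so no information about these terms is lost. -/
theorem exp_affine_indep_aux {ι : Type*} [DecidableEq ι] (r : ι → ℝ) (hr : Function.Injective r)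
    {J : Set ℝ} (hJ : IsOpen J) (hne : J.Nonempty) (S : Finset ι) :
    ∀ c d : ι → ℝ, (∀ t ∈ J, ∑ i ∈ S, (c i + d i * t) * Real.exp (r i * t) = 0) →
      ∀ i ∈ S, c i = 0 ∧ d i = 0 := by
  induction S using Finset.induction_on with
  | empty => simp
  | insert j S hj ih =>
    intro c d h
    have hderiv : ∀ {f f' : ℝ → ℝ}, (∀ t, HasDerivAt f (f' t) t) → (∀ t ∈ J, f t = 0) →
        ∀ t ∈ J, f' t = 0 := by
      intro f f' h1 h2 t ht
      have h3 : f =ᶠ[𝓝 t] fun _ => 0 := Filter.eventuallyEq_of_mem (hJ.mem_nhds ht) h2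
      exact (h1 t).unique ((hasDerivAt_const t 0).congr_of_eventuallyEq h3)
    have e0 : ∀ t ∈ J, c j + d j * t +
        ∑ i ∈ S, (c i + d i * t) * Real.exp ((r i - r j) * t) = 0 := by
      intro t ht
      have := h t ht
      rw [Finset.sum_insert hj] at this
      have h2 : (c j + d j * t + ∑ i ∈ S, (c i + d i * t) * Real.exp ((r i - r j) * t)) *
          Real.exp (r j * t) = 0 := by
        rw [add_mul, Finset.sum_mul, ← this]
        congr 1
        refine Finset.sum_congr rfl fun i _ => ?_
        rw [mul_assoc, ← Real.exp_add]
        ring_nf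
      exact (mul_eq_zero.1 h2).resolve_right (Real.exp_ne_zero _)
    have ed : ∀ (a b ρ t : ℝ), HasDerivAt (fun t => (a + b * t) * Real.exp (ρ * t))
        ((b + ρ * a + ρ * b * t) * Real.exp (ρ * t)) t := by
      intro a b ρ t
      have h1 : HasDerivAt (fun t => a + b * t) b t := by
        simpa using ((hasDerivAt_id t).const_mul b).const_add a
      have h2 : HasDerivAt (fun t => Real.exp (ρ * t)) (Real.exp (ρ * t) * ρ) t := by
        simpa using ((hasDerivAt_id t).const_mul ρ).exp
      refine (h1.mul h2).congr_deriv ?_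
      ring
    have e1 := hderiv (f' := fun t => d j + ∑ i ∈ S,
        ((d i + (r i - r j) * c i) + (r i - r j) * d i * t) * Real.exp ((r i - r j) * t))
      (fun t => by
        have h1 : HasDerivAt (fun t => c j + d j * t) (d j) t := by
          simpa using ((hasDerivAt_id t).const_mul (d j)).const_add (c j)
        exact h1.add (HasDerivAt.fun_sum fun i _ => ed _ _ _ _)) e0
    have e2 := hderiv (f' := fun t => 0 + ∑ i ∈ S,
        (((r i - r j) * d i + (r i - r j) * (d i + (r i - r j) * c i)) +
          (r i - r j) * ((r i - r j) * d i) * t) * Real.exp ((r i - r j) * t))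
      (fun t => (hasDerivAt_const t (d j)).add (HasDerivAt.fun_sum fun i _ => ed _ _ _ _)) e1
    -- The twice differentiated relation no longer contains the index j. Multiplication by exp (r j
    -- * t) restores the original exponents, as the induction hypothesis requires.
    have e3 := ih (fun i => (r i - r j) * d i + (r i - r j) * (d i + (r i - r j) * c i))
      (fun i => (r i - r j) * ((r i - r j) * d i)) (by
        intro t ht
        have h2 := congrArg (· * Real.exp (r j * t)) (e2 t ht)
        simp only [zero_add, zero_mul, Finset.sum_mul] at h2
        rw [← h2]
        refine Finset.sum_congr rfl fun i _ => ?_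
        rw [mul_assoc _ (Real.exp _) (Real.exp _), ← Real.exp_add]
        ring_nf)
    have e4 : ∀ i ∈ S, c i = 0 ∧ d i = 0 := by
      intro i hi
      obtain ⟨h1, h2⟩ := e3 i hi
      have h0 : r i - r j ≠ 0 := by
        intro h0
        have := hr (sub_eq_zero.1 h0)
        subst this
        exact hj hi
      have h3 : d i = 0 := by simpa [h0] using h2
      exact ⟨by simpa [h3, h0] using h1, h3⟩
    have e5 : ∀ t ∈ J, c j + d j * t = 0 := by
      intro t ht
      have := e0 t ht
      rwa [Finset.sum_eq_zero (fun i hi => by simp [e4 i hi]), add_zero] at this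
    have e6 : d j = 0 := by
      obtain ⟨t, ht⟩ := hne
      exact hderiv (f' := fun _ => d j) (fun t => by
        simpa using ((hasDerivAt_id t).const_mul (d j)).const_add (c j)) e5 t ht
    intro i hi
    rcases Finset.mem_insert.1 hi with rfl | hi
    · obtain ⟨t, ht⟩ := hne
      exact ⟨by simpa [e6] using e5 t ht, e6⟩
    · exact e4 i hi

/-- The functions `q ^ r` and `q ^ r log q` are linearly independent on every open set. -/
theorem rpow_log_indep {N : ℕ} (r : Fin N → ℝ) (hr : Function.Injective r)
    {J : Set ℝ} (hJ : IsOpen J) (hne : J.Nonempty) (hpos : ∀ q ∈ J, 0 < q) (c d : Fin N → ℝ)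
    (h : ∀ q ∈ J, ∑ i, (c i + d i * Real.log q) * q ^ r i = 0) (i : Fin N) :
    c i = 0 ∧ d i = 0 := by
  refine exp_affine_indep_aux r hr (J := Real.exp ⁻¹' J) (hJ.preimage Real.continuous_exp) ?_
    Finset.univ c d ?_ i (Finset.mem_univ i)
  · obtain ⟨q, hq⟩ := hne
    exact ⟨Real.log q, by simpa [Real.exp_log (hpos q hq)] using hq⟩
  · intro t ht
    rw [← h _ ht]
    refine Finset.sum_congr rfl fun i _ => ?_
    rw [Real.log_exp, ← Real.exp_mul, mul_comm t]


/-! ### Solving the equations b_q = 0, ξ₁a = 0, a_q = −h'' ξ₁b -/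

theorem exists_affine {B : Set E7} (hB : IsBox B) {g : E7 → ℝ} (hg : SmoothOn B g) (φ : E7)
    (h : ∀ n ∈ B, ∀ i, pd i g n = φ i) : ∃ c, ∀ n ∈ B, g n = c + (φ 0 * n 0 + φ 1 * n 1
      + φ 2 * n 2 + φ 3 * n 3 + φ 4 * n 4 + φ 5 * n 5 + φ 6 * n 6) := by
  have hl : ∀ n : E7, DifferentiableAt ℝ (fun n : E7 => φ 0 * n 0 + φ 1 * n 1
      + φ 2 * n 2 + φ 3 * n 3 + φ 4 * n 4 + φ 5 * n 5 + φ 6 * n 6) n := by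
    intro n; fun_prop
  have hs : SmoothOn B fun n => g n - (φ 0 * n 0 + φ 1 * n 1
      + φ 2 * n 2 + φ 3 * n 3 + φ 4 * n 4 + φ 5 * n 5 + φ 6 * n 6) := by
    intro n hn
    refine (hg n hn).sub ?_
    fun_prop
  obtain ⟨c, hc⟩ := exists_const hB.convex hs (by
    intro n hn i
    rw [pd_sub (hg.differentiableAt hn) (hl n), h n hn i]
    have hd : ∀ j, DifferentiableAt ℝ (fun n : E7 => φ j * n j) n := fun j => by fun_prop
    rw [pd_add (by fun_prop) (hd _), pd_add (by fun_prop) (hd _), pd_add (by fun_prop) (hd _),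
      pd_add (by fun_prop) (hd _), pd_add (by fun_prop) (hd _), pd_add (hd _) (hd _)]
    simp only [pd_const_mul _ (differentiableAt_coord _ n), pd_coord]
    fin_cases i <;> simp)
  exact ⟨c, fun n hn => by linear_combination hc n hn⟩

/-- The derivative `∂_x + p ∂_y` of a function of the coordinates. -/
def pdT (g : E7 → ℝ) (n : E7) : ℝ := pd 0 g n + n 2 * pd 1 g n

theorem SmoothOn.pdT {B : Set E7} {g : E7 → ℝ} (h : SmoothOn B g) : SmoothOn B (pdT g) :=
  fun n hn => (h.pd 0 n hn).add ((SmoothOn.coord 2 n hn).mul (h.pd 1 n hn))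

/-- The only coordinate field that does not commute with T = ∂_x + p∂_y is ∂_p, with [∂_p, T] = ∂_y.
-/
theorem pd_pdT {B : Set E7} {g : E7 → ℝ} (h : SmoothOn B g) (i : Fin 7) {n : E7} (hn : n ∈ B) :
    pd i (pdT g) n = pdT (pd i g) n + (if i = 2 then pd 1 g n else 0) := by
  have e : pdT g = fun n => pd 0 g n + n 2 * pd 1 g n := rfl
  have d1 : DifferentiableAt ℝ (fun n => n 2 * pd 1 g n) n :=
    (differentiableAt_coord 2 n).mul ((h.pd 1).differentiableAt hn)
  rw [e, pd_add ((h.pd 0).differentiableAt hn) d1,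
    pd_mul (differentiableAt_coord 2 n) ((h.pd 1).differentiableAt hn), pd_coord, pdT,
    h.pd_comm i 0 hn, h.pd_comm i 1 hn]
  by_cases hi : i = 2
  · simp [hi]; ring
  · simp [hi, Ne.symm hi]

/-- A function annihilated by ∂_p and T is annihilated by their commutator ∂_y, and hence by ∂_x = T
− p∂_y. -/
theorem pd_eq_zero_of_pdT {B : Set E7} (hB : IsOpen B) {g : E7 → ℝ} (hg : SmoothOn B g)
    (h2 : ∀ n ∈ B, pd 2 g n = 0) (hT : ∀ n ∈ B, pdT g n = 0) {n : E7} (hn : n ∈ B) :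
    pd 0 g n = 0 ∧ pd 1 g n = 0 := by
  have h := pd_pdT hg 2 hn
  rw [pd_eq_zero_of_const hB hT 2 hn, pdT, pd_eq_zero_of_const hB h2 0 hn,
    pd_eq_zero_of_const hB h2 1 hn] at h
  have h1 : pd 1 g n = 0 := by simpa using h.symm
  have h0 := hT n hn
  rw [pdT, h1] at h0
  exact ⟨by simpa using h0, h1⟩

theorem hasDerivAt_zCoeff {k : ℝ} (hk0 : k ≠ 0) {q : ℝ} (hq : 0 < q) :
    HasDerivAt (zCoeff k) (q ^ (2 * k - 2) / k) q := by
  unfold zCoeff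
  by_cases h : k = 1 / 2
  · simp only [h, if_true]
    have := (Real.hasDerivAt_log hq.ne').div_const (1 / 2)
    refine this.congr_deriv ?_
    rw [show (2 * (1 / 2) - 2 : ℝ) = -1 by norm_num, Real.rpow_neg_one]
  · simp only [h, if_false]
    have h2 : (2 * k - 1) ≠ 0 := fun h2 => h (by linarith)
    refine ((Real.hasDerivAt_rpow_const (p := 2 * k - 1) (Or.inl hq.ne')).div_const
      _).congr_deriv ?_
    rw [show 2 * k - 1 - 1 = 2 * k - 2 by ring]
    field_simp

/-- All powers become rational expressions in q and q^k, so that identities between them can be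
checked with q^k as an independent symbol. -/
theorem rpow_add_natCast_forms {k q : ℝ} (hq : 0 < q) :
    q ^ (k - 1) = q ^ k / q ∧ q ^ (k - 2) = q ^ k / q ^ 2 ∧ q ^ (k + 1) = q ^ k * q ∧
    q ^ (2 * k - 2) = (q ^ k) ^ 2 / q ^ 2 ∧ q ^ (2 * k - 1) = (q ^ k) ^ 2 / q ∧
    q ^ (2 * k) = (q ^ k) ^ 2 ∧ q ^ (3 * k - 1) = (q ^ k) ^ 3 / q := by
  have h2 : q ^ (2 * k) = (q ^ k) ^ 2 := by
    rw [mul_comm, Real.rpow_mul hq.le]; norm_cast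
  have h3 : q ^ (3 * k) = (q ^ k) ^ 3 := by
    rw [mul_comm, Real.rpow_mul hq.le]; norm_cast
  refine ⟨?_, ?_, ?_, ?_, ?_, h2, ?_⟩
  · rw [Real.rpow_sub hq, Real.rpow_one]
  · rw [Real.rpow_sub hq]; norm_cast
  · rw [Real.rpow_add hq, Real.rpow_one]
  · rw [Real.rpow_sub hq, h2]; norm_cast
  · rw [Real.rpow_sub hq, h2, Real.rpow_one]
  · rw [Real.rpow_sub hq, h3, Real.rpow_one]

set_option maxRecDepth 4000 in
/-- Comparison of the coefficients of the powers of `q` in the equation `ξ₁ a = 0`. -/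
theorem power_coefficients {k : ℝ} (hk : k ∉ ({2, 2 / 3, 1 / 3, 0, 1, -1} : Set ℝ))
    {J : Set ℝ} (hJ : IsOpen J) (hne : J.Nonempty) (hpos : ∀ q ∈ J, 0 < q)
    (c₁ c₂ c₃ c₄ c₅ c₆ c₇ c₈ c₉ c : ℝ)
    (h : ∀ q ∈ J, c₁ + q * c₂ + q ^ k / (k * (k - 1)) * c₃
      - q ^ (k - 1) / (k - 1) * (c₄ + q * c₅ + q ^ k / (k * (k - 1)) * c₆)
      - q ^ k / k * (c₇ + q * c₈ + q ^ k / (k * (k - 1)) * c₉)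
      - zCoeff k q / (k - 1) * (c₆ + q * c₉ + q ^ k / (k * (k - 1)) * c) = 0) :
    c₁ = 0 ∧ c₂ = 0 ∧ c₄ = 0 ∧ c₃ = k * c₅ + (k - 1) * c₇ ∧ c₆ = 0 ∧ c₈ = 0 ∧ c₉ = 0 ∧ c = 0 := by
  simp only [Set.mem_insert_iff, Set.mem_singleton_iff, not_or] at hk
  obtain ⟨k2, k23, k13, k0, k1, km1⟩ := hk
  have k1' : k - 1 ≠ 0 := sub_ne_zero.2 k1
  -- For k = 1/2 the exponents 2k − 1, 2k, 3k − 1 collide with 0, 1, k, and `zCoeff` is a logarithm.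
  -- Five exponents remain, three of them with logarithmic coefficients.
  by_cases hh : k = 1 / 2
  · have key := rpow_log_indep ![0, 1, k, k - 1, k + 1] (by
      rw [hh]
      intro i j hij
      fin_cases i <;> fin_cases j <;> first | rfl | (exfalso; norm_num at hij)) hJ hne hpos
      ![c₁ - 8 * c₆, c₂ + 8 * c₉, -4 * c₃ + 2 * c₅ - 2 * c₇, 2 * c₄, -2 * c₈]
      ![4 * c₆, 4 * c₉, -16 * c, 0, 0] (by
      intro q hq
      have hq0 := hpos q hq
      obtain ⟨e1, e2, e3, e4, e5, e6, e7⟩ := rpow_add_natCast_forms (k := k) hq0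
      -- For k = 1/2 everything except log q is rational in P = q^k, since q = P².
      have hP : (q ^ k) ^ 2 = q := by
        rw [← e6, hh]; norm_num
      have h1 := h q hq
      rw [Fin.sum_univ_five]
      simp only [Matrix.cons_val, e1, e3, Real.rpow_zero, Real.rpow_one]
      rw [e1, zCoeff, if_pos hh] at h1
      have hc : k * (k - 1) = -1 / 4 := by rw [hh]; norm_num
      have hc' : k - 1 = -1 / 2 := by rw [hh]; norm_num
      rw [hc, hc'] at h1
      rw [show Real.log q / k = 2 * Real.log q by rw [hh]; ring,
        show q ^ k / k = 2 * q ^ k by rw [hh]; ring] at h1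
      generalize q ^ k = P at *
      have hP0 : P ≠ 0 := by
        rintro rfl
        simp at hP
        exact hq0.ne hP
      generalize Real.log q = l at *
      rw [← hP] at h1 ⊢
      field_simp at h1 ⊢
      linear_combination h1)
    have d0 := (key 0).2
    have d1 := (key 1).2
    have d2 := (key 2).2
    have a0 := (key 0).1
    have a1 := (key 1).1
    have a2 := (key 2).1
    have a3 := (key 3).1
    have a4 := (key 4).1
    simp only [Matrix.cons_val] at d0 d1 d2 a0 a1 a2 a3 a4
    rw [hh]
    refine ⟨?_, ?_, ?_, ?_, ?_, ?_, ?_, ?_⟩ <;> linarith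
  · have h21 : 2 * k - 1 ≠ 0 := fun h2 => hh (by linarith)
    have h21' : k * 2 - 1 ≠ 0 := fun h2 => hh (by linarith)
    -- Two of the eight exponents coincide only for k in {0, 1, 2, −1, 1/2, 1/3, 2/3}. The value 1/2
    -- has been treated separately, and the others are excluded by hypothesis.
    have key := rpow_log_indep ![0, 1, k - 1, k, k + 1, 2 * k - 1, 2 * k, 3 * k - 1] (by
      have n1 : (3 * k - 1) ≠ 0 := fun e => k13 (by linarith)
      have n2 : (3 * k - 2) ≠ 0 := fun e => k23 (by linarith)
      have n3 : k + 1 ≠ 0 := fun e => km1 (by linarith)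
      have n4 : k - 2 ≠ 0 := fun e => k2 (by linarith)
      intro i j hij
      rw [← sub_eq_zero] at hij
      fin_cases i <;> fin_cases j <;> first
        | rfl
        | (exfalso
           simp only [Fin.zero_eta, Fin.mk_one, Fin.reduceFinMk, Matrix.cons_val] at hij
           first
             | exact k0 (by linarith)
             | exact k1' (by linarith)
             | exact h21 (by linarith)
             | exact n1 (by linarith)
             | exact n2 (by linarith)
             | exact n3 (by linarith)
             | exact n4 (by linarith))) hJ hne hpos
      ![c₁, c₂, -c₄ / (k - 1), c₃ / (k * (k - 1)) - c₅ / (k - 1) - c₇ / k, -c₈ / k,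
        -c₆ / (k * (k - 1) * (k - 1)) - c₆ / (k * (2 * k - 1) * (k - 1)),
        -c₉ / (k * (k - 1) * k) - c₉ / (k * (2 * k - 1) * (k - 1)),
        -c / (k * (k - 1) * (k * (2 * k - 1) * (k - 1)))] (fun _ => 0) (by
      intro q hq
      have hq0 := hpos q hq
      obtain ⟨e1, e2, e3, e4, e5, e6, e7⟩ := rpow_add_natCast_forms (k := k) hq0
      have h1 := h q hq
      rw [Fin.sum_univ_eight]
      simp only [Matrix.cons_val, e1, e3, e5, e6, e7, Real.rpow_zero, Real.rpow_one, zero_mul,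
        add_zero]
      rw [e1, zCoeff, if_neg hh, e5] at h1
      rw [← h1]
      generalize q ^ k = P at *
      field_simp
      ring)
    have a0 := (key 0).1
    have a1 := (key 1).1
    have a2 := (key 2).1
    have a3 := (key 3).1
    have a4 := (key 4).1
    have a5 := (key 5).1
    have a6 := (key 6).1
    have a7 := (key 7).1
    simp only [Matrix.cons_val] at a0 a1 a2 a3 a4 a5 a6 a7
    have n1 : (3 * k - 1) ≠ 0 := fun e => k13 (by linarith)
    have n2 : (3 * k - 2) ≠ 0 := fun e => k23 (by linarith)
    refine ⟨a0, a1, ?_, ?_, ?_, ?_, ?_, ?_⟩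
    · field_simp at a2; linarith
    · field_simp at a3; linear_combination a3
    -- The coefficient of q^(2k−1) receives c₆ both from the power term and from `zCoeff`, and 1/(k
    -- − 1) + 1/(2k − 1) has numerator 3k − 2. Likewise 1/k + 1/(2k − 1) produces the factor 3k − 1
    -- for c₉.
    · have : c₆ * (3 * k - 2) = 0 := by
        field_simp at a5; linear_combination -a5
      exact (mul_eq_zero.1 this).resolve_right n2
    · field_simp at a4; linarith
    · have : c₉ * (3 * k - 1) = 0 := by
        field_simp at a6; linear_combination -a6
      exact (mul_eq_zero.1 this).resolve_right n1
    · field_simp at a7; linarith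


/-- The value at `q` of the part of a symmetry determined by `b`. -/
def primitivePart (k : ℝ) (b : E7 → ℝ) (n : E7) : ℝ :=
  pdT b n * (n 3 ^ (k - 1) / (k - 1)) + pd 2 b n * (n 3 ^ k / k)
    + pd 4 b n * (zCoeff k (n 3) / (k - 1))

theorem hasDerivAt_powers {k : ℝ} (hk0 : k ≠ 0) (hk1 : k - 1 ≠ 0) {q : ℝ} (hq : 0 < q) :
    HasDerivAt (fun q : ℝ => q ^ (k - 1) / (k - 1)) (q ^ (k - 2)) q ∧
    HasDerivAt (fun q : ℝ => q ^ k / k) (q ^ (k - 1)) q ∧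
    HasDerivAt (fun q : ℝ => zCoeff k q / (k - 1)) (q ^ (2 * k - 2) / k / (k - 1)) q := by
  refine ⟨?_, ?_, (hasDerivAt_zCoeff hk0 hq).div_const _⟩
  · refine ((Real.hasDerivAt_rpow_const (Or.inl hq.ne')).div_const _).congr_deriv ?_
    rw [show k - 1 - 1 = k - 2 by ring]
    field_simp
  · refine ((Real.hasDerivAt_rpow_const (Or.inl hq.ne')).div_const _).congr_deriv ?_
    field_simp

theorem contDiffAt_powers {k : ℝ} {q : ℝ} (hq : 0 < q) :
    ContDiffAt ℝ ∞ (fun q : ℝ => q ^ (k - 1) / (k - 1)) q ∧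
    ContDiffAt ℝ ∞ (fun q : ℝ => q ^ k / k) q ∧
    ContDiffAt ℝ ∞ (fun q : ℝ => zCoeff k q / (k - 1)) q := by
  refine ⟨(Real.contDiffAt_rpow_const_of_ne hq.ne').div_const _,
    (Real.contDiffAt_rpow_const_of_ne hq.ne').div_const _, ContDiffAt.div_const ?_ _⟩
  unfold zCoeff
  by_cases h : k = 1 / 2
  · simp only [h, if_true]
    exact (Real.contDiffAt_log.2 hq.ne').div_const _
  · simp only [h, if_false]
    exact (Real.contDiffAt_rpow_const_of_ne hq.ne').div_const _

theorem SmoothOn.comp_coord {B : Set E7} {φ : ℝ → ℝ} (j : Fin 7)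
    (h : ∀ n ∈ B, ContDiffAt ℝ ∞ φ (n j)) : SmoothOn B fun n => φ (n j) :=
  fun n hn => (h n hn).comp n (contDiffAt_apply ℝ ℝ j n)

theorem SmoothOn.add {B : Set E7} {f g : E7 → ℝ} (hf : SmoothOn B f) (hg : SmoothOn B g) :
    SmoothOn B fun n => f n + g n := fun n hn => (hf n hn).add (hg n hn)

theorem SmoothOn.sub {B : Set E7} {f g : E7 → ℝ} (hf : SmoothOn B f) (hg : SmoothOn B g) :
    SmoothOn B fun n => f n - g n := fun n hn => (hf n hn).sub (hg n hn)

theorem SmoothOn.mul {B : Set E7} {f g : E7 → ℝ} (hf : SmoothOn B f) (hg : SmoothOn B g) :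
    SmoothOn B fun n => f n * g n := fun n hn => (hf n hn).mul (hg n hn)

theorem smoothOn_primitivePart {k : ℝ} {B : Set E7} (hq : ∀ n ∈ B, 0 < n 3) {b : E7 → ℝ}
    (hb : SmoothOn B b) : SmoothOn B (primitivePart k b) :=
  ((hb.pdT.mul (SmoothOn.comp_coord 3 fun n hn => (contDiffAt_powers (hq n hn)).1)).add
    ((hb.pd 2).mul (SmoothOn.comp_coord 3 fun n hn => (contDiffAt_powers (hq n hn)).2.1))).add
    ((hb.pd 4).mul (SmoothOn.comp_coord 3 fun n hn => (contDiffAt_powers (hq n hn)).2.2))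

/-- The three functions of q in `primitivePart` are primitives of h'', q h'' and h h''. The extra
term of the q-derivative is therefore h'' ξ₁b, which is −a_q in the application. -/
theorem pd_primitivePart {k : ℝ} (hk0 : k ≠ 0) (hk1 : k - 1 ≠ 0) {B : Set E7}
    (hq : ∀ n ∈ B, 0 < n 3) {b : E7 → ℝ} (hb : SmoothOn B b) (i : Fin 7) {n : E7} (hn : n ∈ B) :
    pd i (primitivePart k b) n =
      pd i (pdT b) n * (n 3 ^ (k - 1) / (k - 1)) + pd i (pd 2 b) n * (n 3 ^ k / k)
        + pd i (pd 4 b) n * (zCoeff k (n 3) / (k - 1))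
        + if 3 = i then pdT b n * n 3 ^ (k - 2) + pd 2 b n * n 3 ^ (k - 1)
          + pd 4 b n * (n 3 ^ (2 * k - 2) / k / (k - 1)) else 0 := by
  obtain ⟨h1, h2, h3⟩ := hasDerivAt_powers hk0 hk1 (hq n hn)
  have s1 : SmoothOn B fun n : E7 => n 3 ^ (k - 1) / (k - 1) :=
    SmoothOn.comp_coord 3 fun n hn => (contDiffAt_powers (hq n hn)).1
  have s2 : SmoothOn B fun n : E7 => n 3 ^ k / k :=
    SmoothOn.comp_coord 3 fun n hn => (contDiffAt_powers (hq n hn)).2.1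
  have s3 : SmoothOn B fun n : E7 => zCoeff k (n 3) / (k - 1) :=
    SmoothOn.comp_coord 3 fun n hn => (contDiffAt_powers (hq n hn)).2.2
  have e : primitivePart k b = fun n => pdT b n * (n 3 ^ (k - 1) / (k - 1))
    + pd 2 b n * (n 3 ^ k / k) + pd 4 b n * (zCoeff k (n 3) / (k - 1)) := rfl
  rw [e, pd_add (((hb.pdT.mul s1).add ((hb.pd 2).mul s2)).differentiableAt hn)
    (((hb.pd 4).mul s3).differentiableAt hn),
    pd_add ((hb.pdT.mul s1).differentiableAt hn) (((hb.pd 2).mul s2).differentiableAt hn),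
    pd_mul (hb.pdT.differentiableAt hn) (s1.differentiableAt hn),
    pd_mul ((hb.pd 2).differentiableAt hn) (s2.differentiableAt hn),
    pd_mul ((hb.pd 4).differentiableAt hn) (s3.differentiableAt hn),
    pd_comp h1, pd_comp h2, pd_comp h3]
  split_ifs <;> ring

theorem pd_pd_eq_zero {B : Set E7} (hB : IsOpen B) {g : E7 → ℝ} (hg : SmoothOn B g) {i : Fin 7}
    (h : ∀ n ∈ B, pd i g n = 0) (j : Fin 7) {n : E7} (hn : n ∈ B) : pd i (pd j g) n = 0 := by
  rw [hg.pd_comm i j hn, pd_eq_zero_of_const hB h j hn]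

theorem pd_pdT_eq_zero {B : Set E7} (hB : IsOpen B) {g : E7 → ℝ} (hg : SmoothOn B g) {i : Fin 7}
    (hi : i ≠ 2) (h : ∀ n ∈ B, pd i g n = 0) {n : E7} (hn : n ∈ B) : pd i (pdT g) n = 0 := by
  rw [pd_pdT hg i hn, pdT, pd_eq_zero_of_const hB h 0 hn, pd_eq_zero_of_const hB h 1 hn, if_neg hi]
  ring

/-- The equations between `b` and the part of `a` which does not depend on `q`. -/
theorem symmetry_equations_split {k : ℝ} (hk : k ∉ ({2, 2 / 3, 1 / 3, 0, 1, -1} : Set ℝ))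
    {B : Set E7} (hB : IsBox B) (hq : ∀ n ∈ B, 0 < n 3) {a b : E7 → ℝ}
    (ha : SmoothOn B a) (hb : SmoothOn B b) (b3 : ∀ n ∈ B, pd 3 b n = 0)
    (hxi : ∀ n ∈ B, pdT a n + n 3 * pd 2 a n + n 3 ^ k / (k * (k - 1)) * pd 4 a n = 0)
    (ha3 : ∀ n ∈ B, pd 3 a n = -(n 3 ^ (k - 2) *
      (pdT b n + n 3 * pd 2 b n + n 3 ^ k / (k * (k - 1)) * pd 4 b n))) :
    ∃ A : E7 → ℝ, SmoothOn B A ∧ (∀ n ∈ B, a n = A n - primitivePart k b n) ∧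
      (∀ i, i ≠ 3 → (∀ n ∈ B, pd i a n = 0) → i ≠ 2 → (∀ n ∈ B, pd i b n = 0) →
        ∀ n ∈ B, pd i A n = 0) ∧
      ∀ n ∈ B, pd 3 A n = 0 ∧ pdT A n = 0 ∧ pd 2 A n = 0 ∧ pdT (pdT b) n = 0 ∧
        pd 4 A n = k * pd 2 (pdT b) n + (k - 1) * pdT (pd 2 b) n ∧ pdT (pd 4 b) n = 0 ∧
        pd 2 (pd 2 b) n = 0 ∧ pd 2 (pd 4 b) n = 0 ∧ pd 4 (pd 4 b) n = 0 := by
  have hk' := hk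
  simp only [Set.mem_insert_iff, Set.mem_singleton_iff, not_or] at hk'
  obtain ⟨-, -, -, k0, k1, -⟩ := hk'
  have k1 : k - 1 ≠ 0 := sub_ne_zero.2 k1
  have sp := smoothOn_primitivePart (k := k) hq hb
  have sA : SmoothOn B fun n => a n + primitivePart k b n := ha.add sp
  have pA : ∀ i, ∀ n ∈ B, pd i (fun n => a n + primitivePart k b n) n =
      pd i a n + pd i (primitivePart k b) n := fun i n hn =>
    pd_add (ha.differentiableAt hn) (sp.differentiableAt hn)
  -- As b does not depend on q, neither do Tb, b_p, b_z. The q-derivative of `primitivePart` is thus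
  -- exactly h'' ξ₁b and cancels a_q.
  have A3 : ∀ n ∈ B, pd 3 (fun n => a n + primitivePart k b n) n = 0 := by
    intro n hn
    rw [pA 3 n hn, ha3 n hn, pd_primitivePart k0 k1 hq hb 3 hn, if_pos rfl,
      pd_pdT_eq_zero hB.isOpen hb (by decide) b3 hn, pd_pd_eq_zero hB.isOpen hb b3 2 hn,
      pd_pd_eq_zero hB.isOpen hb b3 4 hn]
    obtain ⟨e1, e2, e3, e4, e5, e6, e7⟩ := rpow_add_natCast_forms (k := k) (hq n hn)
    rw [e1, e2, e4]
    have := (hq n hn).ne'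
    field_simp
    ring
  refine ⟨_, sA, fun n _ => by ring, ?_, ?_⟩
  · intro i i3 hi i2 hi' n hn
    rw [pA i n hn, hi n hn, pd_primitivePart k0 k1 hq hb i hn, if_neg (Ne.symm i3),
      pd_pdT_eq_zero hB.isOpen hb i2 hi' hn, pd_pd_eq_zero hB.isOpen hb hi' 2 hn,
      pd_pd_eq_zero hB.isOpen hb hi' 4 hn]
    ring
  intro n hn
  set A : E7 → ℝ := fun n => a n + primitivePart k b n with hA
  refine ⟨A3 n hn, ?_⟩
  -- The equation ξ₁a = 0 is read along the line through n on which only q varies. All coefficients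
  -- built from A and b are constant on it, so an identity between functions of q alone results.
  have hJo : IsOpen {t : ℝ | Function.update n 3 t ∈ B} :=
    hB.isOpen.preimage (continuous_const.update 3 continuous_id)
  have key := power_coefficients hk hJo ⟨n 3, by simpa using hn⟩
    (fun t ht => by simpa using hq _ ht)
    (pdT A n) (pd 2 A n) (pd 4 A n) (pdT (pdT b) n) (pd 2 (pdT b) n) (pdT (pd 4 b) n)
    (pdT (pd 2 b) n) (pd 2 (pd 2 b) n) (pd 2 (pd 4 b) n) (pd 4 (pd 4 b) n) (by
    intro t ht
    have inv : ∀ g : E7 → ℝ, SmoothOn B g → (∀ x ∈ B, pd 3 g x = 0) →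
        g (Function.update n 3 t) = g n := by
      intro g hg h3
      refine eq_of_pd_eq_zero hB.convex hg ht hn fun i => ?_
      by_cases hi : i = 3
      · exact Or.inr (hi ▸ h3)
      · exact Or.inl (by simp [hi])
    have T3 : ∀ g : E7 → ℝ, SmoothOn B g → (∀ x ∈ B, pd 3 g x = 0) →
        ∀ x ∈ B, pd 3 (pdT g) x = 0 := fun g hg h x hx =>
      pd_pdT_eq_zero hB.isOpen hg (by decide) h hx
    have D3 : ∀ g : E7 → ℝ, SmoothOn B g → (∀ x ∈ B, pd 3 g x = 0) → ∀ j,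
        ∀ x ∈ B, pd 3 (pd j g) x = 0 := fun g hg h j x hx =>
      pd_pd_eq_zero hB.isOpen hg h j hx
    rw [← inv _ sA.pdT (T3 _ sA A3), ← inv _ (sA.pd 2) (D3 _ sA A3 2),
      ← inv _ (sA.pd 4) (D3 _ sA A3 4), ← inv _ hb.pdT.pdT (T3 _ hb.pdT (T3 _ hb b3)),
      ← inv _ (hb.pdT.pd 2) (D3 _ hb.pdT (T3 _ hb b3) 2),
      ← inv _ (hb.pd 4).pdT (T3 _ (hb.pd 4) (D3 _ hb b3 4)),
      ← inv _ (hb.pd 2).pdT (T3 _ (hb.pd 2) (D3 _ hb b3 2)),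
      ← inv _ ((hb.pd 2).pd 2) (D3 _ (hb.pd 2) (D3 _ hb b3 2) 2),
      ← inv _ ((hb.pd 4).pd 2) (D3 _ (hb.pd 4) (D3 _ hb b3 4) 2),
      ← inv _ ((hb.pd 4).pd 4) (D3 _ (hb.pd 4) (D3 _ hb b3 4) 4)]
    have ht3 : (Function.update n 3 t) 3 = t := by simp
    replace ht : Function.update n 3 t ∈ B := ht
    clear inv
    generalize Function.update n 3 t = m at ht ht3 ⊢
    rw [← ht3]
    have h0 := hxi m ht
    simp only [pdT] at h0
    rw [show pdT A m = pd 0 A m + m 2 * pd 1 A m from rfl, pA 0 m ht, pA 1 m ht, pA 2 m ht,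
      pA 4 m ht, pd_primitivePart k0 k1 hq hb 0 ht, pd_primitivePart k0 k1 hq hb 1 ht,
      pd_primitivePart k0 k1 hq hb 2 ht, pd_primitivePart k0 k1 hq hb 4 ht,
      show pdT (pdT b) m = pd 0 (pdT b) m + m 2 * pd 1 (pdT b) m from rfl,
      show pdT (pd 2 b) m = pd 0 (pd 2 b) m + m 2 * pd 1 (pd 2 b) m from rfl,
      hb.pd_comm 4 2 ht, pd_pdT hb 4 ht]
    simp only [Fin.reduceEq, if_false]
    rw [show pdT (pd 4 b) m = pd 0 (pd 4 b) m + m 2 * pd 1 (pd 4 b) m from rfl]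
    linear_combination h0)
  obtain ⟨r1, r2, r3, r4, r5, r6, r7, r8⟩ := key
  exact ⟨r1, r2, r3, r4, r5, r6, r7, r8⟩

/-- The functions `a = η₃(X)`, `b = η₁(X)` of a symmetry of the distribution. -/
theorem exists_coefficients {k : ℝ} (hk : k ∉ ({2, 2 / 3, 1 / 3, 0, 1, -1} : Set ℝ))
    {B : Set E7} (hB : IsBox B) (hq : ∀ n ∈ B, 0 < n 3) {a b : E7 → ℝ}
    (ha : SmoothOn B a) (hb : SmoothOn B b) (b3 : ∀ n ∈ B, pd 3 b n = 0)
    (a5 : ∀ n ∈ B, pd 5 a n = 0) (a6 : ∀ n ∈ B, pd 6 a n = 0)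
    (b5 : ∀ n ∈ B, pd 5 b n = 0) (b6 : ∀ n ∈ B, pd 6 b n = 0)
    (hxi : ∀ n ∈ B, pdT a n + n 3 * pd 2 a n + n 3 ^ k / (k * (k - 1)) * pd 4 a n = 0)
    (ha3 : ∀ n ∈ B, pd 3 a n = -(n 3 ^ (k - 2) *
      (pdT b n + n 3 * pd 2 b n + n 3 ^ k / (k * (k - 1)) * pd 4 b n))) :
    ∃ c : Fin 7 → ℝ, ∀ n ∈ B,
      b n = -c 0 * n 2 + c 1 + c 3 * n 0 - c 4 * (n 2 * n 0) + c 5 * n 1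
        + c 6 * ((1 - k) * n 4) ∧
      a n = c 0 * (n 3 ^ k / k) + c 2 - c 3 * (n 3 ^ (k - 1) / (k - 1))
        + c 4 * ((1 - 2 * k) * n 4 + n 2 * (n 3 ^ (k - 1) / (k - 1)) + n 0 * (n 3 ^ k / k))
        + c 5 * (k * n 4 - n 2 * (n 3 ^ (k - 1) / (k - 1))) + c 6 * zCoeff k (n 3) := by
  obtain ⟨A, sA, haA, hA, h⟩ := symmetry_equations_split hk hB hq ha hb b3 hxi ha3
  have hA5 := hA 5 (by decide) a5 (by decide) b5
  have hA6 := hA 6 (by decide) a6 (by decide) b6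
  simp only [Set.mem_insert_iff, Set.mem_singleton_iff, not_or] at hk
  obtain ⟨k2, k23, k13, k0, k1, km1⟩ := hk
  have k1 : k - 1 ≠ 0 := sub_ne_zero.2 k1
  have n1 : (3 * k - 1) ≠ 0 := fun e => k13 (by linarith)
  have n2 : (3 * k - 2) ≠ 0 := fun e => k23 (by linarith)
  have ho := hB.isOpen
  have Z : ∀ {g : E7 → ℝ} {i : Fin 7}, SmoothOn B g → (∀ n ∈ B, pd i g n = 0) → ∀ j,
      ∀ n ∈ B, pd i (pd j g) n = 0 := fun hg hi j n hn => pd_pd_eq_zero ho hg hi j hn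
  -- the derivative `b_z` is constant
  have sbz := hb.pd 4
  have bz01 : ∀ n ∈ B, pd 0 (pd 4 b) n = 0 ∧ pd 1 (pd 4 b) n = 0 := fun n hn =>
    pd_eq_zero_of_pdT ho sbz (fun n hn => (h n hn).2.2.2.2.2.2.2.1)
      (fun n hn => (h n hn).2.2.2.2.2.1) hn
  have bzi : ∀ i, ∀ n ∈ B, pd i (pd 4 b) n = 0 := by
    intro i n hn
    fin_cases i
    · exact (bz01 n hn).1
    · exact (bz01 n hn).2
    · exact (h n hn).2.2.2.2.2.2.2.1
    · exact Z hb b3 4 n hn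
    · exact (h n hn).2.2.2.2.2.2.2.2
    · exact Z hb b5 4 n hn
    · exact Z hb b6 4 n hn
  obtain ⟨cz, hcz⟩ := exists_const hB.convex sbz fun n hn i => bzi i n hn
  -- the function `A` is affine in `z`
  have A01 : ∀ n ∈ B, pd 0 A n = 0 ∧ pd 1 A n = 0 := fun n hn =>
    pd_eq_zero_of_pdT ho sA (fun n hn => (h n hn).2.2.1) (fun n hn => (h n hn).2.1) hn
  -- The relation A_z = k (Tb)_p + (k − 1) T b_p is rewritten by (Tb)_p = T b_p + b_y.
  have hR : ∀ n ∈ B, pd 4 A n = (2 * k - 1) * pdT (pd 2 b) n + k * pd 1 b n := by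
    intro n hn
    have := (h n hn).2.2.2.2.1
    rw [pd_pdT hb 2 hn, if_pos rfl] at this
    linear_combination this
  have bzj : ∀ j, ∀ n ∈ B, pd 4 (pd j b) n = 0 := fun j n hn => by
    rw [hb.pd_comm 4 j hn, bzi j n hn]
  have A44 : ∀ n ∈ B, pd 4 (pd 4 A) n = 0 := by
    intro n hn
    rw [pd_congr ho hR 4 hn, pd_add
      (((hb.pd 2).pdT.differentiableAt hn).const_mul _)
      (((hb.pd 1).differentiableAt hn).const_mul _),
      pd_const_mul _ ((hb.pd 2).pdT.differentiableAt hn),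
      pd_const_mul _ ((hb.pd 1).differentiableAt hn), bzj 1 n hn,
      pd_pdT_eq_zero ho (hb.pd 2) (by decide) (bzj 2) hn]
    ring
  obtain ⟨c2, hc2⟩ := exists_const hB.convex (sA.pd 4) (by
    intro n hn i
    fin_cases i
    · exact Z sA (fun n hn => (A01 n hn).1) 4 n hn
    · exact Z sA (fun n hn => (A01 n hn).2) 4 n hn
    · exact Z sA (fun n hn => (h n hn).2.2.1) 4 n hn
    · exact Z sA (fun n hn => (h n hn).1) 4 n hn
    · exact A44 n hn
    · exact Z sA hA5 4 n hn
    · exact Z sA hA6 4 n hn)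
  obtain ⟨c1, hc1⟩ := exists_affine hB sA ![0, 0, 0, 0, c2, 0, 0] (by
    intro n hn i
    fin_cases i
    · exact (A01 n hn).1
    · exact (A01 n hn).2
    · exact (h n hn).2.2.1
    · exact (h n hn).1
    · exact hc2 n hn
    · exact hA5 n hn
    · exact hA6 n hn)
  -- the derivatives of `b_p`
  have bpp : ∀ n ∈ B, pd 2 (pd 2 b) n = 0 := fun n hn => (h n hn).2.2.2.2.2.2.1
  have hR' : ∀ n ∈ B, (2 * k - 1) * pdT (pd 2 b) n + k * pd 1 b n = c2 := fun n hn => by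
    rw [← hR n hn, hc2 n hn]
  have pdR : ∀ i, ∀ n ∈ B, (2 * k - 1) * pd i (pdT (pd 2 b)) n + k * pd i (pd 1 b) n = 0 := by
    intro i n hn
    have := pd_eq_zero_of_const ho hR' i hn
    rwa [pd_add
      (((hb.pd 2).pdT.differentiableAt hn).const_mul _)
      (((hb.pd 1).differentiableAt hn).const_mul _),
      pd_const_mul _ ((hb.pd 2).pdT.differentiableAt hn),
      pd_const_mul _ ((hb.pd 1).differentiableAt hn)] at this
  -- The p-derivative of (2k − 1) T b_p + k b_y = c2 is (2k − 1) b_py + k b_py, because b_pp = 0.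
  -- The factor 3k − 1 is nonzero.
  have bpy : ∀ n ∈ B, pd 1 (pd 2 b) n = 0 := by
    intro n hn
    have := pdR 2 n hn
    rw [pd_pdT (hb.pd 2) 2 hn, if_pos rfl, pdT, pd_eq_zero_of_const ho bpp 0 hn,
      pd_eq_zero_of_const ho bpp 1 hn, hb.pd_comm 2 1 hn] at this
    have : (3 * k - 1) * pd 1 (pd 2 b) n = 0 := by linear_combination this
    exact (mul_eq_zero.1 this).resolve_left n1
  have Tbp : ∀ n ∈ B, pdT (pd 2 b) n = pd 0 (pd 2 b) n := fun n hn => by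
    rw [pdT, bpy n hn]; ring
  have byy : ∀ n ∈ B, pd 1 (pd 1 b) n = 0 := by
    intro n hn
    have := pdR 1 n hn
    rw [pd_congr ho Tbp 1 hn, Z (hb.pd 2) bpy 0 n hn] at this
    have : k * pd 1 (pd 1 b) n = 0 := by linear_combination this
    exact (mul_eq_zero.1 this).resolve_left k0
  have bxpp : ∀ n ∈ B, pd 2 (pd 0 (pd 2 b)) n = 0 := Z (hb.pd 2) bpp 0
  -- The x-derivative of the same relation gives (2k − 1) b_xxp + k b_xy = 0, and the p-derivative
  -- of T²b = 0 gives b_xxp + 2 b_xy = 0. The determinant of this system is 3k − 2 up to sign.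
  have bxy : ∀ n ∈ B, pd 0 (pd 1 b) n = 0 ∧ pd 0 (pd 0 (pd 2 b)) n = 0 := by
    intro n hn
    have e1 := pdR 0 n hn
    rw [pd_congr ho Tbp 0 hn] at e1
    have e2 := pd_eq_zero_of_const ho (fun n hn => (h n hn).2.2.2.1) 2 hn
    have e3 : pd 2 (pdT b) n = pdT (pd 2 b) n + pd 1 b n := by rw [pd_pdT hb 2 hn, if_pos rfl]
    have e4 : ∀ m ∈ B, pd 2 (pdT b) m = pd 0 (pd 2 b) m + pd 1 b m := fun m hm => by
      rw [pd_pdT hb 2 hm, if_pos rfl, Tbp m hm]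
    rw [pd_pdT hb.pdT 2 hn, if_pos rfl, pdT, pd_congr ho e4 0 hn, pd_congr ho e4 1 hn,
      pd_add (((hb.pd 2).pd 0).differentiableAt hn) ((hb.pd 1).differentiableAt hn),
      pd_add (((hb.pd 2).pd 0).differentiableAt hn) ((hb.pd 1).differentiableAt hn),
      Z (hb.pd 2) bpy 0 n hn, byy n hn, pd_pdT hb 1 hn, if_neg (by decide), pdT, byy n hn] at e2
    have e5 : (3 * k - 2) * pd 0 (pd 1 b) n = 0 := by
      linear_combination -e1 + (2 * k - 1) * e2
    have e6 := (mul_eq_zero.1 e5).resolve_left n2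
    refine ⟨e6, ?_⟩
    rw [e6] at e2
    linear_combination e2
  obtain ⟨c5, hc5⟩ := exists_const hB.convex (hb.pd 1) (by
    intro n hn i
    fin_cases i
    · exact (bxy n hn).1
    · exact byy n hn
    · exact (hb.pd_comm 2 1 hn).trans (bpy n hn)
    · exact Z hb b3 1 n hn
    · exact bzj 1 n hn
    · exact Z hb b5 1 n hn
    · exact Z hb b6 1 n hn)
  obtain ⟨c4, hc4⟩ := exists_const hB.convex ((hb.pd 2).pd 0) (by
    intro n hn i
    fin_cases i
    · exact (bxy n hn).2
    · exact Z (hb.pd 2) bpy 0 n hn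
    · exact bxpp n hn
    · exact Z (hb.pd 2) (Z hb b3 2) 0 n hn
    · exact Z (hb.pd 2) (bzj 2) 0 n hn
    · exact Z (hb.pd 2) (Z hb b5 2) 0 n hn
    · exact Z (hb.pd 2) (Z hb b6 2) 0 n hn)
  obtain ⟨c3, hc3⟩ := exists_affine hB (hb.pd 2) ![c4, 0, 0, 0, 0, 0, 0] (by
    intro n hn i
    fin_cases i
    · exact hc4 n hn
    · exact bpy n hn
    · exact bpp n hn
    · exact Z hb b3 2 n hn
    · exact bzj 2 n hn
    · exact Z hb b5 2 n hn
    · exact Z hb b6 2 n hn)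
  have bxx : ∀ n ∈ B, pd 0 (pd 0 b) n = 0 := by
    intro n hn
    have := (h n hn).2.2.2.1
    rw [pdT, pd_pdT hb 0 hn, pd_pdT hb 1 hn, pdT, pdT, byy n hn, if_neg (by decide),
      if_neg (by decide), hb.pd_comm 1 0 hn, (bxy n hn).1] at this
    linear_combination this
  obtain ⟨c6, hc6⟩ := exists_affine hB (hb.pd 0) ![0, 0, c4, 0, 0, 0, 0] (by
    intro n hn i
    fin_cases i
    · exact bxx n hn
    · exact (hb.pd_comm 1 0 hn).trans (bxy n hn).1
    · exact (hb.pd_comm 2 0 hn).trans (hc4 n hn)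
    · exact Z hb b3 0 n hn
    · exact bzj 0 n hn
    · exact Z hb b5 0 n hn
    · exact Z hb b6 0 n hn)
  -- The monomial x p is the only nonlinear term of b; after its removal b is affine.
  have sxp : SmoothOn B fun n => c4 * (n 0 * n 2) := fun n hn =>
    contDiffAt_const.mul ((SmoothOn.coord 0 n hn).mul (SmoothOn.coord 2 n hn))
  obtain ⟨c7, hc7⟩ := exists_affine hB (hb.sub sxp) ![c6, c5, c3, 0, cz, 0, 0] (by
    intro n hn i
    rw [pd_sub (hb.differentiableAt hn) (sxp.differentiableAt hn),
      pd_const_mul (f := fun n => n 0 * n 2) _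
        ((differentiableAt_coord 0 n).mul (differentiableAt_coord 2 n)),
      pd_mul (differentiableAt_coord 0 n) (differentiableAt_coord 2 n), pd_coord, pd_coord]
    have e0 := hc6 n hn
    have e1 := hc5 n hn
    have e2 := hc3 n hn
    simp only [Matrix.cons_val] at e0 e2
    fin_cases i
    · simp; rw [e0]; ring
    · simp; rw [e1]
    · simp; rw [e2]; ring
    · simp; rw [b3 n hn]
    · simp; rw [hcz n hn]
    · simp; rw [b5 n hn]
    · simp; rw [b6 n hn])
  -- The constants are matched with η₁(X₁), …, η₁(X₇) = −p, 1, 0, x, −px, y, (1 − k)z. The field X₃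
  -- is invisible in b, and its coefficient is the additive constant of A.
  refine ⟨![-c3, c7, c1, c6, -c4, c5, cz / (1 - k)], fun n hn => ?_⟩
  have k1' : 1 - k ≠ 0 := fun e => k1 (by linarith)
  have hk2 : c2 = (2 * k - 1) * c4 + k * c5 := by
    rw [← hR' n hn, Tbp n hn, hc4 n hn, hc5 n hn]
  have e0 := hc6 n hn
  have e2 := hc3 n hn
  have e7 := hc7 n hn
  have e1 := hc1 n hn
  simp only [Matrix.cons_val] at e0 e1 e2 e7 ⊢
  constructor
  · have : cz / (1 - k) * ((1 - k) * n 4) = cz * n 4 := by field_simp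
    rw [this]
    linear_combination e7
  · rw [haA n hn, primitivePart, pdT, e0, e2, hcz n hn, hc5 n hn, e1, hk2]
    have : cz / (1 - k) * zCoeff k (n 3) = -(cz * (zCoeff k (n 3) / (k - 1))) := by
      rw [show 1 - k = -(k - 1) by ring]
      field_simp
    rw [this]
    ring


/-! ### The derivatives of `h` -/

theorem iteratedDeriv_profile_succ {k : ℝ} {j : ℕ} {c e : ℝ}
    (h : ∀ q : ℝ, 0 < q → iteratedDeriv j (profile k) q = c * q ^ e) (q : ℝ) (hq : 0 < q) :
    iteratedDeriv (j + 1) (profile k) q = c * e * q ^ (e - 1) := by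
  have h1 : iteratedDeriv j (profile k) =ᶠ[𝓝 q] fun q => c * q ^ e :=
    Filter.eventuallyEq_of_mem (Ioi_mem_nhds hq) h
  rw [iteratedDeriv_succ, h1.deriv_eq,
    ((Real.hasDerivAt_rpow_const (p := e) (Or.inl hq.ne')).const_mul c).deriv, mul_assoc]

theorem iteratedDeriv_profile {k : ℝ} (hk0 : k ≠ 0) (hk1 : k - 1 ≠ 0) (q : ℝ) (hq : 0 < q) :
    profile k q = 1 / (k * (k - 1)) * q ^ k ∧
    deriv (profile k) q = 1 / (k - 1) * q ^ (k - 1) ∧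
    iteratedDeriv 2 (profile k) q = 1 * q ^ (k - 2) ∧
    iteratedDeriv 3 (profile k) q = (k - 2) * q ^ (k - 3) ∧
    iteratedDeriv 4 (profile k) q = (k - 2) * (k - 3) * q ^ (k - 4) ∧
    iteratedDeriv 5 (profile k) q = (k - 2) * (k - 3) * (k - 4) * q ^ (k - 5) := by
  have h0 : ∀ q : ℝ, 0 < q → iteratedDeriv 0 (profile k) q = 1 / (k * (k - 1)) * q ^ k := by
    intro q _
    rw [iteratedDeriv_zero, profile]
    ring
  have step : ∀ {j : ℕ} {c e c' e' : ℝ}, c * e = c' → e - 1 = e' →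
      (∀ q : ℝ, 0 < q → iteratedDeriv j (profile k) q = c * q ^ e) →
      ∀ q : ℝ, 0 < q → iteratedDeriv (j + 1) (profile k) q = c' * q ^ e' := by
    rintro j c e _ _ rfl rfl h q hq
    exact iteratedDeriv_profile_succ h q hq
  have h1 := step (c' := 1 / (k - 1)) (e' := k - 1) (by field_simp) rfl h0
  have h2 := step (c' := 1) (e' := k - 2) (by field_simp) (by ring) h1
  have h3 := step (c' := k - 2) (e' := k - 3) (by ring) (by ring) h2
  have h4 := step (c' := (k - 2) * (k - 3)) (e' := k - 4) (by ring) (by ring) h3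
  have h5 := step (c' := (k - 2) * (k - 3) * (k - 4)) (e' := k - 5) (by ring) (by ring) h4
  refine ⟨?_, ?_, h2 q hq, h3 q hq, h4 q hq, h5 q hq⟩
  · simpa using h0 q hq
  · simpa [iteratedDeriv_one] using h1 q hq

/-- Here h'' = q^(k−2) is the basic symbol, because the forms θⁱ are written in powers of h''. -/
theorem rpow_sub_natCast_forms {k q : ℝ} (hq : 0 < q) :
    q ^ k = q ^ 2 * q ^ (k - 2) ∧ q ^ (k - 1) = q * q ^ (k - 2) ∧
    q ^ (k - 3) = q ^ (k - 2) / q ∧ q ^ (k - 4) = q ^ (k - 2) / q ^ 2 ∧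
    q ^ (k - 5) = q ^ (k - 2) / q ^ 3 := by
  have h : ∀ m : ℕ, q ^ (k - m) = q ^ k / q ^ m := fun m => by
    rw [Real.rpow_sub hq, Real.rpow_natCast]
  have h1 := h 1
  have h2 := h 2
  have h3 := h 3
  have h4 := h 4
  have h5 := h 5
  norm_num at h1 h2 h3 h4 h5
  have hq' := hq.ne'
  rw [h1, h2, h3, h4, h5]
  refine ⟨?_, ?_, ?_, ?_, ?_⟩ <;> field_simp

/-- The derivatives of `h`, expressed by `q` and `u = h''`. -/
theorem profile_jet {k : ℝ} (hk0 : k ≠ 0) (hk1 : k - 1 ≠ 0) {q : ℝ} (hq : 0 < q) :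
    profile k q = q ^ 2 * q ^ (k - 2) / (k * (k - 1)) ∧
    deriv (profile k) q = q * q ^ (k - 2) / (k - 1) ∧
    iteratedDeriv 2 (profile k) q = q ^ (k - 2) ∧
    iteratedDeriv 3 (profile k) q = (k - 2) * q ^ (k - 2) / q ∧
    iteratedDeriv 4 (profile k) q = (k - 2) * (k - 3) * q ^ (k - 2) / q ^ 2 ∧
    iteratedDeriv 5 (profile k) q = (k - 2) * (k - 3) * (k - 4) * q ^ (k - 2) / q ^ 3 := by
  obtain ⟨a0, a1, a2, a3, a4, a5⟩ := iteratedDeriv_profile hk0 hk1 q hq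
  obtain ⟨b0, b1, b3, b4, b5⟩ := rpow_sub_natCast_forms (k := k) hq
  rw [a0, a1, a2, a3, a4, a5, b1, b3, b4, b5, b0]
  refine ⟨?_, ?_, ?_, ?_, ?_, ?_⟩ <;> ring

/-! ### An adapted coframe of the contact distribution -/

/-- The forms η₁ and η₂ with η₃ = dz − h' dp + (q^k/k) dx annihilate D_k; moreover η₁ and η₃
annihilate its derived distribution, and λ = η₃ + vη₁ − wη₂. -/
def eta1 (n ξ : E7) : ℝ := ξ 1 - n 2 * ξ 0

def eta2 (n ξ : E7) : ℝ := ξ 2 - n 3 * ξ 0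

/-- The fibre coordinates `s = v / w` and `t = h'' / w`. -/
def fibS (n : E7) : ℝ := n 5 / n 6

def fibT (k : ℝ) (n : E7) : ℝ := n 3 ^ (k - 2) / n 6

/-- Coefficients of the coframe. -/
def coefE (k : ℝ) (n : E7) : ℝ := (k - 2) * (k + 1) / 30 / (n 3 ^ 2 * fibT k n)

def coefZ (k : ℝ) (n : E7) : ℝ :=
  -((2 * k - 1) * (k - 2) * (k + 1) / 45) / (n 3 ^ 3 * fibT k n ^ 2)

/-- The coframe of the contact distribution, as a matrix with rows `0, 2, 4` and `1, 3, 5`. -/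
def coframe (k : ℝ) (i : Fin 6) (n ξ : E7) : ℝ :=
  let s := fibS n; let t := fibT k n; let E := coefE k n; let Z := coefZ k n; let q := n 3;
  match i with
  | 0 => eta1 n ξ
  | 1 => eta2 n ξ - s * eta1 n ξ
  | 2 => ξ 0 - (2 * t / 3 + (k - 2) / (3 * q)) * eta2 n ξ + s * t / 3 * eta1 n ξ
      + E * (eta2 n ξ - s * eta1 n ξ)
  | 3 => -t * (ξ 3 - s * eta2 n ξ + s ^ 2 / 3 * eta1 n ξ)
  | 4 => s ^ 2 * (Z + t / 18) * eta1 n ξ - s * (Z + E + 2 * t / 9) * eta2 n ξ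
      + (E - (k - 2) / (3 * q) + t / 3) * ξ 3 + ξ 6 / n 6
  | 5 => -s ^ 3 * (E / 3 + t / 18) * eta1 n ξ
      + s ^ 2 * (E / 3 - (k - 2) / (9 * q) + 5 * t / 18) * eta2 n ξ + s ^ 2 / 3 * ξ 0
      + s * ((k - 2) / (3 * q) - 2 * t / 3) * ξ 3 + ξ 5 / n 6 - s * (ξ 6 / n 6)

/-- The quartic form `2 m P₀₁ P₁₂ - P₀₂²` in the minors `P` of a `2 × 3` matrix. -/
def minorQuartic (m : ℝ) (a : Fin 6 → ℝ) : ℝ :=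
  2 * m * ((a 0 * a 3 - a 2 * a 1) * (a 2 * a 5 - a 4 * a 3)) - (a 0 * a 5 - a 4 * a 1) ^ 2

/-- On ker λ the form dz is eliminated. Up to scalars, θ¹, θ³, θ⁵ become the first row of the
matrix, and θ², θ⁴, θ⁶ become the second row plus s times the first, a row operation that does not
affect minors. -/
theorem theta_of_mem_contact {k : ℝ} (hk0 : k ≠ 0) (hk1 : k - 1 ≠ 0) {n : E7} (hq : 0 < n 3)
    (hw : n 6 ≠ 0) {r : ℝ} (hr : r = (n 3 ^ (k - 2)) ^ (1 / 3 : ℝ)) {ξ : E7} (hξ : lam k n ξ = 0) :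
    theta1 (profile k) n ξ = r ^ 4 / (27 * n 6 ^ 4) * coframe k 0 n ξ ∧
    theta2 (profile k) n ξ = r ^ 5 / (27 * n 6 ^ 4) *
      (coframe k 1 n ξ + fibS n * coframe k 0 n ξ) ∧
    theta3 (profile k) n ξ = 1 / (3 * n 6) * coframe k 2 n ξ ∧
    theta4 (profile k) n ξ = r / (3 * n 6) * (coframe k 3 n ξ + fibS n * coframe k 2 n ξ) ∧
    theta5 (profile k) n ξ = n 6 / r * coframe k 4 n ξ ∧
    theta6 (profile k) n ξ = -n 6 * (coframe k 5 n ξ + fibS n * coframe k 4 n ξ) := by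
  obtain ⟨e0, e1, e2, e3, e4, e5⟩ := profile_jet hk0 hk1 hq
  obtain ⟨b0, b1, -, -, -⟩ := rpow_sub_natCast_forms (k := k) hq
  have hu : 0 < n 3 ^ (k - 2) := Real.rpow_pos_of_pos hq _
  have hr0 : 0 < r := hr ▸ Real.rpow_pos_of_pos hu _
  -- All fractional powers of h'' are integral powers of its cube root r, so the six identities
  -- become rational.
  have hp : ∀ m : ℕ, (n 3 ^ (k - 2)) ^ ((m : ℝ) / 3) = r ^ m := by
    intro m
    rw [hr, ← Real.rpow_natCast, ← Real.rpow_mul hu.le]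
    ring_nf
  have p1 := hp 1
  have p3 := hp 3
  have p4 := hp 4
  have p5 := hp 5
  have p8 := hp 8
  have p10 := hp 10
  have p16 := hp 16
  norm_num at p1 p3 p4 p5 p8 p10 p16
  simp only [lam] at hξ
  rw [b0, b1, p3] at hξ
  rw [p3] at e0 e1 e2 e3 e4 e5
  have hz : ξ 4 = (n 6 + n 3 * r ^ 3 / (k - 1)) * ξ 2 - n 5 * ξ 1
      - (n 6 * n 3 - n 5 * n 2 + n 3 ^ 2 * r ^ 3 / k) * ξ 0 := by linear_combination hξ
  rw [p3] at p1 p4 p5 p8 p10 p16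
  simp only [theta1, theta2, theta3, theta4, theta5, theta6, coframe, coefE, coefZ, fibS, fibT,
    eta1, eta2]
  rw [e0, e1, e2, e3, e4, e5, p3, hz, p4, p5, p8, p10, p16]
  norm_num only
  rw [p1]
  generalize n 3 = q at *
  generalize n 5 = v at *
  generalize n 6 = w at *
  generalize n 2 = p at *
  have hr' := hr0.ne'
  have hq' := hq.ne'
  clear hξ hz e0 e1 e2 e3 e4 e5 p1 p3 p4 p5 p8 p10 p16 hp hr hu b0 b1
  refine ⟨?_, ?_, ?_, ?_, ?_, ?_⟩
  · field_simp
    ring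
  · field_simp
    ring
  · field_simp
    ring
  · field_simp
    ring
  · field_simp
    ring
  · field_simp
    ring

/-- After the row operation and the rescalings of `theta_of_mem_contact`, Υ is a quadratic form in
the three minors. The parameter s drops out, and only m = 1/t remains besides a common factor. -/
theorem upsilon_of_mem_contact {k : ℝ} (hk0 : k ≠ 0) (hk1 : k - 1 ≠ 0) {n : E7} (hq : 0 < n 3)
    (hw : n 6 ≠ 0) {ξ : E7} (hξ : lam k n ξ = 0) :
    upsilon (profile k) n ξ = (n 3 ^ (k - 2)) ^ (8 / 3 : ℝ) / (243 * n 6 ^ 6) *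
      minorQuartic (1 / fibT k n) fun i => coframe k i n ξ := by
  have hu : 0 < n 3 ^ (k - 2) := Real.rpow_pos_of_pos hq _
  have hp : ∀ m : ℕ, (n 3 ^ (k - 2)) ^ ((m : ℝ) / 3) = ((n 3 ^ (k - 2)) ^ (1 / 3 : ℝ)) ^ m := by
    intro m
    rw [← Real.rpow_natCast, ← Real.rpow_mul hu.le]
    ring_nf
  have p8 := hp 8
  have p3 := hp 3
  norm_num only at p8 p3
  rw [Real.rpow_one] at p3
  obtain ⟨e1, e2, e3, e4, e5, e6⟩ := theta_of_mem_contact hk0 hk1 hq hw rfl hξ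
  have hr : 0 < (n 3 ^ (k - 2)) ^ (1 / 3 : ℝ) := Real.rpow_pos_of_pos hu _
  simp only [upsilon, minorQuartic]
  rw [e1, e2, e3, e4, e5, e6, p8]
  rw [fibT, ← show ((n 3 ^ (k - 2)) ^ (1 / 3 : ℝ)) ^ 3 = n 3 ^ (k - 2) from p3.symm]
  generalize coframe k 0 n ξ = a0
  generalize coframe k 1 n ξ = a1
  generalize coframe k 2 n ξ = a2
  generalize coframe k 3 n ξ = a3
  generalize coframe k 4 n ξ = a4
  generalize coframe k 5 n ξ = a5
  generalize fibS n = s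
  have : (((n 3 ^ (k - 2)) ^ (1 / 3 : ℝ)) ^ 3) ^ (1 / 3 : ℝ) = (n 3 ^ (k - 2)) ^ (1 / 3 : ℝ) := by
    rw [← p3]
  rw [this]
  generalize (n 3 ^ (k - 2)) ^ (1 / 3 : ℝ) = r at *
  field_simp
  ring


/-! ### Lie derivatives -/

/-- The Lie derivative is the derivative of F, as a function on the tangent bundle, along the
complete lift (X, DX ξ) of X. In this form it obeys the sum, product and chain rules. -/
theorem lieDerivative_eq_fderiv {X : E7 → E7} {F : E7 → E7 → ℝ} {n ξ : E7}
    (hF : DifferentiableAt ℝ (fun x : E7 × E7 => F x.1 x.2) (n, ξ)) :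
    lieDerivative X F n ξ =
      fderiv ℝ (fun x : E7 × E7 => F x.1 x.2) (n, ξ) (X n, fderiv ℝ X n ξ) := by
  have h1 : HasFDerivAt (fun n' => F n' ξ) _ n :=
    hF.hasFDerivAt.comp (f := fun n' : E7 => (n', ξ)) n (hasFDerivAt_prodMk_left n ξ)
  have h2 : HasFDerivAt (F n) _ ξ :=
    hF.hasFDerivAt.comp (f := fun ξ' : E7 => (n, ξ')) ξ (hasFDerivAt_prodMk_right n ξ)
  rw [lieDerivative, h1.fderiv, h2.fderiv]
  simp only [ContinuousLinearMap.comp_apply, ← map_add]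
  simp

theorem lam_e4 (k : ℝ) (n : E7) : lam k n (Pi.single 4 1) = 1 := by
  simp [lam]

theorem differentiableAt_lam {k : ℝ} {n : E7} (hq : n 3 ≠ 0) (ξ : E7) :
    DifferentiableAt ℝ (fun x : E7 × E7 => lam k x.1 x.2) (n, ξ) := by
  have hq' : ((n, ξ) : E7 × E7).1 3 ≠ 0 := hq
  unfold lam
  have h3 : DifferentiableAt ℝ (fun x : E7 × E7 => x.1 3) (n, ξ) := by fun_prop
  have h1 : DifferentiableAt ℝ (fun x : E7 × E7 => x.1 3 ^ (k - 1)) (n, ξ) :=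
    h3.rpow_const (Or.inl hq')
  have h2 : DifferentiableAt ℝ (fun x : E7 × E7 => x.1 3 ^ k) (n, ξ) := h3.rpow_const (Or.inl hq')
  fun_prop

/-- The wedge condition is tested against ∂_z, on which λ equals 1. -/
theorem lieDerivative_lam_eq_zero {k : ℝ} {X : E7 → E7} {n : E7}
    (h : ∀ ξ η : E7,
      lieDerivative X (lam k) n ξ * lam k n η - lieDerivative X (lam k) n η * lam k n ξ = 0)
    {ξ : E7} (hξ : lam k n ξ = 0) : lieDerivative X (lam k) n ξ = 0 := by
  have := h ξ (Pi.single 4 1)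
  rwa [lam_e4, hξ, mul_one, mul_zero, sub_zero] at this

/-- The Lie derivative along an infinitesimal contact transformation of a tensor field restricted
to the contact distribution depends only on that restriction. -/
theorem lieDerivative_congr_contact {k : ℝ} {X : E7 → E7} {F G : E7 → E7 → ℝ} {n ξ : E7}
    (hq : n 3 ≠ 0)
    (hF : DifferentiableAt ℝ (fun x : E7 × E7 => F x.1 x.2) (n, ξ))
    (hG : DifferentiableAt ℝ (fun x : E7 × E7 => G x.1 x.2) (n, ξ))
    (h : ∀ᶠ n' in 𝓝 n, ∀ ξ' : E7, lam k n' ξ' = 0 → F n' ξ' = G n' ξ')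
    (hξ : lam k n ξ = 0) (hL : lieDerivative X (lam k) n ξ = 0) :
    lieDerivative X F n ξ = lieDerivative X G n ξ := by
  -- φ projects tangent vectors to ker λ along ∂_z, so F ∘ φ = G ∘ φ near the point. The complete
  -- lift of X is fixed by the differential of φ, because L_Xλ vanishes on ξ. Hence F and G have the
  -- same derivative along it.
  set φ : E7 × E7 → E7 × E7 := fun x => (x.1, x.2 - lam k x.1 x.2 • Pi.single 4 1) with hφ
  have hl := differentiableAt_lam (k := k) hq ξ
  have hφd : HasFDerivAt φ ((ContinuousLinearMap.fst ℝ E7 E7).prod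
      (ContinuousLinearMap.snd ℝ E7 E7 - (fderiv ℝ (fun x : E7 × E7 => lam k x.1 x.2)
        (n, ξ)).smulRight (Pi.single 4 (1 : ℝ)))) (n, ξ) :=
    hasFDerivAt_fst.prodMk (hasFDerivAt_snd.sub (hl.hasFDerivAt.smul_const _))
  have hφ0 : φ (n, ξ) = (n, ξ) := by simp [hφ, hξ]
  have hlam : ∀ x : E7 × E7, lam k (φ x).1 (φ x).2 = 0 := by
    intro x
    simp [hφ, lam]
    ring
  rw [lieDerivative_eq_fderiv hl] at hL
  rw [lieDerivative_eq_fderiv hF, lieDerivative_eq_fderiv hG]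
  have hval : ((ContinuousLinearMap.fst ℝ E7 E7).prod
      (ContinuousLinearMap.snd ℝ E7 E7 - (fderiv ℝ (fun x : E7 × E7 => lam k x.1 x.2)
        (n, ξ)).smulRight (Pi.single 4 (1 : ℝ)))) (X n, fderiv ℝ X n ξ) =
      (X n, fderiv ℝ X n ξ) := by
    simp [hL]
  have e : (fun x => F (φ x).1 (φ x).2) =ᶠ[𝓝 (n, ξ)] fun x => G (φ x).1 (φ x).2 := by
    filter_upwards [continuous_fst.continuousAt.eventually h] with x hx
    exact hx _ (hlam x)
  have hF' : HasFDerivAt (fun x => F (φ x).1 (φ x).2) _ (n, ξ) :=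
    HasFDerivAt.comp (g := fun x : E7 × E7 => F x.1 x.2) (n, ξ)
      (by rw [hφ0]; exact hF.hasFDerivAt) hφd
  have hG' : HasFDerivAt (fun x => G (φ x).1 (φ x).2) _ (n, ξ) :=
    HasFDerivAt.comp (g := fun x : E7 × E7 => G x.1 x.2) (n, ξ)
      (by rw [hφ0]; exact hG.hasFDerivAt) hφd
  have := (hF'.congr_of_eventuallyEq e.symm).unique hG'
  have := congrArg (fun T => T (X n, fderiv ℝ X n ξ)) this
  simpa only [ContinuousLinearMap.comp_apply, hval] using this

theorem isLinearMap_lieDerivative {X : E7 → E7} {F : E7 → E7 → ℝ} {n : E7}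
    (hF : ∀ n', IsLinearMap ℝ (F n')) (hd : ∀ ξ, DifferentiableAt ℝ (fun n' => F n' ξ) n) :
    IsLinearMap ℝ (lieDerivative X F n) ∧
    ∀ ξ, lieDerivative X F n ξ = fderiv ℝ (fun n' => F n' ξ) n (X n) + F n (fderiv ℝ X n ξ) := by
  have h2 : ∀ ξ ζ, fderiv ℝ (F n) ξ ζ = F n ζ := by
    intro ξ ζ
    have : F n = (hF n).mk'.toContinuousLinearMap := rfl
    conv_lhs => rw [this]
    rw [ContinuousLinearMap.fderiv]
    rfl
  have h3 : ∀ ξ, lieDerivative X F n ξ =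
      fderiv ℝ (fun n' => F n' ξ) n (X n) + F n (fderiv ℝ X n ξ) := by
    intro ξ
    rw [lieDerivative, h2]
  refine ⟨⟨fun ξ η => ?_, fun c ξ => ?_⟩, h3⟩
  · have : (fun n' => F n' (ξ + η)) = fun n' => F n' ξ + F n' η := by
      funext n'; exact (hF n').map_add ξ η
    rw [h3, h3, h3, this, fderiv_fun_add (hd ξ) (hd η), map_add, (hF n).map_add]
    simp only [add_apply]
    ring
  · have : (fun n' => F n' (c • ξ)) = fun n' => c * F n' ξ := by
      funext n'; exact (hF n').map_smul c ξ
    rw [h3, h3, this, fderiv_const_mul (hd ξ), map_smul, (hF n).map_smul]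
    simp only [smul_apply, smul_eq_mul]
    ring

/-! ### The infinitesimal stabilizer of the quartic form -/

/-- The derivative of `minorQuartic` in the direction `(m', a')`. -/
def minorQuarticDeriv (m m' : ℝ) (a a' : Fin 6 → ℝ) : ℝ :=
  2 * m' * ((a 0 * a 3 - a 2 * a 1) * (a 2 * a 5 - a 4 * a 3))
  + 2 * m * ((a' 0 * a 3 + a 0 * a' 3 - a' 2 * a 1 - a 2 * a' 1) * (a 2 * a 5 - a 4 * a 3)
    + (a 0 * a 3 - a 2 * a 1) * (a' 2 * a 5 + a 2 * a' 5 - a' 4 * a 3 - a 4 * a' 3))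
  - 2 * (a 0 * a 5 - a 4 * a 1) * (a' 0 * a 5 + a 0 * a' 5 - a' 4 * a 1 - a 4 * a' 1)

/-- Both sides are quartic polynomials in t, and the conclusions come from comparing individual
coefficients. Only the entries needed later are recorded; the list does not describe the whole
stabilizer. Each coefficient is isolated by a finite difference over integer points. -/
theorem stabilizer_equations {m m' f : ℝ} (hm : m ≠ 0) (D : Fin 6 → Fin 6 → ℝ)
    (h : ∀ t : Fin 6 → ℝ,
      minorQuarticDeriv m m' t (fun i => ∑ j, D i j * t j) = f * minorQuartic m t) :
    D 0 4 = 0 ∧ D 0 5 = 0 ∧ D 1 4 = 0 ∧ D 1 5 = 0 ∧ D 2 5 = 0 ∧ D 3 4 = 0 ∧ D 2 4 = D 3 5 ∧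
      D 4 1 = 0 := by
  have H : ∀ a b c d e g : ℝ, _ := fun a b c d e g => h ![a, b, c, d, e, g]
  simp only [minorQuarticDeriv, minorQuartic, Fin.sum_univ_six, Matrix.cons_val] at H
  -- The combination 8F(1) − 8F(−1) − F(2) + F(−2) annihilates even and cubic terms and returns
  -- twelve times the linear coefficient, here that of a₀a₅³. The entries (1,4) and (4,1) are found
  -- in the same way from a₁a₄³ and a₁³a₄.
  have d05 : D 0 5 = 0 := by
    linear_combination (-1 / 24) * (8 * H 1 0 0 0 0 1 - 8 * H (-1) 0 0 0 0 1 - H 2 0 0 0 0 1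
      + H (-2) 0 0 0 0 1)
  have d14 : D 1 4 = 0 := by
    linear_combination (-1 / 24) * (8 * H 0 1 0 0 1 0 - 8 * H 0 (-1) 0 0 1 0 - H 0 2 0 0 1 0
      + H 0 (-2) 0 0 1 0)
  have d41 : D 4 1 = 0 := by
    linear_combination (-1 / 24) * (8 * H 0 1 0 0 1 0 - 8 * H 0 1 0 0 (-1) 0 - H 0 1 0 0 2 0
      + H 0 1 0 0 (-2) 0)
  have d25 : m * D 2 5 = 0 := by
    linear_combination (-1 / 48) * (H 0 1 1 0 0 2 - H 0 (-1) 1 0 0 2 - H 0 1 (-1) 0 0 2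
      + H 0 (-1) (-1) 0 0 2 - (H 0 1 1 0 0 1 - H 0 (-1) 1 0 0 1 - H 0 1 (-1) 0 0 1
      + H 0 (-1) (-1) 0 0 1))
  have d34 : m * D 3 4 = 0 := by
    linear_combination (-1 / 48) * (H 1 0 0 1 2 0 - H (-1) 0 0 1 2 0 - H 1 0 0 (-1) 2 0
      + H (-1) 0 0 (-1) 2 0 - (H 1 0 0 1 1 0 - H (-1) 0 0 1 1 0 - H 1 0 0 (-1) 1 0
      + H (-1) 0 0 (-1) 1 0))
  have d15 : m * D 1 5 = 0 := by
    linear_combination (-1 / 48) * (16 * (H 0 0 1 0 0 1 + H 0 0 (-1) 0 0 1)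
      - (H 0 0 2 0 0 1 + H 0 0 (-2) 0 0 1))
  have d04 : D 0 4 - D 1 5 = 0 := by
    linear_combination (-1 / 24) * (H 1 0 0 0 1 2 - H (-1) 0 0 0 1 2 - H 1 0 0 0 (-1) 2
      + H (-1) 0 0 0 (-1) 2 - (H 1 0 0 0 1 1 - H (-1) 0 0 0 1 1 - H 1 0 0 0 (-1) 1
      + H (-1) 0 0 0 (-1) 1))
  -- `eA` and `eC` are the coefficients of a₁a₂a₄a₅ and a₀a₂a₅². Each involves the entry (0,2),
  -- which cancels in their sum.
  have eA : -2 * m * (2 * D 2 4 - D 3 5) + 2 * D 0 2 = 0 := by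
    linear_combination (1 / 8) * (H 0 1 1 0 1 1 - H 0 (-1) 1 0 1 1 - H 0 1 (-1) 0 1 1
      - H 0 1 1 0 (-1) 1 + H 0 (-1) (-1) 0 1 1 + H 0 (-1) 1 0 (-1) 1 + H 0 1 (-1) 0 (-1) 1
      - H 0 (-1) (-1) 0 (-1) 1)
  have eC : 2 * m * D 3 5 - 2 * D 0 2 = 0 := by
    linear_combination (1 / 12) * (H 1 0 1 0 0 2 - H (-1) 0 1 0 0 2 - H 1 0 (-1) 0 0 2
      + H (-1) 0 (-1) 0 0 2 - (H 1 0 1 0 0 1 - H (-1) 0 1 0 0 1 - H 1 0 (-1) 0 0 1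
      + H (-1) 0 (-1) 0 0 1))
  have z : ∀ {x : ℝ}, m * x = 0 → x = 0 := fun hx => (mul_eq_zero.1 hx).resolve_left hm
  have d15' := z d15
  refine ⟨by linarith, d05, d14, d15', z d25, z d34, ?_, d41⟩
  have : m * (D 2 4 - D 3 5) = 0 := by linear_combination (-1 / 4) * (eA + eC)
  linarith [z this]


/-! ### Regularity of the tensors, and the symmetry equations in the coframe -/

theorem differentiableAt_coframe {k : ℝ} {n : E7} (hq : 0 < n 3) (hw : n 6 ≠ 0) (ξ : E7)
    (i : Fin 6) : DifferentiableAt ℝ (fun x : E7 × E7 => coframe k i x.1 x.2) (n, ξ) := by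
  have hq' : ((n, ξ) : E7 × E7).1 3 ≠ 0 := hq.ne'
  have hw' : ((n, ξ) : E7 × E7).1 6 ≠ 0 := hw
  have h3 : DifferentiableAt ℝ (fun x : E7 × E7 => x.1 3) (n, ξ) := by fun_prop
  have hu : DifferentiableAt ℝ (fun x : E7 × E7 => x.1 3 ^ (k - 2)) (n, ξ) :=
    h3.rpow_const (Or.inl hq')
  have hS : DifferentiableAt ℝ (fun x : E7 × E7 => fibS x.1) (n, ξ) := by
    unfold fibS
    fun_prop (disch := assumption)
  have hT : DifferentiableAt ℝ (fun x : E7 × E7 => fibT k x.1) (n, ξ) := by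
    unfold fibT
    fun_prop (disch := assumption)
  have hT0 : fibT k ((n, ξ) : E7 × E7).1 ≠ 0 :=
    div_ne_zero (Real.rpow_pos_of_pos hq _).ne' hw
  have hE : DifferentiableAt ℝ (fun x : E7 × E7 => coefE k x.1) (n, ξ) := by
    unfold coefE
    have : ((n, ξ) : E7 × E7).1 3 ^ 2 * fibT k ((n, ξ) : E7 × E7).1 ≠ 0 :=
      mul_ne_zero (pow_ne_zero _ hq') hT0
    fun_prop (disch := assumption)
  have hZ : DifferentiableAt ℝ (fun x : E7 × E7 => coefZ k x.1) (n, ξ) := by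
    unfold coefZ
    have : ((n, ξ) : E7 × E7).1 3 ^ 3 * fibT k ((n, ξ) : E7 × E7).1 ^ 2 ≠ 0 :=
      mul_ne_zero (pow_ne_zero _ hq') (pow_ne_zero _ hT0)
    fun_prop (disch := assumption)
  have h3' : (3 : ℝ) * ((n, ξ) : E7 × E7).1 3 ≠ 0 := mul_ne_zero (by norm_num) hq'
  have h9' : (9 : ℝ) * ((n, ξ) : E7 × E7).1 3 ≠ 0 := mul_ne_zero (by norm_num) hq'
  fin_cases i <;> (simp only [coframe, eta1, eta2]; fun_prop (disch := assumption))

theorem isLinearMap_coframe (k : ℝ) (i : Fin 6) (n : E7) : IsLinearMap ℝ (coframe k i n) := by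
  constructor
  · intro ξ η
    fin_cases i <;> simp only [coframe, eta1, eta2, Pi.add_apply] <;> ring
  · intro c ξ
    fin_cases i <;> simp only [coframe, eta1, eta2, Pi.smul_apply, smul_eq_mul] <;> ring

theorem contDiffAt_iteratedDeriv_profile {k : ℝ} {j : ℕ} {q : ℝ} (hq : 0 < q) :
    ContDiffAt ℝ ∞ (iteratedDeriv j (profile k)) q := by
  induction j with
  | zero =>
    rw [iteratedDeriv_zero]
    exact (Real.contDiffAt_rpow_const_of_ne hq.ne').div_const _
  | succ j ih =>
    rw [iteratedDeriv_succ]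
    have : deriv (iteratedDeriv j (profile k)) =
        fun q => fderiv ℝ (iteratedDeriv j (profile k)) q 1 := by
      funext q; simp
    rw [this]
    exact (ih.fderiv_right le_rfl).clm_apply contDiffAt_const

theorem differentiableAt_theta {k : ℝ} (hk0 : k ≠ 0) (hk1 : k - 1 ≠ 0) {n : E7} (hq : 0 < n 3)
    (hw : n 6 ≠ 0) (ξ : E7) :
    DifferentiableAt ℝ (fun x : E7 × E7 => theta1 (profile k) x.1 x.2) (n, ξ) ∧
    DifferentiableAt ℝ (fun x : E7 × E7 => theta2 (profile k) x.1 x.2) (n, ξ) ∧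
    DifferentiableAt ℝ (fun x : E7 × E7 => theta3 (profile k) x.1 x.2) (n, ξ) ∧
    DifferentiableAt ℝ (fun x : E7 × E7 => theta4 (profile k) x.1 x.2) (n, ξ) ∧
    DifferentiableAt ℝ (fun x : E7 × E7 => theta5 (profile k) x.1 x.2) (n, ξ) ∧
    DifferentiableAt ℝ (fun x : E7 × E7 => theta6 (profile k) x.1 x.2) (n, ξ) := by
  have hw' : ((n, ξ) : E7 × E7).1 6 ≠ 0 := hw
  have h3 : DifferentiableAt ℝ (fun x : E7 × E7 => x.1 3) (n, ξ) := by fun_prop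
  have hd : ∀ {φ : ℝ → ℝ}, ContDiffAt ℝ ∞ φ (n 3) →
      DifferentiableAt ℝ (fun x : E7 × E7 => φ (x.1 3)) (n, ξ) := fun {φ} hφ =>
    DifferentiableAt.comp (g := φ) (f := fun x : E7 × E7 => x.1 3) (n, ξ)
      (hφ.differentiableAt (by simp)) h3
  have i0 : DifferentiableAt ℝ (fun x : E7 × E7 => profile k (x.1 3)) (n, ξ) := by
    simpa using hd (contDiffAt_iteratedDeriv_profile (k := k) (j := 0) hq)
  have i1 : DifferentiableAt ℝ (fun x : E7 × E7 => deriv (profile k) (x.1 3)) (n, ξ) := by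
    simpa [iteratedDeriv_one] using hd (contDiffAt_iteratedDeriv_profile (k := k) (j := 1) hq)
  have i2 : DifferentiableAt ℝ (fun x : E7 × E7 => iteratedDeriv 2 (profile k) (x.1 3)) (n, ξ) :=
    hd (contDiffAt_iteratedDeriv_profile hq)
  have i3 : DifferentiableAt ℝ (fun x : E7 × E7 => iteratedDeriv 3 (profile k) (x.1 3)) (n, ξ) :=
    hd (contDiffAt_iteratedDeriv_profile hq)
  have i4 : DifferentiableAt ℝ (fun x : E7 × E7 => iteratedDeriv 4 (profile k) (x.1 3)) (n, ξ) :=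
    hd (contDiffAt_iteratedDeriv_profile hq)
  have i5 : DifferentiableAt ℝ (fun x : E7 × E7 => iteratedDeriv 5 (profile k) (x.1 3)) (n, ξ) :=
    hd (contDiffAt_iteratedDeriv_profile hq)
  have hpos : 0 < iteratedDeriv 2 (profile k) (((n, ξ) : E7 × E7).1 3) := by
    rw [(profile_jet hk0 hk1 hq).2.2.1]
    exact Real.rpow_pos_of_pos hq _
  have hne := hpos.ne'
  have hr : ∀ a : ℝ, DifferentiableAt ℝ
      (fun x : E7 × E7 => iteratedDeriv 2 (profile k) (x.1 3) ^ a) (n, ξ) := fun a =>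
    i2.rpow_const (Or.inl hne)
  have r1 := hr (1 / 3)
  have r4 := hr (4 / 3)
  have r5 := hr (5 / 3)
  have r8 := hr (8 / 3)
  have r10 := hr (10 / 3)
  have r16 := hr (16 / 3)
  have hn : ∀ a : ℝ, iteratedDeriv 2 (profile k) (((n, ξ) : E7 × E7).1 3) ^ a ≠ 0 := fun a =>
    (Real.rpow_pos_of_pos hpos a).ne'
  have n1 := hn (1 / 3)
  have n4 := hn (4 / 3)
  have n8 := hn (8 / 3)
  have n10 := hn (10 / 3)
  have n16 := hn (16 / 3)
  refine ⟨?_, ?_, ?_, ?_, ?_, ?_⟩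
  · simp only [theta1]
    fun_prop (disch := simp [*])
  · simp only [theta2]
    fun_prop (disch := simp [*])
  · simp only [theta3]
    fun_prop (disch := simp [*])
  · simp only [theta4]
    fun_prop (disch := simp [*])
  · simp only [theta5]
    fun_prop (disch := simp [*])
  · simp only [theta6]
    fun_prop (disch := simp [*])

theorem isLinearMap_theta (h : ℝ → ℝ) (n : E7) :
    IsLinearMap ℝ (theta1 h n) ∧ IsLinearMap ℝ (theta2 h n) ∧ IsLinearMap ℝ (theta3 h n) ∧
    IsLinearMap ℝ (theta4 h n) ∧ IsLinearMap ℝ (theta5 h n) ∧ IsLinearMap ℝ (theta6 h n) := by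
  refine ⟨⟨?_, ?_⟩, ⟨?_, ?_⟩, ⟨?_, ?_⟩, ⟨?_, ?_⟩, ⟨?_, ?_⟩, ⟨?_, ?_⟩⟩ <;> intro a b <;>
    simp only [theta1, theta2, theta3, theta4, theta5, theta6, Pi.add_apply, Pi.smul_apply,
      smul_eq_mul] <;> ring

theorem differentiableAt_upsilon {k : ℝ} (hk0 : k ≠ 0) (hk1 : k - 1 ≠ 0) {n : E7} (hq : 0 < n 3)
    (hw : n 6 ≠ 0) (ξ : E7) :
    DifferentiableAt ℝ (fun x : E7 × E7 => upsilon (profile k) x.1 x.2) (n, ξ) := by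
  obtain ⟨h1, h2, h3, h4, h5, h6⟩ := differentiableAt_theta hk0 hk1 hq hw ξ
  simp only [upsilon]
  fun_prop

/-- The value of `Υ` on contact vectors, in terms of the coframe. -/
def upsilonContact (k : ℝ) (n ξ : E7) : ℝ :=
  (n 3 ^ (k - 2)) ^ (8 / 3 : ℝ) / (243 * n 6 ^ 6) *
    minorQuartic (1 / fibT k n) fun i => coframe k i n ξ

/-- The Leibniz rule: the derivative falls on the conformal factor, on m = 1/t, or on the entries of
the matrix. Only m' is recorded explicitly, as g' is absorbed into the multiplier f later. -/
theorem lieDerivative_upsilonContact {k : ℝ} {n : E7} (hq : 0 < n 3) (hw : n 6 ≠ 0)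
    (X : E7 → E7) : ∃ g' m' : ℝ, m' = fderiv ℝ (fun n => 1 / fibT k n) n (X n) ∧ ∀ ξ : E7,
      DifferentiableAt ℝ (fun x : E7 × E7 => upsilonContact k x.1 x.2) (n, ξ) ∧
      lieDerivative X (upsilonContact k) n ξ =
        g' * (minorQuartic (1 / fibT k n) fun i => coframe k i n ξ) +
        (n 3 ^ (k - 2)) ^ (8 / 3 : ℝ) / (243 * n 6 ^ 6) *
          minorQuarticDeriv (1 / fibT k n) m' (fun i => coframe k i n ξ)
            fun i => lieDerivative X (coframe k i) n ξ := by
  set g : E7 → ℝ := fun n => (n 3 ^ (k - 2)) ^ (8 / 3 : ℝ) / (243 * n 6 ^ 6) with hg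
  set m : E7 → ℝ := fun n => 1 / fibT k n with hm
  have hu : 0 < n 3 ^ (k - 2) := Real.rpow_pos_of_pos hq _
  have h3 : DifferentiableAt ℝ (fun n : E7 => n 3) n := differentiableAt_coord 3 n
  have hu' : DifferentiableAt ℝ (fun n : E7 => n 3 ^ (k - 2)) n := h3.rpow_const (Or.inl hq.ne')
  have dg : DifferentiableAt ℝ g n := by
    have h1 : DifferentiableAt ℝ (fun n : E7 => (n 3 ^ (k - 2)) ^ (8 / 3 : ℝ)) n :=
      hu'.rpow_const (Or.inl hu.ne')
    have : 243 * n 6 ^ 6 ≠ 0 := mul_ne_zero (by norm_num) (pow_ne_zero _ hw)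
    fun_prop (disch := assumption)
  have dm : DifferentiableAt ℝ m n := by
    have : fibT k n ≠ 0 := div_ne_zero hu.ne' hw
    have hT : DifferentiableAt ℝ (fibT k) n := by
      unfold fibT
      fun_prop (disch := assumption)
    fun_prop (disch := assumption)
  refine ⟨fderiv ℝ g n (X n), fderiv ℝ m n (X n), rfl, fun ξ => ?_⟩
  have hc : ∀ i, HasFDerivAt (fun x : E7 × E7 => coframe k i x.1 x.2)
      (fderiv ℝ (fun x : E7 × E7 => coframe k i x.1 x.2) (n, ξ)) (n, ξ) := fun i =>
    (differentiableAt_coframe hq hw ξ i).hasFDerivAt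
  have hgx : HasFDerivAt (fun x : E7 × E7 => g x.1)
      ((fderiv ℝ g n).comp (ContinuousLinearMap.fst ℝ E7 E7)) (n, ξ) :=
    HasFDerivAt.comp (g := g) (f := Prod.fst) ((n, ξ) : E7 × E7) dg.hasFDerivAt hasFDerivAt_fst
  have hmx : HasFDerivAt (fun x : E7 × E7 => m x.1)
      ((fderiv ℝ m n).comp (ContinuousLinearMap.fst ℝ E7 E7)) (n, ξ) :=
    HasFDerivAt.comp (g := m) (f := Prod.fst) ((n, ξ) : E7 × E7) dm.hasFDerivAt hasFDerivAt_fst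
  have e : (fun x : E7 × E7 => upsilonContact k x.1 x.2) = fun x => g x.1 *
      (2 * m x.1 * ((coframe k 0 x.1 x.2 * coframe k 3 x.1 x.2
        - coframe k 2 x.1 x.2 * coframe k 1 x.1 x.2) * (coframe k 2 x.1 x.2 * coframe k 5 x.1 x.2
        - coframe k 4 x.1 x.2 * coframe k 3 x.1 x.2))
      - (coframe k 0 x.1 x.2 * coframe k 5 x.1 x.2
        - coframe k 4 x.1 x.2 * coframe k 1 x.1 x.2) ^ 2) := rfl
  have main := hgx.mul (((hmx.const_mul 2).mul ((((hc 0).mul (hc 3)).sub ((hc 2).mul (hc 1))).mul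
    (((hc 2).mul (hc 5)).sub ((hc 4).mul (hc 3))))).sub
    ((((hc 0).mul (hc 5)).sub ((hc 4).mul (hc 1))).pow 2))
  have hd : DifferentiableAt ℝ (fun x : E7 × E7 => upsilonContact k x.1 x.2) (n, ξ) := by
    rw [e]; exact main.differentiableAt
  refine ⟨hd, ?_⟩
  rw [lieDerivative_eq_fderiv hd, e]
  have main' : fderiv ℝ _ (n, ξ) = _ := main.fderiv
  refine (congrArg (fun T => T (X n, fderiv ℝ X n ξ)) main').trans ?_
  have hl : ∀ i, lieDerivative X (coframe k i) n ξ =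
      fderiv ℝ (fun x : E7 × E7 => coframe k i x.1 x.2) (n, ξ) (X n, fderiv ℝ X n ξ) := fun i =>
    lieDerivative_eq_fderiv (differentiableAt_coframe hq hw ξ i)
  simp only [minorQuartic, minorQuarticDeriv, hl]
  simp
  ring

theorem upsilon_eventuallyEq {k : ℝ} (hk0 : k ≠ 0) (hk1 : k - 1 ≠ 0) {n : E7} (hq : 0 < n 3)
    (hw : n 6 ≠ 0) : ∀ᶠ n' in 𝓝 n, ∀ ξ : E7, lam k n' ξ = 0 →
      upsilon (profile k) n' ξ = upsilonContact k n' ξ := by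
  have h1 : ∀ᶠ n' : E7 in 𝓝 n, 0 < n' 3 := (continuous_apply 3).continuousAt.eventually_const_lt hq
  have h2 : ∀ᶠ n' : E7 in 𝓝 n, n' 6 ≠ 0 := (continuous_apply 6).continuousAt.eventually_ne hw
  filter_upwards [h1, h2] with n' h1 h2 ξ hξ
  exact upsilon_of_mem_contact hk0 hk1 h1 h2 hξ

/-- The six forms and λ are independent, since the system is triangular: it is solved successively
for η₁, η₂, dx, dq, dw, dv, and λ = 0 then determines dz. -/
theorem exists_contact_vector {k : ℝ} {n : E7} (hq : 0 < n 3) (hw : n 6 ≠ 0) (t : Fin 6 → ℝ) :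
    ∃ ξ : E7, lam k n ξ = 0 ∧ ∀ i, coframe k i n ξ = t i := by
  have hT : fibT k n ≠ 0 := div_ne_zero (Real.rpow_pos_of_pos hq _).ne' hw
  set s := fibS n
  set T := fibT k n
  set E := coefE k n
  set Z := coefZ k n
  obtain ⟨y1, h1⟩ : ∃ y1, y1 = t 0 := ⟨_, rfl⟩
  obtain ⟨y2, h2⟩ : ∃ y2, y2 = t 1 + s * t 0 := ⟨_, rfl⟩
  obtain ⟨x, hx⟩ : ∃ x, x = t 2 - (-(2 * T / 3 + (k - 2) / (3 * n 3)) * y2 + s * T / 3 * y1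
      + E * (y2 - s * y1)) := ⟨_, rfl⟩
  obtain ⟨q, hq'⟩ : ∃ q, q = -t 3 / T + s * y2 - s ^ 2 / 3 * y1 := ⟨_, rfl⟩
  obtain ⟨w, hw'⟩ : ∃ w, w = n 6 * (t 4 - (s ^ 2 * (Z + T / 18) * y1
    - s * (Z + E + 2 * T / 9) * y2 + (E - (k - 2) / (3 * n 3) + T / 3) * q)) := ⟨_, rfl⟩
  obtain ⟨v, hv⟩ : ∃ v, v = n 6 * (t 5 - (-s ^ 3 * (E / 3 + T / 18) * y1
      + s ^ 2 * (E / 3 - (k - 2) / (9 * n 3) + 5 * T / 18) * y2 + s ^ 2 / 3 * x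
      + s * ((k - 2) / (3 * n 3) - 2 * T / 3) * q - s * (w / n 6))) := ⟨_, rfl⟩
  refine ⟨![x, y1 + n 2 * x, y2 + n 3 * x, q, (n 6 + n 3 ^ (k - 1) / (k - 1)) * (y2 + n 3 * x)
    - n 5 * (y1 + n 2 * x) - (n 6 * n 3 - n 5 * n 2 + n 3 ^ k / k) * x, v, w], ?_, ?_⟩
  · simp [lam]
    ring
  · have f1 : ∀ a b c d e f g : ℝ, eta1 n ![a, b, c, d, e, f, g] = b - n 2 * a :=
      fun _ _ _ _ _ _ _ => rfl
    have f2 : ∀ a b c d e f g : ℝ, eta2 n ![a, b, c, d, e, f, g] = c - n 3 * a :=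
      fun _ _ _ _ _ _ _ => rfl
    intro i
    fin_cases i
    · simp [coframe, f1, h1]
    · simp only [coframe, f1, f2, Fin.mk_one]
      simp only [add_sub_cancel_right, h1, h2]
      ring
    · simp only [coframe, f1, f2, Fin.reduceFinMk, add_sub_cancel_right, Matrix.cons_val, hx]
      ring
    · simp only [coframe, f1, f2, Fin.reduceFinMk, add_sub_cancel_right, Matrix.cons_val, hq']
      change -T * _ = _
      field_simp
      ring
    · simp only [coframe, f1, f2, Fin.reduceFinMk, add_sub_cancel_right, Matrix.cons_val, hw']
      rw [mul_div_cancel_left₀ _ hw]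
      ring
    · simp only [coframe, f1, f2, Fin.reduceFinMk, add_sub_cancel_right, Matrix.cons_val, hv]
      rw [mul_div_cancel_left₀ _ hw]
      ring

/-- The first order equations for an infinitesimal symmetry. -/
theorem structure_equations {k : ℝ} (hk0 : k ≠ 0) (hk1 : k - 1 ≠ 0) {n : E7} (hq : 0 < n 3)
    (hw : n 6 ≠ 0) {X : E7 → E7} (hX : SymmetryEquationsAt k X n) {N V W : E7}
    (hN : lam k n N = 0) (hV : lam k n V = 0) (hW : lam k n W = 0)
    (hN' : ∀ i, coframe k i n N = (Pi.single 1 1 : Fin 6 → ℝ) i)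
    (hV' : ∀ i, coframe k i n V = (Pi.single 4 1 : Fin 6 → ℝ) i)
    (hW' : ∀ i, coframe k i n W = (Pi.single 5 1 : Fin 6 → ℝ) i) :
    lieDerivative X (coframe k 0) n V = 0 ∧ lieDerivative X (coframe k 0) n W = 0 ∧
    lieDerivative X (coframe k 1) n V = 0 ∧ lieDerivative X (coframe k 1) n W = 0 ∧
    lieDerivative X (coframe k 2) n W = 0 ∧ lieDerivative X (coframe k 3) n V = 0 ∧
    lieDerivative X (coframe k 2) n V = lieDerivative X (coframe k 3) n W ∧
    lieDerivative X (coframe k 4) n N = 0 := by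
  obtain ⟨g', m', -, hgm⟩ := lieDerivative_upsilonContact (k := k) hq hw X
  obtain ⟨hlam, f, τ, hτ⟩ := hX
  have hT : fibT k n ≠ 0 := div_ne_zero (Real.rpow_pos_of_pos hq _).ne' hw
  set g := (n 3 ^ (k - 2)) ^ (8 / 3 : ℝ) / (243 * n 6 ^ 6) with hg
  have hg0 : g ≠ 0 := div_ne_zero
    (Real.rpow_pos_of_pos (Real.rpow_pos_of_pos hq _) _).ne'
    (mul_ne_zero (by norm_num) (pow_ne_zero _ hw))
  -- On ker λ the term with τ disappears. The derivative of the conformal factor only shifts the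
  -- multiplier f.
  have key : ∀ ξ, lam k n ξ = 0 → minorQuarticDeriv (1 / fibT k n) m' (fun i => coframe k i n ξ)
      (fun i => lieDerivative X (coframe k i) n ξ) =
      (f - g' / g) * minorQuartic (1 / fibT k n) fun i => coframe k i n ξ := by
    intro ξ hξ
    have e1 := hτ ξ
    rw [hξ, zero_mul, add_zero, upsilon_of_mem_contact hk0 hk1 hq hw hξ,
      lieDerivative_congr_contact hq.ne' (differentiableAt_upsilon hk0 hk1 hq hw ξ) (hgm ξ).1
        (upsilon_eventuallyEq hk0 hk1 hq hw) hξ (lieDerivative_lam_eq_zero hlam hξ),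
      (hgm ξ).2] at e1
    field_simp
    linear_combination e1
  obtain ⟨V0, hV0, hV0'⟩ := exists_contact_vector (k := k) hq hw (Pi.single 0 1)
  obtain ⟨V2, hV2, hV2'⟩ := exists_contact_vector (k := k) hq hw (Pi.single 2 1)
  obtain ⟨V3, hV3, hV3'⟩ := exists_contact_vector (k := k) hq hw (Pi.single 3 1)
  have hlin : ∀ i, IsLinearMap ℝ (lieDerivative X (coframe k i) n) := fun i =>
    (isLinearMap_lieDerivative (isLinearMap_coframe k i) fun ξ =>
      (differentiableAt_coframe hq hw ξ i).comp (f := fun n' : E7 => (n', ξ)) n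
        (by fun_prop)).1
  have hlamlin : IsLinearMap ℝ (lam k n) := by
    constructor
    · intro a b; simp only [lam, Pi.add_apply]; ring
    · intro a b; simp only [lam, Pi.smul_apply, smul_eq_mul]; ring
  have hcomb : ∀ {F : E7 → ℝ}, IsLinearMap ℝ F → ∀ t : Fin 6 → ℝ,
      F (t 0 • V0 + t 1 • N + t 2 • V2 + t 3 • V3 + t 4 • V + t 5 • W) =
        t 0 * F V0 + t 1 * F N + t 2 * F V2 + t 3 * F V3 + t 4 * F V + t 5 * F W := by
    intro F hF t
    simp only [hF.map_add, hF.map_smul, smul_eq_mul]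
  -- Column j of the matrix D consists of the values of the Lie derivatives of the coframe on the
  -- j-th vector of the dual basis of ker λ. The vectors V0, V2, V3 only complete N, V, W to a
  -- basis.
  have := stabilizer_equations (m := 1 / fibT k n) (m' := m') (f := f - g' / g)
    (one_div_ne_zero hT)
    (fun i j => lieDerivative X (coframe k i) n (![V0, N, V2, V3, V, W] j)) (by
    intro t
    have h1 := key (t 0 • V0 + t 1 • N + t 2 • V2 + t 3 • V3 + t 4 • V + t 5 • W) (by
      rw [hcomb hlamlin, hV0, hN, hV2, hV3, hV, hW]; ring)
    have h2 : (fun i => coframe k i n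
        (t 0 • V0 + t 1 • N + t 2 • V2 + t 3 • V3 + t 4 • V + t 5 • W)) = t := by
      funext i
      rw [hcomb (isLinearMap_coframe k i n), hV0', hN', hV2', hV3', hV', hW']
      fin_cases i <;> simp
    rw [h2] at h1
    rw [← h1]
    congr 1
    funext i
    rw [hcomb (hlin i), Fin.sum_univ_six]
    simp only [Matrix.cons_val]
    ring)
  simpa only [Matrix.cons_val] using this


/-! ### The components of an infinitesimal symmetry modulo the distribution -/

/-- The function `η₁(X)`. -/
def compB (X : E7 → E7) (n : E7) : ℝ := X n 1 - n 2 * X n 0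

/-- The function `η₂(X)`. -/
def compC (X : E7 → E7) (n : E7) : ℝ := X n 2 - n 3 * X n 0

/-- The function `η₃(X)`. -/
def compA (k : ℝ) (X : E7 → E7) (n : E7) : ℝ :=
  X n 4 - n 3 ^ (k - 1) / (k - 1) * X n 2 + n 3 ^ k / k * X n 0

theorem fderiv_component {X : E7 → E7} {n : E7} (hX : DifferentiableAt ℝ X n) (ξ : E7) (i : Fin 7) :
    fderiv ℝ X n ξ i = fderiv ℝ (fun n => X n i) n ξ := by
  have := (hasFDerivAt_pi'.1 hX.hasFDerivAt i).fderiv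
  rw [this]
  rfl

theorem fderiv_mul_apply {f g : E7 → ℝ} {n : E7} (hf : DifferentiableAt ℝ f n)
    (hg : DifferentiableAt ℝ g n) (ξ : E7) :
    fderiv ℝ (fun n => f n * g n) n ξ = f n * fderiv ℝ g n ξ + g n * fderiv ℝ f n ξ := by
  simp [fderiv_fun_mul hf hg]

theorem fderiv_add_apply {f g : E7 → ℝ} {n : E7} (hf : DifferentiableAt ℝ f n)
    (hg : DifferentiableAt ℝ g n) (ξ : E7) :
    fderiv ℝ (fun n => f n + g n) n ξ = fderiv ℝ f n ξ + fderiv ℝ g n ξ := by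
  simp [fderiv_fun_add hf hg]

theorem fderiv_sub_apply {f g : E7 → ℝ} {n : E7} (hf : DifferentiableAt ℝ f n)
    (hg : DifferentiableAt ℝ g n) (ξ : E7) :
    fderiv ℝ (fun n => f n - g n) n ξ = fderiv ℝ f n ξ - fderiv ℝ g n ξ := by
  simp [fderiv_fun_sub hf hg]

theorem fderiv_coord (j : Fin 7) (n ξ : E7) : fderiv ℝ (fun n : E7 => n j) n ξ = ξ j := by
  have : HasFDerivAt (fun n : E7 => n j)
    (ContinuousLinearMap.proj (R := ℝ) (φ := fun _ : Fin 7 => ℝ) j) n := hasFDerivAt_apply j n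
  rw [this.fderiv]
  rfl

theorem fderiv_comp_coord {φ : ℝ → ℝ} {d : ℝ} {j : Fin 7} {n : E7} (h : HasDerivAt φ d (n j))
    (ξ : E7) : fderiv ℝ (fun n : E7 => φ (n j)) n ξ = d * ξ j := by
  have h1 : HasFDerivAt (fun n : E7 => n j)
    (ContinuousLinearMap.proj (R := ℝ) (φ := fun _ : Fin 7 => ℝ) j) n := hasFDerivAt_apply j n
  have h2 : HasFDerivAt (fun n : E7 => φ (n j)) _ n := h.comp_hasFDerivAt n h1
  rw [h2.fderiv]
  simp

theorem differentiableAt_comp_coord {φ : ℝ → ℝ} {d : ℝ} {j : Fin 7} {n : E7}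
    (h : HasDerivAt φ d (n j)) : DifferentiableAt ℝ (fun n : E7 => φ (n j)) n :=
  DifferentiableAt.comp (g := φ) (f := fun n : E7 => n j) n h.differentiableAt
    (differentiableAt_coord j n)

section Components

variable {k : ℝ} {X : E7 → E7} {n : E7}

theorem eta1_fderiv (hX : DifferentiableAt ℝ X n) (ξ : E7) :
    eta1 n (fderiv ℝ X n ξ) = fderiv ℝ (compB X) n ξ + ξ 2 * X n 0 := by
  have hc : ∀ i, DifferentiableAt ℝ (fun n => X n i) n := fun i =>
    differentiableAt_pi.1 hX i
  have : compB X = fun n => X n 1 - n 2 * X n 0 := rfl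
  rw [eta1, fderiv_component hX, fderiv_component hX, this, fderiv_sub_apply (hc 1)
    ((differentiableAt_coord 2 n).fun_mul (hc 0)),
    fderiv_mul_apply (differentiableAt_coord 2 n) (hc 0), fderiv_coord]
  ring

theorem eta2_fderiv (hX : DifferentiableAt ℝ X n) (ξ : E7) :
    eta2 n (fderiv ℝ X n ξ) = fderiv ℝ (compC X) n ξ + ξ 3 * X n 0 := by
  have hc : ∀ i, DifferentiableAt ℝ (fun n => X n i) n := fun i =>
    differentiableAt_pi.1 hX i
  have : compC X = fun n => X n 2 - n 3 * X n 0 := rfl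
  rw [eta2, fderiv_component hX, fderiv_component hX, this, fderiv_sub_apply (hc 2)
    ((differentiableAt_coord 3 n).fun_mul (hc 0)),
    fderiv_mul_apply (differentiableAt_coord 3 n) (hc 0), fderiv_coord]
  ring

theorem fderiv_compA (hk0 : k ≠ 0) (hk1 : k - 1 ≠ 0) (hq : 0 < n 3) (hX : DifferentiableAt ℝ X n)
    (ξ : E7) : fderiv ℝ (compA k X) n ξ = fderiv ℝ X n ξ 4
      - (n 3 ^ (k - 1) / (k - 1) * fderiv ℝ X n ξ 2 + X n 2 * (n 3 ^ (k - 2) * ξ 3))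
      + (n 3 ^ k / k * fderiv ℝ X n ξ 0 + X n 0 * (n 3 ^ (k - 1) * ξ 3)) := by
  have hc : ∀ i, DifferentiableAt ℝ (fun n => X n i) n := fun i =>
    differentiableAt_pi.1 hX i
  obtain ⟨h1, h2, -⟩ := hasDerivAt_powers hk0 hk1 hq
  have d1 := differentiableAt_comp_coord (j := 3) h1
  have d2 := differentiableAt_comp_coord (j := 3) h2
  have e : compA k X = fun n => X n 4 - n 3 ^ (k - 1) / (k - 1) * X n 2 + n 3 ^ k / k * X n 0 := rfl
  rw [e, fderiv_add_apply ((hc 4).fun_sub (d1.fun_mul (hc 2))) (d2.fun_mul (hc 0)),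
    fderiv_sub_apply (hc 4) (d1.fun_mul (hc 2)), fderiv_mul_apply d1 (hc 2),
    fderiv_mul_apply d2 (hc 0), fderiv_comp_coord h1, fderiv_comp_coord h2,
    fderiv_component hX, fderiv_component hX, fderiv_component hX]

theorem lam_fderiv (hk0 : k ≠ 0) (hk1 : k - 1 ≠ 0) (hq : 0 < n 3) (hX : DifferentiableAt ℝ X n)
    (ξ : E7) : lam k n (fderiv ℝ X n ξ) = fderiv ℝ (compA k X) n ξ
      + n 5 * fderiv ℝ (compB X) n ξ - n 6 * fderiv ℝ (compC X) n ξ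
      + n 3 ^ (k - 2) * ξ 3 * compC X n + n 5 * ξ 2 * X n 0 - n 6 * ξ 3 * X n 0 := by
  have e1 := eta1_fderiv hX ξ
  have e2 := eta2_fderiv hX ξ
  rw [fderiv_compA hk0 hk1 hq hX]
  obtain ⟨-, b1, -, -, -⟩ := rpow_sub_natCast_forms (k := k) hq
  rw [b1]
  simp only [eta1, eta2] at e1 e2
  simp only [lam, compC]
  rw [b1]
  linear_combination n 5 * e1 - n 6 * e2

theorem isLinearMap_lam (k : ℝ) (n : E7) : IsLinearMap ℝ (lam k n) := by
  constructor
  · intro a b; simp only [lam, Pi.add_apply]; ring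
  · intro a b; simp only [lam, Pi.smul_apply, smul_eq_mul]; ring

theorem lieDerivative_lam (hk0 : k ≠ 0) (hk1 : k - 1 ≠ 0) (hq : 0 < n 3) (ξ : E7) :
    lieDerivative X (lam k) n ξ = -(X n 6 + n 3 ^ (k - 2) * X n 3) * ξ 2 + X n 5 * ξ 1
      + (X n 6 * n 3 + n 6 * X n 3 - X n 5 * n 2 - n 5 * X n 2 + n 3 ^ (k - 1) * X n 3) * ξ 0
      + lam k n (fderiv ℝ X n ξ) := by
  obtain ⟨h1, h2, -⟩ := hasDerivAt_powers hk0 hk1 hq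
  have d1 := differentiableAt_comp_coord (j := 3) h1
  have d2 := differentiableAt_comp_coord (j := 3) h2
  rw [(isLinearMap_lieDerivative (isLinearMap_lam k) fun ξ =>
      (differentiableAt_lam hq.ne' ξ).comp (f := fun n' : E7 => (n', ξ)) n (by fun_prop)).2]
  congr 1
  have D : ∀ j, DifferentiableAt ℝ (fun n : E7 => n j) n := fun j => differentiableAt_coord j n
  have e : (fun n' => lam k n' ξ) = fun n => ξ 4 - (n 6 + n 3 ^ (k - 1) / (k - 1)) * ξ 2
    + n 5 * ξ 1 + (n 6 * n 3 - n 5 * n 2 + n 3 ^ k / k) * ξ 0 := rfl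
  have c : ∀ x : ℝ, DifferentiableAt ℝ (fun _ : E7 => x) n := fun x => differentiableAt_const x
  have m1 : DifferentiableAt ℝ (fun n : E7 => n 6 + n 3 ^ (k - 1) / (k - 1)) n := (D 6).add d1
  have m2 : DifferentiableAt ℝ (fun n : E7 => n 6 * n 3 - n 5 * n 2) n :=
    ((D 6).mul (D 3)).sub ((D 5).mul (D 2))
  have m3 : DifferentiableAt ℝ (fun n : E7 => n 6 * n 3 - n 5 * n 2 + n 3 ^ k / k) n := m2.add d2
  rw [e, fderiv_add_apply (((c _).fun_sub (m1.fun_mul (c _))).fun_add ((D 5).fun_mul (c _)))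
    (m3.fun_mul (c _)),
    fderiv_add_apply ((c _).fun_sub (m1.fun_mul (c _))) ((D 5).fun_mul (c _)),
    fderiv_sub_apply (c _) (m1.fun_mul (c _)), fderiv_mul_apply m1 (c _),
    fderiv_mul_apply (D 5) (c _),
    fderiv_mul_apply m3 (c _), fderiv_add_apply (D 6) d1, fderiv_add_apply m2 d2,
    fderiv_sub_apply ((D 6).fun_mul (D 3)) ((D 5).fun_mul (D 2)), fderiv_mul_apply (D 6) (D 3),
    fderiv_mul_apply (D 5) (D 2), fderiv_comp_coord h1, fderiv_comp_coord h2]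
  simp only [fderiv_coord, fderiv_fun_const, Pi.zero_apply, zero_apply]
  ring

theorem lieDerivative_coframe (hq : 0 < n 3) (hw : n 6 ≠ 0) (i : Fin 6) (ξ : E7) :
    lieDerivative X (coframe k i) n ξ =
      fderiv ℝ (fun n' => coframe k i n' ξ) n (X n) + coframe k i n (fderiv ℝ X n ξ) :=
  (isLinearMap_lieDerivative (isLinearMap_coframe k i) fun ξ =>
    (differentiableAt_coframe hq hw ξ i).comp (f := fun n' : E7 => (n', ξ)) n (by fun_prop)).2 ξ

end Components

/-- The vector of the contact distribution dual to the second form of the coframe. -/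
def dualVector (k : ℝ) (n : E7) : E7 :=
  let s := fibS n; let t := fibT k n; let E := coefE k n; let Z := coefZ k n; let q := n 3
  let c := 2 * t / 3 + (k - 2) / (3 * q) - E;
  ![c, n 2 * c, 1 + q * c, s, q ^ k / (k * (k - 1)) * c + q ^ (k - 1) / (k - 1) + n 6,
    n 6 * (s ^ 2 * (Z + t / 18)), n 6 * (s * (Z + (k - 2) / (3 * q) - t / 9))]

theorem lam_dualVector {k : ℝ} (hk0 : k ≠ 0) (hk1 : k - 1 ≠ 0) {n : E7} (hq : 0 < n 3) :
    lam k n (dualVector k n) = 0 := by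
  obtain ⟨b0, b1, -, -, -⟩ := rpow_sub_natCast_forms (k := k) hq
  simp only [lam, dualVector, Matrix.cons_val]
  rw [b0, b1]
  field_simp
  ring

theorem coframe_dualVector {k : ℝ} {n : E7} (hw : n 6 ≠ 0) (i : Fin 6) :
    coframe k i n (dualVector k n) = (Pi.single 1 1 : Fin 6 → ℝ) i := by
  have e1 : eta1 n (dualVector k n) = 0 := by simp [eta1, dualVector]
  have e2 : eta2 n (dualVector k n) = 1 := by simp [eta2, dualVector]
  fin_cases i <;> simp only [coframe, e1, e2] <;>
    simp only [dualVector, Matrix.cons_val, Fin.zero_eta, Fin.mk_one, Fin.reduceFinMk] <;>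
    (try rw [mul_div_cancel_left₀ _ hw]) <;> (try rw [mul_div_cancel_left₀ _ hw]) <;> simp <;> ring

theorem lam_vertical (k : ℝ) (n : E7) (a b : ℝ) : lam k n ![0, 0, 0, 0, 0, a, b] = 0 := by
  simp [lam]

theorem coframe_vertical (k : ℝ) (n : E7) (a b : ℝ) :
    coframe k 0 n ![0, 0, 0, 0, 0, a, b] = 0 ∧ coframe k 1 n ![0, 0, 0, 0, 0, a, b] = 0 ∧
    coframe k 2 n ![0, 0, 0, 0, 0, a, b] = 0 ∧ coframe k 3 n ![0, 0, 0, 0, 0, a, b] = 0 ∧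
    coframe k 4 n ![0, 0, 0, 0, 0, a, b] = b / n 6 ∧
    coframe k 5 n ![0, 0, 0, 0, 0, a, b] = a / n 6 - n 5 / n 6 * (b / n 6) := by
  have e1 : eta1 n ![0, 0, 0, 0, 0, a, b] = 0 := by simp [eta1]
  have e2 : eta2 n ![0, 0, 0, 0, 0, a, b] = 0 := by simp [eta2]
  simp only [coframe, e1, e2, fibS]
  simp

/-- Vector fields on an open set which satisfy the symmetry equations. -/
structure IsSymmetryOn (k : ℝ) (B : Set E7) (X : E7 → E7) : Prop where
  smooth : ∀ n ∈ B, ContDiffAt ℝ ∞ X n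
  equations : ∀ n ∈ B, SymmetryEquationsAt k X n

theorem IsSymmetryOn.differentiableAt {k : ℝ} {B : Set E7} {X : E7 → E7}
    (hX : IsSymmetryOn k B X) {n : E7} (hn : n ∈ B) : DifferentiableAt ℝ X n :=
  (hX.smooth n hn).differentiableAt (by simp)

theorem IsSymmetryOn.comp {k : ℝ} {B : Set E7} {X : E7 → E7}
    (hX : IsSymmetryOn k B X) (i : Fin 7) : SmoothOn B fun n => X n i := fun n hn =>
  contDiffAt_pi.1 (hX.smooth n hn) i

theorem IsSymmetryOn.smooth_compB {k : ℝ} {B : Set E7} {X : E7 → E7} (hX : IsSymmetryOn k B X) :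
    SmoothOn B (compB X) := (hX.comp 1).sub ((SmoothOn.coord 2).mul (hX.comp 0))

theorem IsSymmetryOn.smooth_compC {k : ℝ} {B : Set E7} {X : E7 → E7} (hX : IsSymmetryOn k B X) :
    SmoothOn B (compC X) := (hX.comp 2).sub ((SmoothOn.coord 3).mul (hX.comp 0))

theorem IsSymmetryOn.smooth_compA {k : ℝ} {B : Set E7} {X : E7 → E7} (hX : IsSymmetryOn k B X)
    (hq : ∀ n ∈ B, 0 < n 3) : SmoothOn B (compA k X) :=
  ((hX.comp 4).sub ((SmoothOn.comp_coord (φ := fun q => q ^ (k - 1) / (k - 1)) 3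
    fun n hn => (contDiffAt_powers (hq n hn)).1).mul (hX.comp 2))).add
    ((SmoothOn.comp_coord (φ := fun q => q ^ k / k) 3
      fun n hn => (contDiffAt_powers (hq n hn)).2.1).mul (hX.comp 0))

/-- The part of the symmetry equations which involves the fibre derivatives. -/
theorem vertical_equations {k : ℝ} (hk0 : k ≠ 0) (hk1 : k - 1 ≠ 0) {B : Set E7} {X : E7 → E7}
    (hX : IsSymmetryOn k B X) {n : E7} (hn : n ∈ B) (hq : 0 < n 3) (hw : n 6 ≠ 0) :
    (pd 5 (compA k X) n = 0 ∧ pd 6 (compA k X) n = 0) ∧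
    (pd 5 (compB X) n = 0 ∧ pd 6 (compB X) n = 0) ∧
    (pd 5 (compC X) n = 0 ∧ pd 6 (compC X) n = 0) ∧
    pd 5 (fun n => X n 0) n = 0 ∧
    n 5 * pd 5 (fun n => X n 3) n + n 6 * pd 6 (fun n => X n 3) n = 0 ∧
    n 6 * pd 6 (fun n => X n 0) n = -(n 3 ^ (k - 2) * pd 5 (fun n => X n 3) n) ∧
    lieDerivative X (coframe k 4) n (dualVector k n) = 0 := by
  have hd := hX.differentiableAt hn
  -- In the basis dual to the coframe, v∂_v + w∂_w is dual to the fifth form and w∂_v to the sixth.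
  obtain ⟨h1, h2, h3, h4, h5, h6, h7, h8⟩ := structure_equations hk0 hk1 hq hw (hX.equations n hn)
    (N := dualVector k n) (V := ![0, 0, 0, 0, 0, n 5, n 6]) (W := ![0, 0, 0, 0, 0, n 6, 0])
    (lam_dualVector hk0 hk1 hq) (lam_vertical k n _ _) (lam_vertical k n _ _)
    (coframe_dualVector hw)
    (by
      intro i
      obtain ⟨e0, e1, e2, e3, e4, e5⟩ := coframe_vertical k n (n 5) (n 6)
      fin_cases i
      · simpa using e0
      · simpa using e1
      · simpa using e2
      · simpa using e3
      · simpa [hw] using e4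
      · simpa [hw] using e5)
    (by
      intro i
      obtain ⟨e0, e1, e2, e3, e4, e5⟩ := coframe_vertical k n (n 6) 0
      fin_cases i
      · simpa using e0
      · simpa using e1
      · simpa using e2
      · simpa using e3
      · simpa [hw] using e4
      · simpa [hw] using e5)
  -- The first four forms vanish identically on vertical vectors, so their Lie derivatives there
  -- reduce to the forms applied to DX.
  have z : ∀ a b, (fun n' => coframe k 0 n' ![0, 0, 0, 0, 0, a, b]) = (fun _ => 0) ∧
      (fun n' => coframe k 1 n' ![0, 0, 0, 0, 0, a, b]) = (fun _ => 0) ∧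
      (fun n' => coframe k 2 n' ![0, 0, 0, 0, 0, a, b]) = (fun _ => 0) ∧
      (fun n' => coframe k 3 n' ![0, 0, 0, 0, 0, a, b]) = (fun _ => 0) := fun a b =>
    ⟨funext fun n' => (coframe_vertical k n' a b).1,
      funext fun n' => (coframe_vertical k n' a b).2.1,
      funext fun n' => (coframe_vertical k n' a b).2.2.1,
      funext fun n' => (coframe_vertical k n' a b).2.2.2.1⟩
  rw [lieDerivative_coframe hq hw, (z _ _).1, fderiv_fun_const, Pi.zero_apply, zero_apply,
    zero_add] at h1 h2
  rw [lieDerivative_coframe hq hw, (z _ _).2.1, fderiv_fun_const, Pi.zero_apply, zero_apply,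
    zero_add] at h3 h4
  rw [lieDerivative_coframe hq hw, (z _ _).2.2.1, fderiv_fun_const, Pi.zero_apply, zero_apply,
    zero_add] at h5 h7
  rw [lieDerivative_coframe hq hw, (z _ _).2.2.2, fderiv_fun_const, Pi.zero_apply, zero_apply,
    zero_add] at h6 h7
  have hT : fibT k n ≠ 0 := div_ne_zero (Real.rpow_pos_of_pos hq _).ne' hw
  simp only [coframe] at h1 h2 h3 h4 h5 h6 h7
  have g1 := h1
  have g2 := h2
  rw [eta1_fderiv hd] at g1 g2
  rw [h1, mul_zero, sub_zero] at h3
  rw [h2, mul_zero, sub_zero] at h4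
  have g3 := h3
  have g4 := h4
  rw [eta2_fderiv hd] at g3 g4
  rw [h2, h4] at h5 h7
  rw [h1, h3] at h6 h7
  have b5 : pd 5 (compB X) n = 0 := by
    rw [fderiv_eq_pd] at g2
    simpa [hw] using g2
  have b6 : pd 6 (compB X) n = 0 := by
    rw [fderiv_eq_pd] at g1
    simpa [hw, b5] using g1
  have c5 : pd 5 (compC X) n = 0 := by
    rw [fderiv_eq_pd] at g4
    simpa [hw] using g4
  have c6 : pd 6 (compC X) n = 0 := by
    rw [fderiv_eq_pd] at g3
    simpa [hw, c5] using g3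
  -- On vertical vectors the contact condition involves only fibre derivatives of a, b, c. Those of
  -- b and c are already zero.
  have a56 : ∀ a b, a * pd 5 (compA k X) n + b * pd 6 (compA k X) n = 0 := by
    intro a b
    have := lieDerivative_lam_eq_zero (hX.equations n hn).1 (lam_vertical k n a b)
    rw [lieDerivative_lam hk0 hk1 hq, lam_fderiv hk0 hk1 hq hd, fderiv_eq_pd, fderiv_eq_pd,
      fderiv_eq_pd] at this
    simpa [b5, b6, c5, c6] using this
  have x5 : pd 5 (fun n => X n 0) n = 0 := by
    rw [fderiv_component hd, fderiv_eq_pd] at h5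
    simpa [hw] using h5
  refine ⟨⟨by simpa using a56 1 0, by simpa using a56 0 1⟩, ⟨b5, b6⟩, ⟨c5, c6⟩, x5, ?_, ?_, h8⟩
  · rw [fderiv_component hd, fderiv_eq_pd] at h6
    simpa [hT] using h6
  · rw [fderiv_component hd, fderiv_eq_pd, fderiv_component hd, fderiv_eq_pd] at h7
    simp [x5, fibT] at h7
    rw [h7]
    field_simp

/-- The equation `(L_X λ) ∧ λ = 0` in components. -/
theorem contact_equations {k : ℝ} (hk0 : k ≠ 0) (hk1 : k - 1 ≠ 0) {B : Set E7} {X : E7 → E7}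
    (hX : IsSymmetryOn k B X) {n : E7} (hn : n ∈ B) (hq : 0 < n 3) :
    (pd 3 (compA k X) n + n 5 * pd 3 (compB X) n - n 6 * pd 3 (compC X) n
      + n 3 ^ (k - 2) * compC X n - n 6 * X n 0 = 0) ∧
    ((pdT (compA k X) n + n 3 * pd 2 (compA k X) n
        + n 3 ^ k / (k * (k - 1)) * pd 4 (compA k X) n)
      + n 5 * (pdT (compB X) n + n 3 * pd 2 (compB X) n
        + n 3 ^ k / (k * (k - 1)) * pd 4 (compB X) n)
      - n 6 * (pdT (compC X) n + n 3 * pd 2 (compC X) n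
        + n 3 ^ k / (k * (k - 1)) * pd 4 (compC X) n)
      + n 6 * X n 3 - n 5 * compC X n = 0) ∧
    ((pd 1 (compA k X) n - n 5 * pd 4 (compA k X) n)
      + n 5 * (pd 1 (compB X) n - n 5 * pd 4 (compB X) n)
      - n 6 * (pd 1 (compC X) n - n 5 * pd 4 (compC X) n) + X n 5 = 0) ∧
    ((pd 2 (compA k X) n + (n 3 ^ (k - 1) / (k - 1) + n 6) * pd 4 (compA k X) n)
      + n 5 * (pd 2 (compB X) n + (n 3 ^ (k - 1) / (k - 1) + n 6) * pd 4 (compB X) n)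
      - n 6 * (pd 2 (compC X) n + (n 3 ^ (k - 1) / (k - 1) + n 6) * pd 4 (compC X) n)
      - X n 6 - n 3 ^ (k - 2) * X n 3 + n 5 * X n 0 = 0) := by
  have hd := hX.differentiableAt hn
  obtain ⟨b0, b1, -, -, -⟩ := rpow_sub_natCast_forms (k := k) hq
  -- L_Xλ is evaluated on ∂_q, ξ₁, ∂_y − v∂_z and ∂_p + (h' + w)∂_z, which together with the
  -- vertical vectors span ker λ.
  have L : ∀ ξ, lam k n ξ = 0 → _ := fun ξ hξ => by
    have := lieDerivative_lam_eq_zero (hX.equations n hn).1 hξ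
    rw [lieDerivative_lam hk0 hk1 hq, lam_fderiv hk0 hk1 hq hd, fderiv_eq_pd, fderiv_eq_pd,
      fderiv_eq_pd] at this
    exact this
  refine ⟨?_, ?_, ?_, ?_⟩
  · have := L ![0, 0, 0, 1, 0, 0, 0] (by simp [lam])
    simp only [Matrix.cons_val] at this
    linear_combination this
  · have := L ![1, n 2, n 3, 0, n 3 ^ k / (k * (k - 1)), 0, 0] (by
      simp only [lam, Matrix.cons_val]
      rw [b0, b1]
      field_simp
      ring)
    simp only [Matrix.cons_val] at this
    rw [b1] at this
    simp only [pdT]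
    have e : compC X n = X n 2 - n 3 * X n 0 := rfl
    rw [e] at this ⊢
    linear_combination this
  · have := L ![0, 1, 0, 0, -n 5, 0, 0] (by simp [lam])
    simp only [Matrix.cons_val] at this
    linear_combination this
  · have := L ![0, 0, 1, 0, n 3 ^ (k - 1) / (k - 1) + n 6, 0, 0] (by simp [lam]; ring)
    simp only [Matrix.cons_val] at this
    linear_combination this


/-! ### The reduced equations -/

/-- The derivative of a function along `∂_x + p ∂_y + q ∂_p + h ∂_z`. -/
def pdXi (k : ℝ) (g : E7 → ℝ) (n : E7) : ℝ :=
  pdT g n + n 3 * pd 2 g n + n 3 ^ k / (k * (k - 1)) * pd 4 g n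

theorem smoothOn_rpow {B : Set E7} (hq : ∀ n ∈ B, 0 < n 3) (e : ℝ) :
    SmoothOn B fun n => n 3 ^ e :=
  SmoothOn.comp_coord (φ := fun q => q ^ e) 3 fun n hn =>
    Real.contDiffAt_rpow_const_of_ne (hq n hn).ne'

theorem SmoothOn.pdXi {k : ℝ} {B : Set E7} (hq : ∀ n ∈ B, 0 < n 3) {g : E7 → ℝ}
    (h : SmoothOn B g) : SmoothOn B (pdXi k g) :=
  (h.pdT.add ((SmoothOn.coord 3).mul (h.pd 2))).add
    ((SmoothOn.comp_coord (φ := fun q => q ^ k / (k * (k - 1))) 3 fun n hn =>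
      (Real.contDiffAt_rpow_const_of_ne (hq n hn).ne').div_const _).mul (h.pd 4))

/-- Every coordinate field except ∂_p and ∂_q either commutes with ξ₁ or has no effect on its
coefficients. -/
theorem pd_pdXi_eq_zero {k : ℝ} {B : Set E7} (hB : IsOpen B) (hq : ∀ n ∈ B, 0 < n 3)
    {g : E7 → ℝ} (hg : SmoothOn B g) {i : Fin 7} (hi : i ≠ 2) (hi' : i ≠ 3)
    (h : ∀ n ∈ B, pd i g n = 0) {n : E7} (hn : n ∈ B) : pd i (pdXi k g) n = 0 := by
  have e : pdXi k g = fun n => pdT g n + n 3 * pd 2 g n +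
    (fun q => q ^ k / (k * (k - 1))) (n 3) * pd 4 g n := rfl
  have d1 := hg.pdT.differentiableAt hn
  have d2 := (hg.pd 2).differentiableAt hn
  have d4 := (hg.pd 4).differentiableAt hn
  have dq := differentiableAt_coord 3 n
  have hφ : HasDerivAt (fun q : ℝ => q ^ k / (k * (k - 1))) _ (n 3) :=
    (Real.hasDerivAt_rpow_const (p := k) (Or.inl (hq n hn).ne')).div_const (k * (k - 1))
  have dφ := differentiableAt_comp_coord (j := 3) hφ
  rw [e, pd_add (d1.fun_add (dq.fun_mul d2)) (dφ.fun_mul d4), pd_add d1 (dq.fun_mul d2),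
    pd_mul dq d2, pd_mul dφ d4, pd_coord, pd_comp hφ, pd_pdT_eq_zero hB hg hi h hn,
    pd_pd_eq_zero hB hg h 2 hn, pd_pd_eq_zero hB hg h 4 hn, if_neg hi'.symm, if_neg hi'.symm]
  ring

/-- A symmetry is determined by `η₁(X)`, `η₂(X)`, `η₃(X)`, which satisfy the equations below. -/
theorem reduced_equations {k : ℝ} (hk0 : k ≠ 0) (hk1 : k - 1 ≠ 0) {B : Set E7} (hB : IsOpen B)
    (hq : ∀ n ∈ B, 0 < n 3) (hw : ∀ n ∈ B, n 6 ≠ 0) {X : E7 → E7} (hX : IsSymmetryOn k B X)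
    {n : E7} (hn : n ∈ B) :
    pd 3 (compB X) n = 0 ∧ pdXi k (compA k X) n = 0 ∧
    pd 3 (compA k X) n = -(n 3 ^ (k - 2) * pdXi k (compB X) n) ∧
    X n 0 = -pd 3 (compC X) n + fibT k n * (compC X n - pdXi k (compB X) n) ∧
    X n 3 = pdXi k (compC X) n + fibS n * (compC X n - pdXi k (compB X) n) := by
  have V := fun n hn => vertical_equations hk0 hk1 hX (n := n) hn (hq n hn) (hw n hn)
  have C := fun n hn => contact_equations hk0 hk1 hX (n := n) hn (hq n hn)
  have sa := hX.smooth_compA hq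
  have sb := hX.smooth_compB
  have sc := hX.smooth_compC
  have a5 := fun n hn => (V n hn).1.1
  have a6 := fun n hn => (V n hn).1.2
  have b5 := fun n hn => (V n hn).2.1.1
  have b6 := fun n hn => (V n hn).2.1.2
  have c5 := fun n hn => (V n hn).2.2.1.1
  have c6 := fun n hn => (V n hn).2.2.1.2
  obtain ⟨-, -, -, x5, x3, x6, -⟩ := V n hn
  have E2 := fun n hn => (C n hn).1
  have E1 : ∀ n ∈ B, pdXi k (compA k X) n + n 5 * pdXi k (compB X) n - n 6 * pdXi k (compC X) n
      + n 6 * X n 3 - n 5 * compC X n = 0 := fun n hn => (C n hn).2.1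
  have D := differentiableAt_coord (n := n)
  have d5 := D 5
  have d6 := D 6
  have dA := (sa.pd 3).differentiableAt hn
  have dB := (sb.pd 3).differentiableAt hn
  have dC := (sc.pd 3).differentiableAt hn
  have dc := sc.differentiableAt hn
  have du := (smoothOn_rpow hq (k - 2)).differentiableAt hn
  have dX0 := (hX.comp 0).differentiableAt hn
  have dX3 := (hX.comp 3).differentiableAt hn
  have dA' := (sa.pdXi (k := k) hq).differentiableAt hn
  have dB' := (sb.pdXi (k := k) hq).differentiableAt hn
  have dC' := (sc.pdXi (k := k) hq).differentiableAt hn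
  have hφ : HasDerivAt (fun q : ℝ => q ^ (k - 2)) _ (n 3) :=
    Real.hasDerivAt_rpow_const (p := k - 2) (Or.inl (hq n hn).ne')
  -- The contact equations along ∂_q and ξ₁ are differentiated in v and in w. Since a, b, c are
  -- constant along the fibres, these variables occur only explicitly and through X n 0, X n 3.
  have P2 : ∀ i, pd i (compC X) n = 0 → i ≠ 3 → _ := fun i hc hi => by
    have h := pd_eq_zero_of_const hB E2 i hn
    rw [pd_sub ((((dA.fun_add (d5.fun_mul dB)).fun_sub (d6.fun_mul dC)).fun_add
        (du.fun_mul dc))) (d6.fun_mul dX0), pd_add ((dA.fun_add (d5.fun_mul dB)).fun_sub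
        (d6.fun_mul dC)) (du.fun_mul dc), pd_sub (dA.fun_add (d5.fun_mul dB)) (d6.fun_mul dC),
      pd_add dA (d5.fun_mul dB), pd_mul d5 dB, pd_mul d6 dC, pd_mul du dc, pd_mul d6 dX0,
      pd_coord, pd_coord, pd_comp hφ, hc, if_neg hi.symm] at h
    exact h
  have P1 : ∀ i, pd i (compC X) n = 0 → _ := fun i hc => by
    have h := pd_eq_zero_of_const hB E1 i hn
    rw [pd_sub ((((dA'.fun_add (d5.fun_mul dB')).fun_sub (d6.fun_mul dC')).fun_add
        (d6.fun_mul dX3))) (d5.fun_mul dc), pd_add ((dA'.fun_add (d5.fun_mul dB')).fun_sub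
        (d6.fun_mul dC')) (d6.fun_mul dX3), pd_sub (dA'.fun_add (d5.fun_mul dB')) (d6.fun_mul dC'),
      pd_add dA' (d5.fun_mul dB'), pd_mul d5 dB', pd_mul d6 dC', pd_mul d5 dc, pd_mul d6 dX3,
      pd_coord, pd_coord, hc] at h
    exact h
  have F5 := P2 5 (c5 n hn) (by decide)
  have F6 := P2 6 (c6 n hn) (by decide)
  have G5 := P1 5 (c5 n hn)
  have G6 := P1 6 (c6 n hn)
  rw [pd_pd_eq_zero hB sa a5 3 hn, pd_pd_eq_zero hB sb b5 3 hn, pd_pd_eq_zero hB sc c5 3 hn,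
    x5] at F5
  rw [pd_pd_eq_zero hB sa a6 3 hn, pd_pd_eq_zero hB sb b6 3 hn, pd_pd_eq_zero hB sc c6 3 hn] at F6
  rw [pd_pdXi_eq_zero hB hq sa (by decide) (by decide) a5 hn,
    pd_pdXi_eq_zero hB hq sb (by decide) (by decide) b5 hn,
    pd_pdXi_eq_zero hB hq sc (by decide) (by decide) c5 hn] at G5
  rw [pd_pdXi_eq_zero hB hq sa (by decide) (by decide) a6 hn,
    pd_pdXi_eq_zero hB hq sb (by decide) (by decide) b6 hn,
    pd_pdXi_eq_zero hB hq sc (by decide) (by decide) c6 hn] at G6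
  simp at F5 F6 G5 G6
  have hw' := hw n hn
  have e3 := E2 n hn
  have e1 := E1 n hn
  -- The differentiated equations read b_q = 0, w∂_wX⁰ = −c_q − X⁰, w∂_vX³ = c − ξ₁b and w∂_wX³ =
  -- ξ₁c − X³. The fibre derivatives of X⁰ and X³ are eliminated by the two relations `x3` and `x6`
  -- from the stabilizer.
  have X0 : n 6 * X n 0 = -n 6 * pd 3 (compC X) n
      + n 3 ^ (k - 2) * (compC X n - pdXi k (compB X) n) := by
    linear_combination (-n 6) * F6 - n 6 * x6 + n 3 ^ (k - 2) * G5
  have X3 : n 6 * X n 3 = n 6 * pdXi k (compC X) n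
      + n 5 * (compC X n - pdXi k (compB X) n) := by
    linear_combination n 6 * G6 - n 6 * x3 + n 5 * G5
  refine ⟨F5, ?_, ?_, ?_, ?_⟩
  · linear_combination e1 - X3
  · rw [F5] at e3
    linear_combination e3 + X0
  · rw [fibT]
    field_simp
    linear_combination X0
  · rw [fibS]
    field_simp
    linear_combination X3

/-! ### Linear combinations of symmetries -/

theorem IsSymmetryOn.mono {k : ℝ} {B B' : Set E7} (h : B' ⊆ B) {X : E7 → E7}
    (hX : IsSymmetryOn k B X) : IsSymmetryOn k B' X :=
  ⟨fun n hn => hX.smooth n (h hn), fun n hn => hX.equations n (h hn)⟩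

theorem IsSymmetryOn.add {k : ℝ} {B : Set E7} {X Y : E7 → E7} (hX : IsSymmetryOn k B X)
    (hY : IsSymmetryOn k B Y) : IsSymmetryOn k B (X + Y) := by
  refine ⟨fun n hn => (hX.smooth n hn).add (hY.smooth n hn), fun n hn => ?_⟩
  have dX := hX.differentiableAt hn
  have dX' := hY.differentiableAt hn
  obtain ⟨a1, f, τ, a2⟩ := hX.equations n hn
  obtain ⟨b1, f', τ', b2⟩ := hY.equations n hn
  refine ⟨fun ξ η => ?_, f + f', τ + τ', fun ξ => ?_⟩
  · rw [lieDerivative_add dX dX', lieDerivative_add dX dX']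
    linear_combination a1 ξ η + b1 ξ η
  · rw [lieDerivative_add dX dX', a2, b2, add_apply]
    ring

theorem IsSymmetryOn.smul {k : ℝ} {B : Set E7} {X : E7 → E7} (hX : IsSymmetryOn k B X) (c : ℝ) :
    IsSymmetryOn k B (c • X) := by
  refine ⟨fun n hn => (hX.smooth n hn).const_smul c, fun n hn => ?_⟩
  have dX := hX.differentiableAt hn
  obtain ⟨a1, f, τ, a2⟩ := hX.equations n hn
  refine ⟨fun ξ η => ?_, c * f, c • τ, fun ξ => ?_⟩
  · rw [lieDerivative_smul dX, lieDerivative_smul dX]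
    linear_combination c * a1 ξ η
  · rw [lieDerivative_smul dX, a2, smul_apply, smul_eq_mul]
    ring

theorem IsSymmetryOn.sub_sum {k : ℝ} {B : Set E7} {X : E7 → E7} (hX : IsSymmetryOn k B X)
    {F : Fin 7 → E7 → E7} (hF : ∀ i, IsSymmetryOn k B (F i)) (c : Fin 7 → ℝ) :
    IsSymmetryOn k B (X - ∑ i, c i • F i) := by
  have : ∀ s : Finset (Fin 7), IsSymmetryOn k B (X + ∑ i ∈ s, (-c i) • F i) := by
    intro s
    induction s using Finset.induction_on with
    | empty => simpa using hX
    | insert j s hj ih =>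
      rw [Finset.sum_insert hj, add_left_comm, add_comm]
      exact ih.add ((hF j).smul _)
  have h := this Finset.univ
  simpa [sub_eq_add_neg, Finset.sum_neg_distrib] using h


/-! ### The derivative of the coframe -/

/-- Up to constants, t, E and Z are the monomials q^(k−2)/w, w/q^k and w²/q^(2k−1). Their
derivatives below are the functions times logarithmic derivatives. -/
def fibSDeriv (n ξ : E7) : ℝ := ξ 5 / n 6 - fibS n * (ξ 6 / n 6)

def fibTDeriv (k : ℝ) (n ξ : E7) : ℝ := fibT k n * ((k - 2) * (ξ 3 / n 3) - ξ 6 / n 6)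

def coefEDeriv (k : ℝ) (n ξ : E7) : ℝ := coefE k n * (ξ 6 / n 6 - k * (ξ 3 / n 3))

def coefZDeriv (k : ℝ) (n ξ : E7) : ℝ := coefZ k n * (2 * (ξ 6 / n 6) - (2 * k - 1) * (ξ 3 / n 3))

/-- The derivative of `coframe k i · ζ` in the direction `ξ`. -/
def coframeDeriv (k : ℝ) (i : Fin 6) (n ξ ζ : E7) : ℝ :=
  let s := fibS n; let t := fibT k n; let E := coefE k n; let Z := coefZ k n;
  let ds := fibSDeriv n ξ; let dt := fibTDeriv k n ξ; let dE := coefEDeriv k n ξ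
  let dZ := coefZDeriv k n ξ; let c := (k - 2) / (3 * n 3); let dc := -c * (ξ 3 / n 3)
  let e1 := eta1 n ζ; let e2 := eta2 n ζ; let de1 := -ξ 2 * ζ 0; let de2 := -ξ 3 * ζ 0;
  match i with
  | 0 => de1
  | 1 => de2 - (ds * e1 + s * de1)
  | 2 => -((2 * dt / 3 + dc) * e2 + (2 * t / 3 + c) * de2) + ((ds * t + s * dt) / 3 * e1
      + s * t / 3 * de1) + (dE * (e2 - s * e1) + E * (de2 - (ds * e1 + s * de1)))
  | 3 => -dt * (ζ 3 - s * e2 + s ^ 2 / 3 * e1)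
      - t * (-(ds * e2 + s * de2) + (2 * s * ds / 3 * e1 + s ^ 2 / 3 * de1))
  | 4 => (2 * s * ds * (Z + t / 18) + s ^ 2 * (dZ + dt / 18)) * e1 + s ^ 2 * (Z + t / 18) * de1
      - ((ds * (Z + E + 2 * t / 9) + s * (dZ + dE + 2 * dt / 9)) * e2
        + s * (Z + E + 2 * t / 9) * de2)
      + (dE - dc + dt / 3) * ζ 3 - ζ 6 / n 6 * (ξ 6 / n 6)
  | 5 => -(3 * s ^ 2 * ds * (E / 3 + t / 18) + s ^ 3 * (dE / 3 + dt / 18)) * e1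
      - s ^ 3 * (E / 3 + t / 18) * de1
      + (2 * s * ds * (E / 3 - c / 3 + 5 * t / 18) + s ^ 2 * (dE / 3 - dc / 3 + 5 * dt / 18)) * e2
      + s ^ 2 * (E / 3 - c / 3 + 5 * t / 18) * de2 + 2 * s * ds / 3 * ζ 0
      + (ds * (c - 2 * t / 3) + s * (dc - 2 * dt / 3)) * ζ 3
      - ζ 5 / n 6 * (ξ 6 / n 6) - (ds * (ζ 6 / n 6) - s * (ζ 6 / n 6 * (ξ 6 / n 6)))

theorem fderiv_apply_eq_of_hasDerivAt {f : E7 → ℝ} {n ξ : E7} (hf : DifferentiableAt ℝ f n) {d : ℝ}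
    (h : HasDerivAt (fun r : ℝ => f (n + r • ξ)) d 0) : fderiv ℝ f n ξ = d := by
  have h1 : HasDerivAt (fun r : ℝ => n + r • ξ) ξ 0 := by
    simpa using ((hasDerivAt_id (0 : ℝ)).smul_const ξ).const_add n
  have h2 : HasFDerivAt f (fderiv ℝ f n) (n + (0 : ℝ) • ξ) := by simpa using hf.hasFDerivAt
  exact (h2.comp_hasDerivAt (0 : ℝ) h1).unique h

theorem hasDerivAt_coef {k : ℝ} {n : E7} (hq : 0 < n 3) (hw : n 6 ≠ 0) (ξ : E7) :
    HasDerivAt (fun r : ℝ => fibS (n + r • ξ)) (fibSDeriv n ξ) 0 ∧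
    HasDerivAt (fun r : ℝ => fibT k (n + r • ξ)) (fibTDeriv k n ξ) 0 ∧
    HasDerivAt (fun r : ℝ => coefE k (n + r • ξ)) (coefEDeriv k n ξ) 0 ∧
    HasDerivAt (fun r : ℝ => coefZ k (n + r • ξ)) (coefZDeriv k n ξ) 0 := by
  have D : ∀ i, HasDerivAt (fun r : ℝ => (n + r • ξ) i) (ξ i) 0 := fun i => by
    simpa using ((hasDerivAt_id (0 : ℝ)).mul_const (ξ i)).const_add (n i)
  have z : n + (0 : ℝ) • ξ = n := by simp
  have hq0 := hq.ne'
  have hq' : (n + (0 : ℝ) • ξ) 3 ≠ 0 := by rw [z]; exact hq0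
  have hw' : (n + (0 : ℝ) • ξ) 6 ≠ 0 := by rw [z]; exact hw
  have hu : n 3 ^ (k - 2) ≠ 0 := (Real.rpow_pos_of_pos hq _).ne'
  have hT0 : fibT k n ≠ 0 := div_ne_zero hu hw
  have hT : HasDerivAt (fun r : ℝ => fibT k (n + r • ξ)) (fibTDeriv k n ξ) 0 := by
    refine (((D 3).rpow_const (p := k - 2) (Or.inl hq')).div (D 6) hw').congr_deriv ?_
    rw [z, fibTDeriv, fibT, Real.rpow_sub_one hq0]
    field_simp
  have hT0' : fibT k (n + (0 : ℝ) • ξ) ≠ 0 := by rw [z]; exact hT0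
  refine ⟨?_, hT, ?_, ?_⟩
  · refine ((D 5).div (D 6) hw').congr_deriv ?_
    rw [z, fibSDeriv, fibS]
    field_simp
  · refine ((hasDerivAt_const (0 : ℝ) ((k - 2) * (k + 1) / 30)).div (((D 3).pow 2).mul hT)
      (mul_ne_zero (pow_ne_zero _ hq') hT0')).congr_deriv ?_
    simp only [z, Pi.pow_apply, Pi.mul_apply, coefEDeriv, coefE, fibTDeriv]
    field_simp
    norm_num
    ring
  · refine ((hasDerivAt_const (0 : ℝ) (-((2 * k - 1) * (k - 2) * (k + 1) / 45))).div
      (((D 3).pow 3).mul (hT.pow 2))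
      (mul_ne_zero (pow_ne_zero _ hq') (pow_ne_zero _ hT0'))).congr_deriv ?_
    simp only [z, Pi.pow_apply, Pi.mul_apply, coefZDeriv, coefZ, fibTDeriv]
    field_simp
    norm_num
    ring

theorem fderiv_coframe {k : ℝ} {n : E7} (hq : 0 < n 3) (hw : n 6 ≠ 0) (i : Fin 6) (ξ ζ : E7) :
    fderiv ℝ (fun n' => coframe k i n' ζ) n ξ = coframeDeriv k i n ξ ζ := by
  refine fderiv_apply_eq_of_hasDerivAt ((differentiableAt_coframe hq hw ζ i).comp
    (f := fun n' : E7 => (n', ζ)) n (by fun_prop)) ?_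
  obtain ⟨hS, hT, hE, hZ⟩ := hasDerivAt_coef (k := k) hq hw ξ
  have D : ∀ i, HasDerivAt (fun r : ℝ => (n + r • ξ) i) (ξ i) 0 := fun i => by
    simpa using ((hasDerivAt_id (0 : ℝ)).mul_const (ξ i)).const_add (n i)
  have z : n + (0 : ℝ) • ξ = n := by simp
  have hq0 := hq.ne'
  have hq' : (n + (0 : ℝ) • ξ) 3 ≠ 0 := by rw [z]; exact hq0
  have hw' : (n + (0 : ℝ) • ξ) 6 ≠ 0 := by rw [z]; exact hw
  have h1 : HasDerivAt (fun r : ℝ => eta1 (n + r • ξ) ζ) (-ξ 2 * ζ 0) 0 :=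
    (((D 2).mul_const (ζ 0)).const_sub (ζ 1)).congr_deriv (by ring)
  have h2 : HasDerivAt (fun r : ℝ => eta2 (n + r • ξ) ζ) (-ξ 3 * ζ 0) 0 :=
    (((D 3).mul_const (ζ 0)).const_sub (ζ 2)).congr_deriv (by ring)
  have hc : ∀ a : ℝ, HasDerivAt (fun r : ℝ => (k - 2) / (a * (n + r • ξ) 3))
      (-((k - 2) / (a * n 3)) * (ξ 3 / n 3)) 0 := by
    intro a
    rcases eq_or_ne a 0 with rfl | ha
    · simpa using hasDerivAt_const (0 : ℝ) (0 : ℝ)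
    refine ((hasDerivAt_const (0 : ℝ) (k - 2)).div ((D 3).const_mul a)
      (mul_ne_zero ha hq')).congr_deriv ?_
    rw [z]
    field_simp
    ring
  have hi : ∀ a : ℝ, HasDerivAt (fun r : ℝ => a / (n + r • ξ) 6) (-(a / n 6) * (ξ 6 / n 6)) 0 := by
    intro a
    refine ((hasDerivAt_const (0 : ℝ) a).div (D 6) hw').congr_deriv ?_
    rw [z]
    field_simp
    ring
  fin_cases i
  · exact h1
  · refine (h2.sub (hS.mul h1)).congr_deriv ?_
    simp only [z, coframeDeriv]
  · refine (((hasDerivAt_const (0 : ℝ) (ζ 0)).sub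
      ((((hT.const_mul 2).div_const 3).add (hc 3)).mul h2)).add
      (((hS.mul hT).div_const 3).mul h1)).add (hE.mul (h2.sub (hS.mul h1))) |>.congr_deriv ?_
    simp only [zero_smul, add_zero, coframeDeriv, Pi.mul_apply, Pi.add_apply, Pi.sub_apply,
      Pi.zero_apply]
    ring
  · refine ((hT.neg).mul (((hS.mul h2).const_sub (ζ 3)).add
      (((hS.pow 2).div_const 3).mul h1))).congr_deriv ?_
    simp only [z, coframeDeriv, Pi.mul_apply, Pi.add_apply, Pi.pow_apply, Pi.neg_apply]
    norm_num
    ring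
  · refine (((((hS.pow 2).mul (hZ.add (hT.div_const 18))).mul h1).sub
      ((hS.mul ((hZ.add hE).add ((hT.const_mul 2).div_const 9))).mul h2)).add
      (((hE.sub (hc 3)).add (hT.div_const 3)).mul_const (ζ 3))).add (hi (ζ 6)) |>.congr_deriv ?_
    simp only [z, coframeDeriv, Pi.mul_apply, Pi.add_apply, Pi.pow_apply]
    norm_num
    ring
  · refine ((((((hS.pow 3).neg.mul ((hE.div_const 3).add (hT.div_const 18))).mul h1).add
      (((hS.pow 2).mul (((hE.div_const 3).sub (hc 9)).add ((hT.const_mul 5).div_const 18))).mul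
        h2)).add (((hS.pow 2).div_const 3).mul_const (ζ 0))).add
      ((hS.mul ((hc 3).sub ((hT.const_mul 2).div_const 3))).mul_const (ζ 3))).add (hi (ζ 5)) |>.sub
      (hS.mul (hi (ζ 6))) |>.congr_deriv ?_
    simp only [z, coframeDeriv, Pi.mul_apply, Pi.add_apply, Pi.sub_apply,
      Pi.pow_apply, Pi.neg_apply]
    have : (k - 2) / (9 * n 3) = (k - 2) / (3 * n 3) / 3 := by field_simp; norm_num
    rw [this]
    norm_num
    ring


/-! ### Symmetries which preserve the fibration trivially -/

/-- The derivative of a function of `(x, y, p, q, z)` along `dualVector`, without the term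
of `∂_q`. -/
def alongDual (k : ℝ) (g : E7 → ℝ) (n : E7) : ℝ :=
  (2 * fibT k n / 3 + (k - 2) / (3 * n 3) - coefE k n) * pdXi k g n
    + (pd 2 g n + (n 3 ^ (k - 1) / (k - 1) + n 6) * pd 4 g n)

/-- Up to vertical terms, `dualVector` is (2t/3 + (k − 2)/(3q) − E) ξ₁ + ∂_p + (h' + w)∂_z + s∂_q.
The last term is kept apart because s is the variable along which differences are taken. -/
theorem fderiv_dualVector {k : ℝ} {g : E7 → ℝ} {n : E7} (h5 : pd 5 g n = 0) (h6 : pd 6 g n = 0) :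
    fderiv ℝ g n (dualVector k n) = alongDual k g n + fibS n * pd 3 g n := by
  rw [fderiv_eq_pd, h5, h6]
  simp only [dualVector, Matrix.cons_val, alongDual, pdXi, pdT]
  ring

/-- The value of `L_X (coframe k 4)` on `dualVector` for a symmetry with `η₁(X) = η₃(X) = 0`, as a
function of the fibre coordinates and of the jets of `η₂(X)`: the function, its derivatives along
`ξ₁`, `∂_p`, `∂_z`, `∂_q`, and their derivatives along `dualVector`. -/
def dualResidual (k q w s t E Z h' c₁ : ℝ) (g α β : Fin 5 → ℝ) : ℝ :=
  let c := (k - 2) / (3 * q)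
  let N : Fin 5 → ℝ := fun i => α i + s * β i
  let e := w * (s ^ 2 * (Z + t / 18))
  let f := w * (s * (Z + c - t / 9))
  let x := -g 4 + t * g 0
  let r := g 1 + s * g 0
  let a := w * (c₁ - s * w * g 3)
  let b := -w * (g 2 + (h' + w) * g 3) - t * w * r + s * w * x
  let Ns := e / w - s * (f / w)
  let Nt := t * ((k - 2) * (s / q) - f / w)
  let Nx := -N 4 + (Nt * g 0 + t * N 0)
  let Nr := N 1 + (Ns * g 0 + s * N 0)
  let Nb := -(f * (g 2 + (h' + w) * g 3) + w * (N 2 + ((t * w * s + f) * g 3 + (h' + w) * N 3)))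
    - (t * w * (k - 2) * (s / q) * r + t * w * Nr) + (e * x + s * w * Nx)
  let ds := a / w - s * (b / w)
  let dt := t * ((k - 2) * (r / q) - b / w)
  let dE := E * (b / w - k * (r / q))
  let dZ := Z * (2 * (b / w) - (2 * k - 1) * (r / q))
  let dc := -c * (r / q)
  let ν := 2 * t / 3 + c - E
  s ^ 2 * (Z + t / 18) * (-(g 0 + q * x) * ν)
      - (ds * (Z + E + 2 * t / 9) + s * (dZ + dE + 2 * dt / 9)
        + s * (Z + E + 2 * t / 9) * (-r * ν))
      + (dE - dc + dt / 3) * s - f / w * (b / w)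
  + (s ^ 2 * (Z + t / 18) * ((1 + q * ν) * x) - s * (Z + E + 2 * t / 9) * (N 0 + s * x)
      + (E - c + t / 3) * Nr + Nb / w)

/-- With the jets held fixed the residual is a polynomial of degree at most two in s, so the second
difference is a multiple of d² free of s. Only c and c_qq survive in it. The hypothesis says that
the q-derivative of c agrees with the recorded jet c_q. -/
theorem dualResidual_second_difference {k q w s d t E Z h' c₁ : ℝ} (hq : q ≠ 0) (hw : w ≠ 0)
    {g α β : Fin 5 → ℝ} (hβ : β 0 = g 4) :
    dualResidual k q w (s + d) t E Z h' c₁ g α β + dualResidual k q w (s - d) t E Z h' c₁ g α β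
      - 2 * dualResidual k q w s t E Z h' c₁ g α β =
    2 * d ^ 2 * (-β 4 + g 0 * (((k - 2) / (3 * q)) ^ 2 + (k - 2) / (3 * q) / q - t * E / 3
      + 6 * ((k - 2) / (3 * q)) * Z + 3 * Z / q - E ^ 2)) := by
  simp only [dualResidual, hβ]
  field_simp
  ring


/-- The components of a symmetry with `η₁(X) = η₃(X) = 0`. -/
theorem components_of_compA_compB_eq_zero {k : ℝ} (hk0 : k ≠ 0) (hk1 : k - 1 ≠ 0) {B : Set E7}
    (hB : IsOpen B) (hq : ∀ n ∈ B, 0 < n 3) (hw : ∀ n ∈ B, n 6 ≠ 0) {X : E7 → E7}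
    (hX : IsSymmetryOn k B X) (ha : ∀ n ∈ B, compA k X n = 0) (hb : ∀ n ∈ B, compB X n = 0)
    {n : E7} (hn : n ∈ B) :
    X n 0 = -pd 3 (compC X) n + fibT k n * compC X n ∧
    X n 3 = pdXi k (compC X) n + fibS n * compC X n ∧
    X n 5 = n 6 * (pd 1 (compC X) n - n 5 * pd 4 (compC X) n) ∧
    X n 6 = -n 6 * (pd 2 (compC X) n + (n 3 ^ (k - 1) / (k - 1) + n 6) * pd 4 (compC X) n)
      - n 3 ^ (k - 2) * X n 3 + n 5 * X n 0 := by
  obtain ⟨-, -, -, x0, x3⟩ := reduced_equations hk0 hk1 hB hq hw hX hn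
  obtain ⟨-, -, x5, x6⟩ := contact_equations hk0 hk1 hX hn (hq n hn)
  have pa := fun i => pd_eq_zero_of_const hB ha i hn
  have pb := fun i => pd_eq_zero_of_const hB hb i hn
  have xb : pdXi k (compB X) n = 0 := by simp [pdXi, pdT, pb]
  rw [xb, sub_zero] at x0 x3
  simp only [pa, pb] at x5 x6
  exact ⟨x0, x3, by linear_combination x5, by linear_combination -x6⟩

theorem fderiv_congr_of_open {B : Set E7} (hB : IsOpen B) {f g : E7 → ℝ} (h : ∀ n ∈ B, f n = g n)
    {n : E7} (hn : n ∈ B) : fderiv ℝ f n = fderiv ℝ g n :=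
  (Filter.eventuallyEq_of_mem (hB.mem_nhds hn) h : f =ᶠ[𝓝 n] g).fderiv_eq

theorem fderiv_fib {k : ℝ} {n : E7} (hq : 0 < n 3) (hw : n 6 ≠ 0) (ξ : E7) :
    DifferentiableAt ℝ fibS n ∧ DifferentiableAt ℝ (fibT k) n ∧
    fderiv ℝ fibS n ξ = fibSDeriv n ξ ∧ fderiv ℝ (fibT k) n ξ = fibTDeriv k n ξ := by
  have dS : DifferentiableAt ℝ fibS n := by
    unfold fibS
    fun_prop (disch := assumption)
  have h3 : DifferentiableAt ℝ (fun n : E7 => n 3) n := differentiableAt_coord 3 n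
  have hu' : DifferentiableAt ℝ (fun n : E7 => n 3 ^ (k - 2)) n := h3.rpow_const (Or.inl hq.ne')
  have dT : DifferentiableAt ℝ (fibT k) n := by
    unfold fibT
    fun_prop (disch := assumption)
  obtain ⟨hS, hT, -, -⟩ := hasDerivAt_coef (k := k) hq hw ξ
  exact ⟨dS, dT, fderiv_apply_eq_of_hasDerivAt dS hS, fderiv_apply_eq_of_hasDerivAt dT hT⟩

/-- This is the entry (4,1) of the stabilizer matrix, the one equation not used so far. All
components of X are replaced by their expressions in c, so that it becomes an equation for the jets
of c. -/
theorem dualResidual_eq_zero {k : ℝ} (hk0 : k ≠ 0) (hk1 : k - 1 ≠ 0) {B : Set E7}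
    (hB : IsOpen B) (hq : ∀ n ∈ B, 0 < n 3) (hw : ∀ n ∈ B, n 6 ≠ 0) {X : E7 → E7}
    (hX : IsSymmetryOn k B X) (ha : ∀ n ∈ B, compA k X n = 0) (hb : ∀ n ∈ B, compB X n = 0)
    {n : E7} (hn : n ∈ B) (G : Fin 5 → E7 → ℝ)
    (hG : G = ![compC X, pdXi k (compC X), pd 2 (compC X), pd 4 (compC X), pd 3 (compC X)]) :
    dualResidual k (n 3) (n 6) (fibS n) (fibT k n) (coefE k n) (coefZ k n)
      (n 3 ^ (k - 1) / (k - 1)) (pd 1 (compC X) n) (fun i => G i n)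
      (fun i => alongDual k (G i) n) (fun i => pd 3 (G i) n) = 0 := by
  have hd := hX.differentiableAt hn
  have V := fun n hn => vertical_equations hk0 hk1 hX (n := n) hn (hq n hn) (hw n hn)
  have C := fun n hn => components_of_compA_compB_eq_zero hk0 hk1 hB hq hw hX ha hb (n := n) hn
  have sc := hX.smooth_compC
  have c5 := fun n hn => (V n hn).2.2.1.1
  have c6 := fun n hn => (V n hn).2.2.1.2
  have L := (V n hn).2.2.2.2.2.2
  have hw' := hw n hn
  have hq' := hq n hn
  obtain ⟨x0, x3, x5, x6⟩ := C n hn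
  obtain ⟨dS, dT, fS, fT⟩ := fderiv_fib (k := k) hq' hw' (dualVector k n)
  set N := dualVector k n with hN
  have g0 : G 0 = compC X := by rw [hG]; rfl
  have g1 : G 1 = pdXi k (compC X) := by rw [hG]; rfl
  have g2 : G 2 = pd 2 (compC X) := by rw [hG]; rfl
  have g3 : G 3 = pd 4 (compC X) := by rw [hG]; rfl
  have g4 : G 4 = pd 3 (compC X) := by rw [hG]; rfl
  have dG : ∀ i, DifferentiableAt ℝ (G i) n := by
    intro i
    fin_cases i
    · exact g0 ▸ sc.differentiableAt hn
    · exact g1 ▸ (sc.pdXi hq).differentiableAt hn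
    · exact g2 ▸ (sc.pd 2).differentiableAt hn
    · exact g3 ▸ (sc.pd 4).differentiableAt hn
    · exact g4 ▸ (sc.pd 3).differentiableAt hn
  have DG : ∀ i, fderiv ℝ (G i) n N = alongDual k (G i) n + fibS n * pd 3 (G i) n := by
    intro i
    fin_cases i
    · exact g0 ▸ fderiv_dualVector (c5 n hn) (c6 n hn)
    · exact g1 ▸ fderiv_dualVector (pd_pdXi_eq_zero hB hq sc (by decide) (by decide) c5 hn)
        (pd_pdXi_eq_zero hB hq sc (by decide) (by decide) c6 hn)
    · exact g2 ▸ fderiv_dualVector (pd_pd_eq_zero hB sc c5 2 hn) (pd_pd_eq_zero hB sc c6 2 hn)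
    · exact g3 ▸ fderiv_dualVector (pd_pd_eq_zero hB sc c5 4 hn) (pd_pd_eq_zero hB sc c6 4 hn)
    · exact g4 ▸ fderiv_dualVector (pd_pd_eq_zero hB sc c5 3 hn) (pd_pd_eq_zero hB sc c6 3 hn)
  have D := differentiableAt_coord (n := n)
  have dX0 := (hX.comp 0).differentiableAt hn
  have dX3 := (hX.comp 3).differentiableAt hn
  have hφ : HasDerivAt (fun q : ℝ => q ^ (k - 2)) ((k - 2) * n 3 ^ (k - 2 - 1)) (n 3) :=
    Real.hasDerivAt_rpow_const (p := k - 2) (Or.inl hq'.ne')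
  have hφ1 := (hasDerivAt_powers hk0 hk1 hq').1
  have dφ := differentiableAt_comp_coord (j := 3) hφ
  have dφ1 := differentiableAt_comp_coord (j := 3) hφ1
  have N0 : fderiv ℝ (fun n => X n 0) n N = -(alongDual k (G 4) n + fibS n * pd 3 (G 4) n)
      + (fibT k n * (alongDual k (G 0) n + fibS n * pd 3 (G 0) n)
        + G 0 n * fibTDeriv k n N) := by
    have e : ∀ n ∈ B, X n 0 = fibT k n * G 0 n - G 4 n := fun n hn => by
      rw [(C n hn).1, g0, g4]; ring
    rw [fderiv_congr_of_open hB e hn, fderiv_sub_apply (dT.fun_mul (dG 0)) (dG 4),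
      fderiv_mul_apply dT (dG 0), DG, DG, fT]
    ring
  have N3 : fderiv ℝ (fun n => X n 3) n N = (alongDual k (G 1) n + fibS n * pd 3 (G 1) n)
      + (fibS n * (alongDual k (G 0) n + fibS n * pd 3 (G 0) n)
        + G 0 n * fibSDeriv n N) := by
    have e : ∀ n ∈ B, X n 3 = G 1 n + fibS n * G 0 n := fun n hn => by
      rw [(C n hn).2.1, g0, g1]
    rw [fderiv_congr_of_open hB e hn, fderiv_add_apply (dG 1) (dS.fun_mul (dG 0)),
      fderiv_mul_apply dS (dG 0), DG, DG, fS]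
  have N6 : fderiv ℝ (fun n => X n 6) n N =
      -(N 6 * (G 2 n + (n 3 ^ (k - 1) / (k - 1) + n 6) * G 3 n)
        + n 6 * (fderiv ℝ (G 2) n N + ((n 3 ^ (k - 2) * N 3 + N 6) * G 3 n
          + (n 3 ^ (k - 1) / (k - 1) + n 6) * fderiv ℝ (G 3) n N)))
      - ((k - 2) * n 3 ^ (k - 2 - 1) * N 3 * X n 3
        + n 3 ^ (k - 2) * fderiv ℝ (fun n => X n 3) n N)
      + (N 5 * X n 0 + n 5 * fderiv ℝ (fun n => X n 0) n N) := by
    have e : ∀ n ∈ B, X n 6 = n 5 * X n 0 - n 3 ^ (k - 2) * X n 3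
        - n 6 * (G 2 n + (n 3 ^ (k - 1) / (k - 1) + n 6) * G 3 n) := fun n hn => by
      rw [(C n hn).2.2.2, g2, g3]
      ring
    have m1 : DifferentiableAt ℝ (fun n : E7 => n 3 ^ (k - 1) / (k - 1) + n 6) n :=
      dφ1.fun_add (D 6)
    have m2 := (dG 2).fun_add (m1.fun_mul (dG 3))
    rw [fderiv_congr_of_open hB e hn, fderiv_sub_apply (((D 5).fun_mul dX0).fun_sub
        (dφ.fun_mul dX3)) ((D 6).fun_mul m2), fderiv_sub_apply ((D 5).fun_mul dX0) (dφ.fun_mul dX3),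
      fderiv_mul_apply (D 5) dX0, fderiv_mul_apply dφ dX3, fderiv_mul_apply (D 6) m2,
      fderiv_add_apply (dG 2) (m1.fun_mul (dG 3)), fderiv_mul_apply m1 (dG 3),
      fderiv_add_apply dφ1 (D 6), fderiv_comp_coord hφ, fderiv_comp_coord hφ1, fderiv_coord,
      fderiv_coord]
    ring
  rw [lieDerivative_coframe hq' hw', fderiv_coframe hq' hw'] at L
  simp only [coframe, eta1_fderiv hd, eta2_fderiv hd] at L
  rw [show fderiv ℝ (compB X) n N = 0 from by
    rw [fderiv_congr_of_open hB hb hn]; simp, ← g0, DG, fderiv_component hd, fderiv_component hd,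
    N6, N3, N0, DG, DG] at L
  have y2 : X n 2 = G 0 n + n 3 * X n 0 := by rw [g0, compC]; ring
  -- From here on h'' and v are written as tw and sw, so that both sides are rational in q, w, s, t
  -- and the jets.
  have u : n 3 ^ (k - 2) = fibT k n * n 6 := by rw [fibT]; field_simp
  have v : n 5 = fibS n * n 6 := by rw [fibS]; field_simp
  have e1 : eta1 n N = 0 := by simp [hN, eta1, dualVector]
  have e2 : eta2 n N = 1 := by simp [hN, eta2, dualVector]
  rw [← g4, ← g0] at x0
  rw [← g1, ← g0] at x3
  rw [← g3, ← g0] at x5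
  rw [← g3, ← g2] at x6
  simp only [coframeDeriv, e1, e2, fibSDeriv, fibTDeriv, coefEDeriv, coefZDeriv, y2] at L
  have n0 : N 0 = 2 * fibT k n / 3 + (k - 2) / (3 * n 3) - coefE k n := rfl
  have n2 : N 2 = 1 + n 3 * (2 * fibT k n / 3 + (k - 2) / (3 * n 3) - coefE k n) := rfl
  have n3 : N 3 = fibS n := rfl
  have n5 : N 5 = n 6 * (fibS n ^ 2 * (coefZ k n + fibT k n / 18)) := rfl
  have n6 : N 6 = n 6 * (fibS n * (coefZ k n + (k - 2) / (3 * n 3) - fibT k n / 9)) := rfl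
  rw [x5, x6, x3, x0, n0, n2, n3, n5, n6, Real.rpow_sub_one hq'.ne' (k - 2), u, v] at L
  rw [← L, ← g0]
  simp only [dualResidual]
  ring


/-! ### Vanishing of η₂(X) by variation of the fibre coordinates -/

theorem exists_update_mem {B : Set E7} (hB : IsOpen B) {n : E7} (hn : n ∈ B) (i : Fin 7) :
    ∃ d : ℝ, 0 < d ∧ ∀ r, |r| ≤ d → Function.update n i (n i + r) ∈ B := by
  have hc : Continuous fun r : ℝ => Function.update n i (n i + r) :=
    continuous_const.update i (continuous_const.add continuous_id)
  have : (fun r : ℝ => Function.update n i (n i + r)) ⁻¹' B ∈ 𝓝 (0 : ℝ) :=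
    (hB.preimage hc).mem_nhds (by simpa using hn)
  obtain ⟨ε, hε, h⟩ := Metric.mem_nhds_iff.1 this
  refine ⟨ε / 2, by positivity, fun r hr => h ?_⟩
  rw [Metric.mem_ball, Real.dist_eq, sub_zero]
  linarith

theorem SmoothOn.update_eq {B : Set E7} (hB : Convex ℝ B) {g : E7 → ℝ} (hg : SmoothOn B g)
    {i : Fin 7} (h : ∀ n ∈ B, TwistorLieContact.pd i g n = 0) {n : E7} (hn : n ∈ B) {x : ℝ}
    (hx : Function.update n i x ∈ B) : g (Function.update n i x) = g n := by
  refine eq_of_pd_eq_zero hB hg hx hn fun j => ?_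
  rcases eq_or_ne j i with rfl | hj
  · exact Or.inr h
  · exact Or.inl (Function.update_of_ne hj _ _)

/-- A change of v moves s = v/w but leaves w, t, E, Z and all jets of c fixed. The residual
therefore vanishes for an interval of values of s, and with it its s²-coefficient. -/
theorem compC_second_order {k : ℝ} (hk0 : k ≠ 0) (hk1 : k - 1 ≠ 0) {B : Set E7}
    (hB : IsBox B) (hq : ∀ n ∈ B, 0 < n 3) (hw : ∀ n ∈ B, n 6 ≠ 0) {X : E7 → E7}
    (hX : IsSymmetryOn k B X) (ha : ∀ n ∈ B, compA k X n = 0) (hb : ∀ n ∈ B, compB X n = 0)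
    {n : E7} (hn : n ∈ B) :
    -pd 3 (pd 3 (compC X)) n + compC X n * (((k - 2) / (3 * n 3)) ^ 2
      + (k - 2) / (3 * n 3) / n 3 - fibT k n * coefE k n / 3
      + 6 * ((k - 2) / (3 * n 3)) * coefZ k n + 3 * coefZ k n / n 3 - coefE k n ^ 2) = 0 := by
  have sc := hX.smooth_compC
  have c5 : ∀ n ∈ B, pd 5 (compC X) n = 0 := fun n hn =>
    (vertical_equations hk0 hk1 hX hn (hq n hn) (hw n hn)).2.2.1.1
  have hBo := hB.isOpen
  obtain ⟨G, hG⟩ : ∃ G : Fin 5 → E7 → ℝ, G = ![compC X, pdXi k (compC X), pd 2 (compC X),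
    pd 4 (compC X), pd 3 (compC X)] := ⟨_, rfl⟩
  have sG : ∀ i, SmoothOn B (G i) ∧ ∀ n ∈ B, pd 5 (G i) n = 0 := by
    intro i
    rw [hG]
    fin_cases i
    · exact ⟨sc, c5⟩
    · exact ⟨sc.pdXi hq, fun n hn => pd_pdXi_eq_zero hBo hq sc (by decide) (by decide) c5 hn⟩
    · exact ⟨sc.pd 2, fun n hn => pd_pd_eq_zero hBo sc c5 2 hn⟩
    · exact ⟨sc.pd 4, fun n hn => pd_pd_eq_zero hBo sc c5 4 hn⟩
    · exact ⟨sc.pd 3, fun n hn => pd_pd_eq_zero hBo sc c5 3 hn⟩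
  have E0 := fun n hn => dualResidual_eq_zero hk0 hk1 hBo hq hw hX ha hb (n := n) hn G hG
  obtain ⟨d, hd, hmem⟩ := exists_update_mem hBo hn 5
  have E1 : ∀ r, |r| ≤ d → dualResidual k (n 3) (n 6) (fibS n + r / n 6) (fibT k n) (coefE k n)
      (coefZ k n) (n 3 ^ (k - 1) / (k - 1)) (pd 1 (compC X) n) (fun i => G i n)
      (fun i => alongDual k (G i) n) (fun i => pd 3 (G i) n) = 0 := by
    intro r hr
    have hm := hmem r hr
    have h := E0 _ hm
    have u : ∀ j : Fin 7, j ≠ 5 → Function.update n 5 (n 5 + r) j = n j := fun j hj =>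
      Function.update_of_ne hj _ _
    have uT : fibT k (Function.update n 5 (n 5 + r)) = fibT k n := by
      simp only [fibT, u 3 (by decide), u 6 (by decide)]
    have uE : coefE k (Function.update n 5 (n 5 + r)) = coefE k n := by
      simp only [coefE, u 3 (by decide), uT]
    have uZ : coefZ k (Function.update n 5 (n 5 + r)) = coefZ k n := by
      simp only [coefZ, u 3 (by decide), uT]
    have uS : fibS (Function.update n 5 (n 5 + r)) = fibS n + r / n 6 := by
      simp only [fibS, u 6 (by decide), Function.update_self, add_div]
    have g0 : ∀ i, G i (Function.update n 5 (n 5 + r)) = G i n := fun i =>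
      (sG i).1.update_eq hB.convex (sG i).2 hn hm
    have gj : ∀ i j, pd j (G i) (Function.update n 5 (n 5 + r)) = pd j (G i) n := fun i j =>
      ((sG i).1.pd j).update_eq hB.convex
        (fun n hn => pd_pd_eq_zero hBo (sG i).1 (sG i).2 j hn) hn hm
    have gx : ∀ i, pdXi k (G i) (Function.update n 5 (n 5 + r)) = pdXi k (G i) n := fun i =>
      ((sG i).1.pdXi hq).update_eq hB.convex
        (fun n hn => pd_pdXi_eq_zero hBo hq (sG i).1 (by decide) (by decide) (sG i).2 hn) hn hm
    have ga : ∀ i, alongDual k (G i) (Function.update n 5 (n 5 + r)) = alongDual k (G i) n := by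
      intro i
      simp only [alongDual, gj, gx, uT, uE, u 3 (by decide), u 6 (by decide)]
    have g1 : pd 1 (compC X) (Function.update n 5 (n 5 + r)) = pd 1 (compC X) n :=
      (sc.pd 1).update_eq hB.convex (fun n hn => pd_pd_eq_zero hBo sc c5 1 hn) hn hm
    simpa only [ga, gj, g0, g1, uT, uE, uZ, uS, u 3 (by decide), u 6 (by decide)] using h
  have g0 : G 0 = compC X := by rw [hG]; rfl
  have g4 : G 4 = pd 3 (compC X) := by rw [hG]; rfl
  have hn6 := hw n hn
  have key := dualResidual_second_difference (k := k) (q := n 3) (w := n 6) (s := fibS n)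
    (d := d / n 6) (t := fibT k n) (E := coefE k n) (Z := coefZ k n)
    (h' := n 3 ^ (k - 1) / (k - 1)) (c₁ := pd 1 (compC X) n) (hq n hn).ne' hn6
    (g := fun i => G i n) (α := fun i => alongDual k (G i) n) (β := fun i => pd 3 (G i) n)
    (by simp only [g0, g4])
  have p := E1 d (by rw [abs_of_pos hd])
  have m := E1 (-d) (by rw [abs_neg, abs_of_pos hd])
  have z := E1 0 (by simpa using hd.le)
  rw [neg_div, ← sub_eq_add_neg] at m
  rw [zero_div, add_zero] at z
  rw [p, m, z, g0, g4] at key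
  have : 2 * (d / n 6) ^ 2 ≠ 0 := by positivity
  exact (mul_eq_zero.1 (by linear_combination -key)).resolve_left this

/-- In `compC_second_order` the functions c and c_qq do not depend on w, while the factor of c is
quadratic in w: tE is free of w, and E², Z are multiples of w². The second difference in w leaves c
times the w²-coefficient. -/
theorem compC_eq_zero {k : ℝ} (hk : k ∉ ({2, 2 / 3, 1 / 3, 0, 1, -1} : Set ℝ)) {B : Set E7}
    (hB : IsBox B) (hq : ∀ n ∈ B, 0 < n 3) (hw : ∀ n ∈ B, n 6 ≠ 0) {X : E7 → E7}
    (hX : IsSymmetryOn k B X) (ha : ∀ n ∈ B, compA k X n = 0) (hb : ∀ n ∈ B, compB X n = 0)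
    {n : E7} (hn : n ∈ B) : compC X n = 0 := by
  simp only [Set.mem_insert_iff, Set.mem_singleton_iff, not_or] at hk
  obtain ⟨k2, k23, k13, hk0, hk1', km⟩ := hk
  have hk1 : k - 1 ≠ 0 := sub_ne_zero.2 hk1'
  have sc := hX.smooth_compC
  have c6 : ∀ n ∈ B, pd 6 (compC X) n = 0 := fun n hn =>
    (vertical_equations hk0 hk1 hX hn (hq n hn) (hw n hn)).2.2.1.2
  have hBo := hB.isOpen
  obtain ⟨d, hd, hmem⟩ := exists_update_mem hBo hn 6
  have hq' := hq n hn
  have hu : n 3 ^ (k - 2) ≠ 0 := (Real.rpow_pos_of_pos hq' _).ne'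
  -- The Z-terms and E² combine through (2k − 1)²/45 + (k − 2)(k + 1)/900 = (3k − 1)(3k − 2)/100.
  have E : ∀ r, |r| ≤ d → -pd 3 (pd 3 (compC X)) n + compC X n * (((k - 2) / (3 * n 3)) ^ 2
      + (k - 2) / (3 * n 3) / n 3 - (k - 2) * (k + 1) / 90 / n 3 ^ 2
      - (k - 2) * (k + 1) * (3 * k - 1) * (3 * k - 2) / 100 / (n 3 ^ 4 * (n 3 ^ (k - 2)) ^ 2)
        * (n 6 + r) ^ 2) = 0 := by
    intro r hr
    have hm := hmem r hr
    have h := compC_second_order hk0 hk1 hB hq hw hX ha hb hm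
    have h6 := hw _ hm
    rw [((sc.pd 3).pd 3).update_eq hB.convex (fun n hn => pd_pd_eq_zero hBo (sc.pd 3)
      (fun n hn => pd_pd_eq_zero hBo sc c6 3 hn) 3 hn) hn hm, sc.update_eq hB.convex c6 hn hm] at h
    simp only [fibT, coefE, coefZ, Function.update_self,
      Function.update_of_ne (show (3 : Fin 7) ≠ 6 by decide)] at h h6
    rw [← h]
    congr 2
    field_simp
    ring
  have p := E d (by rw [abs_of_pos hd])
  have m := E (-d) (by rw [abs_neg, abs_of_pos hd])
  have z := E 0 (by simpa using hd.le)
  have key : compC X n * ((k - 2) * (k + 1) * (3 * k - 1) * (3 * k - 2) / 100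
      / (n 3 ^ 4 * (n 3 ^ (k - 2)) ^ 2) * (2 * d ^ 2)) = 0 := by
    linear_combination 2 * z - p - m
  refine (mul_eq_zero.1 key).resolve_right ?_
  have e1 : k - 2 ≠ 0 := sub_ne_zero.2 k2
  have e2 : k + 1 ≠ 0 := fun h => km (by linarith)
  have e3 : 3 * k - 1 ≠ 0 := fun h => k13 (by linarith)
  have e4 : 3 * k - 2 ≠ 0 := fun h => k23 (by linarith)
  have := hq'.ne'
  have := hd.ne'
  positivity

theorem eq_zero_of_compA_compB_eq_zero {k : ℝ} (hk : k ∉ ({2, 2 / 3, 1 / 3, 0, 1, -1} : Set ℝ))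
    {B : Set E7} (hB : IsBox B) (hq : ∀ n ∈ B, 0 < n 3) (hw : ∀ n ∈ B, n 6 ≠ 0) {X : E7 → E7}
    (hX : IsSymmetryOn k B X) (ha : ∀ n ∈ B, compA k X n = 0) (hb : ∀ n ∈ B, compB X n = 0)
    {n : E7} (hn : n ∈ B) : X n = 0 := by
  have hc := fun n hn => compC_eq_zero hk hB hq hw hX ha hb (n := n) hn
  simp only [Set.mem_insert_iff, Set.mem_singleton_iff, not_or] at hk
  obtain ⟨-, -, -, hk0, hk1', -⟩ := hk
  have pc := fun i => pd_eq_zero_of_const hB.isOpen hc i hn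
  obtain ⟨x0, x3, x5, x6⟩ := components_of_compA_compB_eq_zero hk0 (sub_ne_zero.2 hk1') hB.isOpen
    hq hw hX ha hb hn
  simp only [pdXi, pdT, pc, hc n hn, mul_zero, add_zero, neg_zero, sub_zero] at x0 x3 x5
  rw [pc, pc, x3, x0] at x6
  have x1 := hb n hn
  have x2 := hc n hn
  have x4 := ha n hn
  simp only [compB, compC, x0, mul_zero, sub_zero] at x1 x2
  simp only [compA, x0, x2, mul_zero, sub_zero, add_zero] at x4
  funext i
  fin_cases i
  · exact x0
  · exact x1
  · exact x2
  · exact x3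
  · exact x4
  · exact x5
  · simpa using x6


/-! ### Forms which vanish on the contact distribution -/

/-- A form of degree four differs from its restriction to the contact distribution, extended along
`∂_z`, by a multiple of `λ`. -/
def ReducesToContact (k : ℝ) (n : E7) (Q : E7 → ℝ) : Prop :=
  ∃ τ : MultilinearMap ℝ (fun _ : Fin 3 => E7) ℝ, ∀ ξ : E7,
    Q ξ - Q (ξ - lam k n ξ • Pi.single 4 1) = lam k n ξ * τ fun _ => ξ

theorem ReducesToContact.add {k : ℝ} {n : E7} {Q R : E7 → ℝ} (hQ : ReducesToContact k n Q)
    (hR : ReducesToContact k n R) : ReducesToContact k n fun ξ => Q ξ + R ξ := by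
  obtain ⟨τ, h⟩ := hQ
  obtain ⟨τ', h'⟩ := hR
  refine ⟨τ + τ', fun ξ => ?_⟩
  rw [add_apply]
  linear_combination h ξ + h' ξ

theorem ReducesToContact.const_mul {k : ℝ} {n : E7} {Q : E7 → ℝ} (hQ : ReducesToContact k n Q)
    (c : ℝ) : ReducesToContact k n fun ξ => c * Q ξ := by
  obtain ⟨τ, h⟩ := hQ
  refine ⟨c • τ, fun ξ => ?_⟩
  rw [smul_apply, smul_eq_mul]
  linear_combination c * h ξ

/-- Under the projection along ∂_z each linear factor l changes by λ(ξ) l(∂_z). The difference of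
the two products telescopes, with a factor λ(ξ) in every summand; the remaining triple products form
τ. -/
theorem reducesToContact_mul {k : ℝ} {n : E7} {a b c d : E7 → ℝ} (ha : IsLinearMap ℝ a)
    (hb : IsLinearMap ℝ b) (hc : IsLinearMap ℝ c) (hd : IsLinearMap ℝ d) :
    ReducesToContact k n fun ξ => a ξ * b ξ * c ξ * d ξ := by
  set e : E7 := Pi.single 4 1 with he
  have hp : ∀ {l : E7 → ℝ}, IsLinearMap ℝ l → IsLinearMap ℝ fun ξ => l (ξ - lam k n ξ • e) := by
    intro l hl
    have : ∀ ξ, l (ξ - lam k n ξ • e) = l ξ - lam k n ξ * l e := fun ξ => by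
      rw [hl.map_sub, hl.map_smul, smul_eq_mul]
    constructor
    · intro x y
      rw [this, this, this, hl.map_add, (isLinearMap_lam k n).map_add]
      ring
    · intro r x
      rw [this, this, hl.map_smul, (isLinearMap_lam k n).map_smul]
      simp only [smul_eq_mul]
      ring
  let m3 : ∀ {x y z : E7 → ℝ}, IsLinearMap ℝ x → IsLinearMap ℝ y → IsLinearMap ℝ z →
      MultilinearMap ℝ (fun _ : Fin 3 => E7) ℝ := fun hx hy hz =>
    (MultilinearMap.mkPiAlgebra ℝ (Fin 3) ℝ).compLinearMap ![hx.mk', hy.mk', hz.mk']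
  have hm3 : ∀ {x y z : E7 → ℝ} (hx : IsLinearMap ℝ x) (hy : IsLinearMap ℝ y)
      (hz : IsLinearMap ℝ z) (ξ : E7), m3 hx hy hz (fun _ => ξ) = x ξ * y ξ * z ξ := by
    intro x y z hx hy hz ξ
    simp [m3, Fin.prod_univ_three]
  refine ⟨a e • m3 hb hc hd + b e • m3 (hp ha) hc hd + c e • m3 (hp ha) (hp hb) hd
    + d e • m3 (hp ha) (hp hb) (hp hc), fun ξ => ?_⟩
  simp only [add_apply, smul_apply, hm3, smul_eq_mul]
  simp only [ha.map_sub, hb.map_sub, hc.map_sub, hd.map_sub, ha.map_smul, hb.map_smul, hc.map_smul,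
    hd.map_smul, smul_eq_mul]
  ring

/-- The form Q − fR vanishes at the projected vector, so it equals its own reduction difference,
which is divisible by λ. -/
theorem ReducesToContact.exists_of_forall {k : ℝ} {n : E7} {Q R : E7 → ℝ}
    (hQ : ReducesToContact k n Q) (hR : ReducesToContact k n R) {f : ℝ}
    (h : ∀ ξ, lam k n ξ = 0 → Q ξ = f * R ξ) :
    ∃ τ : MultilinearMap ℝ (fun _ : Fin 3 => E7) ℝ, ∀ ξ,
      Q ξ = f * R ξ + lam k n ξ * τ fun _ => ξ := by
  obtain ⟨τ, hτ⟩ := hQ.add (hR.const_mul (-f))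
  refine ⟨τ, fun ξ => ?_⟩
  have h0 : lam k n (ξ - lam k n ξ • Pi.single 4 1) = 0 := by
    rw [(isLinearMap_lam k n).map_sub, (isLinearMap_lam k n).map_smul, lam_e4]
    simp
  linear_combination hτ ξ + h _ h0

/-- A tensor field of rank four whose Lie derivative reduces to the contact distribution. -/
def LieReduces (k : ℝ) (X : E7 → E7) (n : E7) (F : E7 → E7 → ℝ) : Prop :=
  (∀ ξ, DifferentiableAt ℝ (fun x : E7 × E7 => F x.1 x.2) (n, ξ)) ∧
  ReducesToContact k n (F n) ∧ ReducesToContact k n (lieDerivative X F n)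

theorem LieReduces.add {k : ℝ} {X : E7 → E7} {n : E7} {F G : E7 → E7 → ℝ}
    (hF : LieReduces k X n F) (hG : LieReduces k X n G) :
    LieReduces k X n fun n ξ => F n ξ + G n ξ := by
  refine ⟨fun ξ => (hF.1 ξ).fun_add (hG.1 ξ), hF.2.1.add hG.2.1, ?_⟩
  have : lieDerivative X (fun n ξ => F n ξ + G n ξ) n =
      fun ξ => lieDerivative X F n ξ + lieDerivative X G n ξ := by
    funext ξ
    rw [lieDerivative_eq_fderiv (hF.1 ξ), lieDerivative_eq_fderiv (hG.1 ξ),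
      lieDerivative_eq_fderiv ((hF.1 ξ).fun_add (hG.1 ξ)), fderiv_fun_add (hF.1 ξ) (hG.1 ξ)]
    rfl
  rw [this]
  exact hF.2.2.add hG.2.2

theorem LieReduces.const_mul {k : ℝ} {X : E7 → E7} {n : E7} {F : E7 → E7 → ℝ}
    (hF : LieReduces k X n F) (c : ℝ) : LieReduces k X n fun n ξ => c * F n ξ := by
  refine ⟨fun ξ => (hF.1 ξ).const_mul c, hF.2.1.const_mul c, ?_⟩
  have : lieDerivative X (fun n ξ => c * F n ξ) n = fun ξ => c * lieDerivative X F n ξ := by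
    funext ξ
    rw [lieDerivative_eq_fderiv (hF.1 ξ), lieDerivative_eq_fderiv ((hF.1 ξ).const_mul c),
      fderiv_const_mul (hF.1 ξ)]
    rfl
  rw [this]
  exact hF.2.2.const_mul c

/-- By the Leibniz rule the Lie derivative is a sum of four products of linear forms, because the
Lie derivative of a linear form is again linear. -/
theorem lieReduces_mul {k : ℝ} {X : E7 → E7} {n : E7} {F : Fin 4 → E7 → E7 → ℝ}
    (hd : ∀ i ξ, DifferentiableAt ℝ (fun x : E7 × E7 => F i x.1 x.2) (n, ξ))
    (hl : ∀ i n', IsLinearMap ℝ (F i n')) :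
    LieReduces k X n fun n ξ => F 0 n ξ * F 1 n ξ * F 2 n ξ * F 3 n ξ := by
  have d01 := fun ξ => (hd 0 ξ).fun_mul (hd 1 ξ)
  have d012 := fun ξ => (d01 ξ).fun_mul (hd 2 ξ)
  have d := fun ξ => (d012 ξ).fun_mul (hd 3 ξ)
  have L : ∀ i, IsLinearMap ℝ (lieDerivative X (F i) n) := fun i =>
    (isLinearMap_lieDerivative (hl i) fun ξ =>
      (hd i ξ).comp (f := fun n' : E7 => (n', ξ)) n (by fun_prop)).1
  refine ⟨d, reducesToContact_mul (hl 0 n) (hl 1 n) (hl 2 n) (hl 3 n), ?_⟩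
  have : lieDerivative X (fun n ξ => F 0 n ξ * F 1 n ξ * F 2 n ξ * F 3 n ξ) n =
      fun ξ => lieDerivative X (F 0) n ξ * F 1 n ξ * F 2 n ξ * F 3 n ξ
        + F 0 n ξ * lieDerivative X (F 1) n ξ * F 2 n ξ * F 3 n ξ
        + F 0 n ξ * F 1 n ξ * lieDerivative X (F 2) n ξ * F 3 n ξ
        + F 0 n ξ * F 1 n ξ * F 2 n ξ * lieDerivative X (F 3) n ξ := by
    funext ξ
    simp only [lieDerivative_eq_fderiv (hd _ ξ)]
    rw [lieDerivative_eq_fderiv (d ξ), fderiv_fun_mul (d012 ξ) (hd 3 ξ),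
      fderiv_fun_mul (d01 ξ) (hd 2 ξ), fderiv_fun_mul (hd 0 ξ) (hd 1 ξ)]
    simp only [add_apply, smul_apply, smul_eq_mul]
    ring
  rw [this]
  exact (((reducesToContact_mul (L 0) (hl 1 n) (hl 2 n) (hl 3 n)).add
    (reducesToContact_mul (hl 0 n) (L 1) (hl 2 n) (hl 3 n))).add
    (reducesToContact_mul (hl 0 n) (hl 1 n) (L 2) (hl 3 n))).add
    (reducesToContact_mul (hl 0 n) (hl 1 n) (hl 2 n) (L 3))

theorem lieReduces_upsilon {k : ℝ} (hk0 : k ≠ 0) (hk1 : k - 1 ≠ 0) {n : E7} (hq : 0 < n 3)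
    (hw : n 6 ≠ 0) (X : E7 → E7) : LieReduces k X n (upsilon (profile k)) := by
  have hd := differentiableAt_theta hk0 hk1 hq hw
  have hl := isLinearMap_theta (profile k)
  obtain ⟨Θ, hΘ⟩ : ∃ Θ : Fin 6 → E7 → E7 → ℝ, Θ = ![theta1 (profile k), theta2 (profile k),
    theta3 (profile k), theta4 (profile k), theta5 (profile k), theta6 (profile k)] := ⟨_, rfl⟩
  have hd' : ∀ i ξ, DifferentiableAt ℝ (fun x : E7 × E7 => Θ i x.1 x.2) (n, ξ) := by
    intro i ξ
    obtain ⟨h1, h2, h3, h4, h5, h6⟩ := hd ξ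
    rw [hΘ]
    fin_cases i <;> assumption
  have hl' : ∀ i n', IsLinearMap ℝ (Θ i n') := by
    intro i n'
    obtain ⟨h1, h2, h3, h4, h5, h6⟩ := hl n'
    rw [hΘ]
    fin_cases i <;> assumption
  have M := fun a b c d : Fin 6 => lieReduces_mul (k := k) (X := X) (n := n)
    (F := fun i => Θ (![a, b, c, d] i)) (fun i => hd' _) (fun i => hl' _)
  have key := ((((((M 1 2 2 5).const_mul 2).add ((M 0 0 5 5).const_mul (-3))).add
    ((M 0 2 3 5).const_mul (-2))).add ((M 0 1 4 5).const_mul (-6))).add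
    ((M 1 2 3 4).const_mul 2)).add ((M 0 3 3 4).const_mul (-2)) |>.add
    ((M 1 1 4 4).const_mul (-3))
  convert key using 1
  funext n ξ
  simp only [upsilon, hΘ, Matrix.cons_val]
  ring

/-- A vector field which acts on the coframe of the contact distribution in a way that preserves
the quartic form up to scale satisfies the symmetry equations. -/
theorem symmetryEquationsAt_of_coframe {k : ℝ} (hk0 : k ≠ 0) (hk1 : k - 1 ≠ 0) {n : E7}
    (hq : 0 < n 3) (hw : n 6 ≠ 0) {X : E7 → E7} {μ : ℝ}
    (hlam : ∀ ξ, lieDerivative X (lam k) n ξ = μ * lam k n ξ) {f : ℝ}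
    (h : ∀ ξ, lam k n ξ = 0 →
      minorQuarticDeriv (1 / fibT k n) (-(fibTDeriv k n (X n) / fibT k n ^ 2))
        (fun i => coframe k i n ξ) (fun i => lieDerivative X (coframe k i) n ξ) =
      f * minorQuartic (1 / fibT k n) fun i => coframe k i n ξ) :
    SymmetryEquationsAt k X n := by
  refine ⟨fun ξ η => by rw [hlam, hlam]; ring, ?_⟩
  obtain ⟨g', m', hm', hgm⟩ := lieDerivative_upsilonContact (k := k) hq hw X
  have hT : fibT k n ≠ 0 := div_ne_zero (Real.rpow_pos_of_pos hq _).ne' hw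
  have hm : m' = -(fibTDeriv k n (X n) / fibT k n ^ 2) := by
    obtain ⟨-, dT, -, -⟩ := fderiv_fib (k := k) hq hw (X n)
    have z : n + (0 : ℝ) • X n = n := by simp
    have h1 := (hasDerivAt_coef (k := k) hq hw (X n)).2.1
    rw [hm']
    refine fderiv_apply_eq_of_hasDerivAt (by fun_prop (disch := assumption))
      (((hasDerivAt_const (0 : ℝ) (1 : ℝ)).div h1 (by rw [z]; exact hT)).congr_deriv ?_)
    rw [z]
    ring
  set g := (n 3 ^ (k - 2)) ^ (8 / 3 : ℝ) / (243 * n 6 ^ 6) with hg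
  have hg0 : g ≠ 0 := div_ne_zero
    (Real.rpow_pos_of_pos (Real.rpow_pos_of_pos hq _) _).ne'
    (mul_ne_zero (by norm_num) (pow_ne_zero _ hw))
  obtain ⟨-, hr, hlr⟩ := lieReduces_upsilon hk0 hk1 hq hw X
  -- The multiplier is f plus the logarithmic derivative of the conformal factor along X. It
  -- suffices to compare both sides on ker λ.
  refine ⟨g' / g + f, hlr.exists_of_forall hr fun ξ hξ => ?_⟩
  rw [lieDerivative_congr_contact hq.ne' (differentiableAt_upsilon hk0 hk1 hq hw ξ) (hgm ξ).1
    (upsilon_eventuallyEq hk0 hk1 hq hw) hξ (by rw [hlam, hξ, mul_zero]), (hgm ξ).2, hm, h ξ hξ,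
    upsilon_of_mem_contact hk0 hk1 hq hw hξ]
  rw [← hg]
  field_simp


/-! ### The vector fields `X̃_i` are symmetries -/

/-- The derivative of `fieldXt k i` in the direction `ξ`. -/
def fieldXtDeriv (k : ℝ) (i : Fin 7) (n ξ : E7) : E7 :=
  match i with
  | 0 => 0
  | 1 => 0
  | 2 => 0
  | 3 => ![0, ξ 0, 0, 0, 0, 0, 0]
  | 4 => ![ξ 0, 0, -ξ 2, -2 * ξ 3, (1 - 2 * k) * ξ 4, (1 - 2 * k) * ξ 5, 2 * (1 - k) * ξ 6]
  | 5 => ![0, ξ 1, ξ 2, ξ 3, k * ξ 4, (k - 1) * ξ 5, (k - 1) * ξ 6]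
  | 6 => ![(k - 1) * n 3 ^ (k - 2) * ξ 3, ξ 2 * n 3 ^ (k - 1)
      + n 2 * ((k - 1) * n 3 ^ (k - 2) * ξ 3) + (1 - k) * ξ 4,
      (k - 1) * n 3 ^ (k - 1) * ξ 3, 0, n 3 ^ (2 * k - 2) / k * ξ 3, 2 * (1 - k) * n 5 * ξ 5,
      (1 - k) * (ξ 5 * n 6 + n 5 * ξ 6)]

theorem contDiffAt_zCoeff {k q : ℝ} (hq : 0 < q) : ContDiffAt ℝ ∞ (zCoeff k) q := by
  unfold zCoeff
  by_cases h : k = 1 / 2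
  · simp only [h, if_true]
    exact (Real.contDiffAt_log.2 hq.ne').div_const _
  · simp only [h, if_false]
    exact (Real.contDiffAt_rpow_const_of_ne hq.ne').div_const _

theorem contDiffAt_fieldXt {k : ℝ} {n : E7} (hq : 0 < n 3) (i : Fin 7) :
    ContDiffAt ℝ ∞ (fieldXt k i) n := by
  have c : ∀ j : Fin 7, ContDiffAt ℝ ∞ (fun n : E7 => n j) n := fun j => contDiffAt_apply ℝ ℝ j n
  have r : ∀ e : ℝ, ContDiffAt ℝ ∞ (fun n : E7 => n 3 ^ e) n := fun e =>
    ContDiffAt.comp (g := fun q : ℝ => q ^ e) n (Real.contDiffAt_rpow_const_of_ne hq.ne') (c 3)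
  have z : ContDiffAt ℝ ∞ (fun n : E7 => zCoeff k (n 3)) n :=
    ContDiffAt.comp (g := zCoeff k) n (contDiffAt_zCoeff hq) (c 3)
  have rk := r k
  have r1 := r (k - 1)
  rw [contDiffAt_pi]
  intro j
  fin_cases i <;> fin_cases j <;> simp [fieldXt] <;> fun_prop

theorem fderiv_fieldXt {k : ℝ} (hk0 : k ≠ 0) {n : E7} (hq : 0 < n 3) (i : Fin 7) (ξ : E7) :
    fderiv ℝ (fieldXt k i) n ξ = fieldXtDeriv k i n ξ := by
  have hd := (contDiffAt_fieldXt (k := k) hq i).differentiableAt (by simp)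
  funext j
  rw [fderiv_component hd]
  refine fderiv_apply_eq_of_hasDerivAt (differentiableAt_pi.1 hd j) ?_
  have D : ∀ i, HasDerivAt (fun r : ℝ => (n + r • ξ) i) (ξ i) 0 := fun i => by
    simpa using ((hasDerivAt_id (0 : ℝ)).mul_const (ξ i)).const_add (n i)
  have z : n + (0 : ℝ) • ξ = n := by simp
  have hq' : (n + (0 : ℝ) • ξ) 3 ≠ 0 := by rw [z]; exact hq.ne'
  have hr : ∀ e : ℝ, HasDerivAt (fun r : ℝ => (n + r • ξ) 3 ^ e) (e * n 3 ^ (e - 1) * ξ 3) 0 := by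
    intro e
    refine ((D 3).rpow_const (p := e) (Or.inl hq')).congr_deriv ?_
    rw [z]
    ring
  have hz : HasDerivAt (fun r : ℝ => zCoeff k ((n + r • ξ) 3)) (n 3 ^ (2 * k - 2) / k * ξ 3) 0 :=
    HasDerivAt.comp (h₂ := zCoeff k) (0 : ℝ) (by rw [z]; exact hasDerivAt_zCoeff hk0 hq) (D 3)
  have c0 : ∀ a : ℝ, HasDerivAt (fun _ : ℝ => a) 0 (0 : ℝ) := hasDerivAt_const 0
  have e2 : k - 1 - 1 = k - 2 := by ring
  fin_cases i <;> fin_cases j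
  all_goals first
    | exact c0 _
    | exact D _
    | exact (D _).neg
    | exact (D _).const_mul _
    | exact hz
    | skip
  · exact ((hr (k - 1)).congr_deriv (by rw [e2]; rfl))
  · refine (((D 2).mul (hr (k - 1))).add ((D 4).const_mul (1 - k))).congr_deriv ?_
    simp only [z, e2, fieldXtDeriv, Matrix.cons_val, Fin.mk_one]
  · refine ((hr k).const_mul ((k - 1) / k)).congr_deriv ?_
    simp only [fieldXtDeriv, Matrix.cons_val, Fin.reduceFinMk]
    field_simp
  · refine (((D 5).pow 2).const_mul (1 - k)).congr_deriv ?_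
    simp only [z, fieldXtDeriv, Matrix.cons_val, Fin.reduceFinMk]
    norm_num
    ring
  · refine (((D 5).const_mul (1 - k)).mul (D 6)).congr_deriv ?_
    simp only [z, fieldXtDeriv, Matrix.cons_val, Fin.reduceFinMk]
    ring

theorem lieDerivative_lam_fieldXt {k : ℝ} (hk0 : k ≠ 0) (hk1 : k - 1 ≠ 0) {n : E7} (hq : 0 < n 3)
    (i : Fin 7) : ∃ μ, ∀ ξ, lieDerivative (fieldXt k i) (lam k) n ξ = μ * lam k n ξ := by
  refine ⟨![0, 0, 0, 0, 1 - 2 * k, k, (1 - k) * n 5] i, fun ξ => ?_⟩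
  rw [lieDerivative_lam hk0 hk1 hq, fderiv_fieldXt hk0 hq]
  obtain ⟨b0, b1, -, -, -⟩ := rpow_sub_natCast_forms (k := k) hq
  have b2 : n 3 ^ (2 * k - 2) = (n 3 * n 3 ^ (k - 2)) ^ 2 := by
    rw [← b1, ← Real.rpow_natCast, ← Real.rpow_mul hq.le]
    ring_nf
  fin_cases i <;> simp [fieldXt, fieldXtDeriv, lam, b0, b1, b2] <;> field_simp <;> ring

/-- The matrices by which the symmetries act on the coframe. -/
theorem lieDerivative_coframe_fieldXt {k : ℝ} (hk0 : k ≠ 0) (hk1 : k - 1 ≠ 0) {n : E7}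
    (hq : 0 < n 3) (hw : n 6 ≠ 0) (i : Fin 7) (j : Fin 6) {ξ : E7} (hξ : lam k n ξ = 0) :
    lieDerivative (fieldXt k i) (coframe k j) n ξ =
      ![0, 0, 0, 0, ![0, -1, 1, 0, 0, -1] j, ![1, 1, 0, 0, 0, 0] j,
        (1 - k) * n 5 * ![0, -1, 0, -1, 1, 0] j] i * coframe k j n ξ
      + (if i = 6 then (1 - k) * n 6 * ![coframe k 1 n ξ, 0,
        coframe k 3 n ξ - fibT k n * fibS n ^ 2 / 3 * coframe k 0 n ξ,
        -(fibT k n * fibS n ^ 2 / 3) * coframe k 1 n ξ,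
        coframe k 5 n ξ - fibS n ^ 2 / 3 * coframe k 2 n ξ,
        -(fibS n ^ 2 / 3) * coframe k 3 n ξ] j else 0) := by
  rw [lieDerivative_coframe hq hw, fderiv_coframe hq hw, fderiv_fieldXt hk0 hq]
  obtain ⟨b0, b1, -, -, -⟩ := rpow_sub_natCast_forms (k := k) hq
  have b2 : n 3 ^ (2 * k - 2) = (n 3 * n 3 ^ (k - 2)) ^ 2 := by
    rw [← b1, ← Real.rpow_natCast, ← Real.rpow_mul hq.le]
    ring_nf
  have u : n 3 ^ (k - 2) = fibT k n * n 6 := by rw [fibT]; field_simp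
  have v : n 5 = fibS n * n 6 := by rw [fibS]; field_simp
  simp only [lam] at hξ
  rw [b0, b1, u, v] at hξ
  have hz : ξ 4 = (n 6 + n 3 * (fibT k n * n 6) / (k - 1)) * ξ 2 - fibS n * n 6 * ξ 1
      - (n 6 * n 3 - fibS n * n 6 * n 2 + n 3 ^ 2 * (fibT k n * n 6) / k) * ξ 0 := by
    linear_combination hξ
  have hq' := hq.ne'
  fin_cases i <;> fin_cases j <;>
    simp only [coframeDeriv, coframe, fieldXt, fieldXtDeriv, eta1, eta2, fibSDeriv, fibTDeriv,
      coefEDeriv, coefZDeriv, Matrix.cons_val, Fin.zero_eta, Fin.mk_one, Fin.reduceFinMk, b0, b1,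
      b2, u, v, hz, Pi.zero_apply] <;>
    simp <;> field_simp <;> ring

theorem symmetryEquationsAt_fieldXt {k : ℝ} (hk0 : k ≠ 0) (hk1 : k - 1 ≠ 0) {n : E7}
    (hq : 0 < n 3) (hw : n 6 ≠ 0) (i : Fin 7) : SymmetryEquationsAt k (fieldXt k i) n := by
  obtain ⟨μ, hμ⟩ := lieDerivative_lam_fieldXt (k := k) hk0 hk1 hq i
  -- Only X̃₅ and X̃₆ scale the quartic. They multiply m = 1/t with weights −2 and 1, and P₀₁P₁₂
  -- with weights 0 and 1; this matches the weights −2 and 2 of P₀₂².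
  refine symmetryEquationsAt_of_coframe hk0 hk1 hq hw hμ
    (f := ![0, 0, 0, 0, -2, 2, 0] i) fun ξ hξ => ?_
  have L := fun j => lieDerivative_coframe_fieldXt hk0 hk1 hq hw i j hξ
  have hT : fibT k n ≠ 0 := div_ne_zero (Real.rpow_pos_of_pos hq _).ne' hw
  have v : n 5 = fibS n * n 6 := by rw [fibS]; field_simp
  have hq' := hq.ne'
  simp only [minorQuarticDeriv, minorQuartic, L, v]
  generalize coframe k 0 n ξ = a0
  generalize coframe k 1 n ξ = a1
  generalize coframe k 2 n ξ = a2
  generalize coframe k 3 n ξ = a3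
  generalize coframe k 4 n ξ = a4
  generalize coframe k 5 n ξ = a5
  fin_cases i <;> simp [fieldXt, fibTDeriv, v] <;> field_simp <;> ring

theorem isSymmetryOn_fieldXt {k : ℝ} (hk0 : k ≠ 0) (hk1 : k - 1 ≠ 0) {B : Set E7}
    (hq : ∀ n ∈ B, 0 < n 3) (hw : ∀ n ∈ B, n 6 ≠ 0) (i : Fin 7) :
    IsSymmetryOn k B (fieldXt k i) :=
  ⟨fun n hn => contDiffAt_fieldXt (hq n hn) i,
    fun n hn => symmetryEquationsAt_fieldXt hk0 hk1 (hq n hn) (hw n hn) i⟩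


/-! ### The local determination of the symmetries -/

/-- On a box, every symmetry is a linear combination of the vector fields `X̃_i`. -/
theorem exists_eq_sum_fieldXt_of_isBox {k : ℝ} (hk : k ∉ ({2, 2 / 3, 1 / 3, 0, 1, -1} : Set ℝ))
    {B : Set E7} (hB : IsBox B) (hq : ∀ n ∈ B, 0 < n 3) (hw : ∀ n ∈ B, n 6 ≠ 0) {X : E7 → E7}
    (hX : IsSymmetryOn k B X) :
    ∃ c : Fin 7 → ℝ, ∀ n ∈ B, X n = ∑ i, c i • fieldXt k i n := by
  have hk' := hk
  simp only [Set.mem_insert_iff, Set.mem_singleton_iff, not_or] at hk'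
  obtain ⟨-, -, -, hk0, hk1', -⟩ := hk'
  have hk1 : k - 1 ≠ 0 := sub_ne_zero.2 hk1'
  have R := fun n hn => reduced_equations hk0 hk1 hB.isOpen hq hw hX (n := n) hn
  have V := fun n hn => vertical_equations hk0 hk1 hX (n := n) hn (hq n hn) (hw n hn)
  obtain ⟨c, hc⟩ := exists_coefficients hk hB hq (hX.smooth_compA hq) hX.smooth_compB
    (fun n hn => (R n hn).1) (fun n hn => (V n hn).1.1) (fun n hn => (V n hn).1.2)
    (fun n hn => (V n hn).2.1.1) (fun n hn => (V n hn).2.1.2) (fun n hn => (R n hn).2.1)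
    (fun n hn => (R n hn).2.2.1)
  refine ⟨c, fun n hn => ?_⟩
  have hX' := hX.sub_sum (fun i => isSymmetryOn_fieldXt hk0 hk1 hq hw i) c
  have e : ∀ n j, (X - ∑ i, c i • fieldXt k i) n j = X n j - ∑ i, c i * fieldXt k i n j := by
    intro n j
    simp [Finset.sum_apply]
  -- The constants were chosen so that the difference has a = b = 0, and such a symmetry vanishes.
  have h := eq_zero_of_compA_compB_eq_zero hk hB hq hw hX' (fun n hn => ?_) (fun n hn => ?_) hn
  · have := sub_eq_zero.1 h
    rw [this]
    simp [Finset.sum_apply]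
  · have ha := (hc n hn).2
    simp only [compA] at ha ⊢
    rw [e, e, e]
    simp only [Fin.sum_univ_seven, fieldXt, Matrix.cons_val]
    have hq' := hq n hn
    field_simp at ha ⊢
    linear_combination ha
  · have hb := (hc n hn).1
    simp only [compB] at hb ⊢
    rw [e, e]
    simp only [Fin.sum_univ_seven, fieldXt, Matrix.cons_val]
    linear_combination hb


/-! ### The two charts of the twistor bundle -/

theorem proj_fieldXt (k : ℝ) (i : Fin 7) (n : E7) : proj (fieldXt k i n) = fieldX k i (proj n) := by
  funext j
  fin_cases i <;> fin_cases j <;> rfl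

theorem proj_add (a b : E7) : proj (a + b) = proj a + proj b := by
  funext j; fin_cases j <;> rfl

theorem proj_smul (c : ℝ) (a : E7) : proj (c • a) = c • proj a := by
  funext j; fin_cases j <;> rfl

theorem proj_sum_fieldXt (k : ℝ) (c : Fin 7 → ℝ) (n : E7) :
    proj (∑ i, c i • fieldXt k i n) = ∑ i, c i • fieldX k i (proj n) := by
  simp only [Fin.sum_univ_seven, proj_add, proj_smul, proj_fieldXt]

theorem continuous_proj : Continuous proj := by
  refine continuous_pi fun j => ?_
  fin_cases j <;> exact continuous_apply _

theorem transition_eq {k : ℝ} (hk0 : k ≠ 0) (hk1 : k - 1 ≠ 0) {n : E7} (hq : 0 < n 3) :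
    transition (profile k) n = ![n 0, n 1, n 2, n 3, n 4, fibS n, fibT k n] := by
  rw [transition, (profile_jet hk0 hk1 hq).2.2.1]
  rfl

theorem proj_transition (h : ℝ → ℝ) (n : E7) : proj (transition h n) = proj n := by
  funext j; fin_cases j <;> rfl

theorem hasFDerivAt_transition {k : ℝ} (hk0 : k ≠ 0) (hk1 : k - 1 ≠ 0) {n : E7} (hq : 0 < n 3)
    (hw : n 6 ≠ 0) : DifferentiableAt ℝ (transition (profile k)) n ∧ ∀ ξ,
    fderiv ℝ (transition (profile k)) n ξ =
      ![ξ 0, ξ 1, ξ 2, ξ 3, ξ 4, fibSDeriv n ξ, fibTDeriv k n ξ] := by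
  have e : transition (profile k) =ᶠ[𝓝 n]
      fun n => ![n 0, n 1, n 2, n 3, n 4, fibS n, fibT k n] := by
    have h1 : ∀ᶠ n' : E7 in 𝓝 n, 0 < n' 3 :=
      (continuous_apply 3).continuousAt.eventually_const_lt hq
    filter_upwards [h1] with n' h1
    exact transition_eq hk0 hk1 h1
  have hd : DifferentiableAt ℝ (fun n : E7 => ![n 0, n 1, n 2, n 3, n 4, fibS n, fibT k n]) n := by
    obtain ⟨dS, dT, -, -⟩ := fderiv_fib (k := k) hq hw 0
    rw [differentiableAt_pi]
    intro j
    fin_cases j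
    · exact differentiableAt_coord 0 n
    · exact differentiableAt_coord 1 n
    · exact differentiableAt_coord 2 n
    · exact differentiableAt_coord 3 n
    · exact differentiableAt_coord 4 n
    · exact dS
    · exact dT
  refine ⟨e.differentiableAt_iff.2 hd, fun ξ => ?_⟩
  obtain ⟨-, -, fS, fT⟩ := fderiv_fib (k := k) hq hw ξ
  rw [e.fderiv_eq]
  funext j
  rw [fderiv_component hd]
  fin_cases j
  · exact fderiv_coord 0 n ξ
  · exact fderiv_coord 1 n ξ
  · exact fderiv_coord 2 n ξ
  · exact fderiv_coord 3 n ξ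
  · exact fderiv_coord 4 n ξ
  · exact fS
  · exact fT

theorem proj_fderiv_transition {k : ℝ} (hk0 : k ≠ 0) (hk1 : k - 1 ≠ 0) {n : E7} (hq : 0 < n 3)
    (hw : n 6 ≠ 0) (ξ : E7) : proj (fderiv ℝ (transition (profile k)) n ξ) = proj ξ := by
  rw [(hasFDerivAt_transition hk0 hk1 hq hw).2]
  funext j; fin_cases j <;> rfl

theorem isOpen_chartPart {k : ℝ} (hk0 : k ≠ 0) (hk1 : k - 1 ≠ 0) {W : Set E7} (hW : IsOpen W) :
    IsOpen (chartPart (profile k) W) := by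
  rw [isOpen_iff_mem_nhds]
  rintro n ⟨hq, hw, hn⟩
  have h1 : ∀ᶠ n' : E7 in 𝓝 n, 0 < n' 3 := (continuous_apply 3).continuousAt.eventually_const_lt hq
  have h2 : ∀ᶠ n' : E7 in 𝓝 n, n' 6 ≠ 0 := (continuous_apply 6).continuousAt.eventually_ne hw
  have h3 := (hasFDerivAt_transition hk0 hk1 hq hw).1.continuousAt.eventually (hW.mem_nhds hn)
  filter_upwards [h1, h2, h3] with n' h1 h2 h3
  exact ⟨h1, h2, h3⟩

/-- The inverse of `transition`. -/
def chartInv (k : ℝ) (u : E7) : E7 :=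
  ![u 0, u 1, u 2, u 3, u 4, u 5 * (u 3 ^ (k - 2) / u 6), u 3 ^ (k - 2) / u 6]

theorem proj_chartInv (k : ℝ) (u : E7) : proj (chartInv k u) = proj u := by
  funext j; fin_cases j <;> rfl

theorem transition_chartInv {k : ℝ} (hk0 : k ≠ 0) (hk1 : k - 1 ≠ 0) {u : E7} (hq : 0 < u 3)
    (ht : u 6 ≠ 0) : transition (profile k) (chartInv k u) = u := by
  have hu : u 3 ^ (k - 2) ≠ 0 := (Real.rpow_pos_of_pos hq _).ne'
  rw [transition_eq hk0 hk1 (by exact hq)]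
  funext j
  fin_cases j
  · rfl
  · rfl
  · rfl
  · rfl
  · rfl
  · change u 5 * (u 3 ^ (k - 2) / u 6) / (u 3 ^ (k - 2) / u 6) = u 5
    field_simp
  · change u 3 ^ (k - 2) / (u 3 ^ (k - 2) / u 6) = u 6
    field_simp

theorem chartInv_mem {k : ℝ} (hk0 : k ≠ 0) (hk1 : k - 1 ≠ 0) {W : Set E7} {u : E7} (hu : u ∈ W)
    (hq : 0 < u 3) (ht : u 6 ≠ 0) : chartInv k u ∈ chartPart (profile k) W :=
  ⟨hq, div_ne_zero (Real.rpow_pos_of_pos hq _).ne' ht, by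
    rwa [transition_chartInv hk0 hk1 hq ht]⟩

theorem continuousAt_chartInv {k : ℝ} {u : E7} (hq : 0 < u 3) (ht : u 6 ≠ 0) :
    ContinuousAt (chartInv k) u := by
  have c : ∀ j, ContinuousAt (fun u : E7 => u j) u := fun j => (continuous_apply j).continuousAt
  have h : ContinuousAt (fun u : E7 => u 3 ^ (k - 2) / u 6) u :=
    ((c 3).rpow_const (Or.inl hq.ne')).div (c 6) ht
  refine continuousAt_pi.2 fun j => ?_
  fin_cases j
  · exact c 0
  · exact c 1
  · exact c 2
  · exact c 3
  · exact c 4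
  · exact (c 5).mul h
  · exact h

theorem chartPart_nonempty {k : ℝ} (hk0 : k ≠ 0) (hk1 : k - 1 ≠ 0) {W : Set E7} (hW : IsOpen W)
    (hne : W.Nonempty) (hW' : W ⊆ twistorDomain) : (chartPart (profile k) W).Nonempty := by
  obtain ⟨u, hu⟩ := hne
  by_cases ht : u 6 = 0
  · obtain ⟨d, hd, h⟩ := exists_update_mem hW hu 6
    have hm := h d (by rw [abs_of_pos hd])
    exact ⟨_, chartInv_mem hk0 hk1 hm (hW' hm) (by simp [ht, hd.ne'])⟩
  · exact ⟨_, chartInv_mem hk0 hk1 hu (hW' hu) ht⟩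

/-! ### Linear independence -/

/-- Varying x in the ∂_x-component detects c 4, the ∂_q-component then gives c 5, and varying z in
the ∂_y-component gives c 6. The other coefficients can then be read off. -/
theorem coefficients_eq_zero {k : ℝ} (hk1 : k - 1 ≠ 0) {D : Set E7} (hD : IsOpen D)
    (hne : D.Nonempty) (hq : ∀ n ∈ D, 0 < n 3) {c : Fin 7 → ℝ}
    (h : ∀ n ∈ D, ∑ i, c i • fieldX k i (proj n) = 0) : c = 0 := by
  obtain ⟨n, hn⟩ := hne
  have H : ∀ n ∈ D, (c 0 + c 4 * n 0 + c 6 * n 3 ^ (k - 1) = 0) ∧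
      (c 1 + c 3 * n 0 + c 5 * n 1 + c 6 * (n 2 * n 3 ^ (k - 1) + (1 - k) * n 4) = 0) ∧
      (c 3 - c 4 * n 2 + c 5 * n 2 + c 6 * ((k - 1) / k * n 3 ^ k) = 0) ∧
      (-2 * c 4 + c 5) * n 3 = 0 ∧
      (c 2 + c 4 * ((1 - 2 * k) * n 4) + c 5 * (k * n 4) + c 6 * zCoeff k (n 3) = 0) := by
    intro n hn
    have e := h n hn
    have e0 := congrFun e 0
    have e1 := congrFun e 1
    have e2 := congrFun e 2
    have e3 := congrFun e 3
    have e4 := congrFun e 4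
    simp only [Fin.sum_univ_seven, fieldX, proj, Pi.add_apply, Pi.smul_apply, smul_eq_mul,
      Matrix.cons_val, Pi.zero_apply] at e0 e1 e2 e3 e4
    refine ⟨?_, ?_, ?_, ?_, ?_⟩
    · linear_combination e0
    · linear_combination e1
    · linear_combination e2
    · linear_combination e3
    · linear_combination e4
  obtain ⟨a0, a1, a2, a3, a4⟩ := H n hn
  obtain ⟨d, hd, hm⟩ := exists_update_mem hD hn 0
  have b0 := (H _ (hm d (by rw [abs_of_pos hd]))).1
  simp only [Function.update_self, Function.update_of_ne (show (3 : Fin 7) ≠ 0 by decide)] at b0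
  have c4 : c 4 = 0 := by
    have : c 4 * d = 0 := by linear_combination b0 - a0
    exact (mul_eq_zero.1 this).resolve_right hd.ne'
  have c5 : c 5 = 0 := by
    have := (mul_eq_zero.1 a3).resolve_right (hq n hn).ne'
    linear_combination this + 2 * c4
  obtain ⟨d, hd, hm⟩ := exists_update_mem hD hn 4
  have b1 := (H _ (hm d (by rw [abs_of_pos hd]))).2.1
  simp only [Function.update_self, Function.update_of_ne (show (3 : Fin 7) ≠ 4 by decide),
    Function.update_of_ne (show (0 : Fin 7) ≠ 4 by decide),
    Function.update_of_ne (show (1 : Fin 7) ≠ 4 by decide),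
    Function.update_of_ne (show (2 : Fin 7) ≠ 4 by decide)] at b1
  have c6 : c 6 = 0 := by
    have : c 6 * ((k - 1) * d) = 0 := by linear_combination a1 - b1
    exact (mul_eq_zero.1 this).resolve_right (mul_ne_zero hk1 hd.ne')
  rw [c4, c6] at a0
  rw [c4, c5, c6] at a2 a4
  have c3 : c 3 = 0 := by linear_combination a2
  rw [c3, c5, c6] at a1
  funext i
  fin_cases i
  · simpa using a0
  · simpa using a1
  · simpa using a4
  · exact c3
  · exact c4
  · exact c5
  · exact c6

theorem coefficients_eq {k : ℝ} (hk1 : k - 1 ≠ 0) {D : Set E7} (hD : IsOpen D)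
    (hne : D.Nonempty) (hq : ∀ n ∈ D, 0 < n 3) {c c' : Fin 7 → ℝ}
    (h : ∀ n ∈ D, ∑ i, c i • fieldX k i (proj n) = ∑ i, c' i • fieldX k i (proj n)) : c = c' := by
  refine sub_eq_zero.1 (coefficients_eq_zero (k := k) hk1 hD hne hq fun n hn => ?_)
  have := h n hn
  simp only [Pi.sub_apply, sub_smul, Finset.sum_sub_distrib, this, sub_self]


/-! ### From local to global -/

/-- Balls of the supremum norm are cubes. -/
theorem isBox_ball (n : E7) {ε : ℝ} (hε : 0 < ε) : IsBox (Metric.ball n ε) where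
  isOpen := Metric.isOpen_ball
  convex := convex_ball n ε
  nonempty := ⟨n, Metric.mem_ball_self hε⟩
  update_mem := by
    intro m hm n' hn' i
    rw [Metric.mem_ball, dist_pi_lt_iff hε] at *
    intro j
    rcases eq_or_ne j i with rfl | hj
    · simpa using hn' j
    · simpa [hj] using hm j

theorem eq_of_isPreconnected {α Y : Type*} [TopologicalSpace α] {S : Set α}
    (hS : IsPreconnected S) {f : α → Y} (hf : ∀ x ∈ S, ∀ᶠ y in 𝓝 x, f y = f x) {x y : α}
    (hx : x ∈ S) (hy : y ∈ S) : f x = f y := by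
  let _ : TopologicalSpace Y := ⊥
  have : DiscreteTopology Y := ⟨rfl⟩
  refine hS.constant (fun z hz => ContinuousAt.continuousWithinAt ?_) hx hy
  exact continuousAt_const.congr ((hf z hz).mono fun _ h => h.symm)

/-- Near `u`, the components of `Y` along `M` are those of a combination of the `X_i`. -/
def AgreesNear (k : ℝ) (Y : E7 → E7) (c : Fin 7 → ℝ) (u : E7) : Prop :=
  ∀ᶠ u' in 𝓝 u, proj (Y u') = ∑ i, c i • fieldX k i (proj u')

theorem AgreesNear.eq {k : ℝ} (hk1 : k - 1 ≠ 0) {Y : E7 → E7} {c c' : Fin 7 → ℝ} {u : E7}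
    (hq : 0 < u 3) (h : AgreesNear k Y c u) (h' : AgreesNear k Y c' u) : c = c' := by
  have h1 : ∀ᶠ n' : E7 in 𝓝 u, 0 < n' 3 := (continuous_apply 3).continuousAt.eventually_const_lt hq
  obtain ⟨D, hD, hDo, hu⟩ := eventually_nhds_iff.1 ((h.and h').and h1)
  exact coefficients_eq hk1 hDo ⟨u, hu⟩ (fun n hn => (hD n hn).2) fun n hn =>
    (hD n hn).1.1.symm.trans (hD n hn).1.2

/-- The local coefficients are unique, hence locally constant, hence constant on a preconnected set.
-/
theorem exists_agreesNear_of_isPreconnected {k : ℝ} (hk1 : k - 1 ≠ 0) {Y : E7 → E7} {S : Set E7}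
    (hS : IsPreconnected S) (hSo : IsOpen S) (hq : ∀ u ∈ S, 0 < u 3)
    (h : ∀ u ∈ S, ∃ c, AgreesNear k Y c u) : ∃ c, ∀ u ∈ S, AgreesNear k Y c u := by
  rcases S.eq_empty_or_nonempty with rfl | ⟨u₀, hu₀⟩
  · exact ⟨0, by simp⟩
  choose! c hc using h
  refine ⟨c u₀, fun u hu => ?_⟩
  rw [eq_of_isPreconnected hS (f := c) (fun x hx => ?_) hu₀ hu]
  · exact hc u hu
  · filter_upwards [eventually_eventually_nhds.2 (hc x hx), hSo.mem_nhds hx] with y hy hyS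
    exact (hc y hyS).eq hk1 (hq y hyS) hy

theorem continuousAt_sum_fieldX {k : ℝ} (c : Fin 7 → ℝ) {u : E7} (hq : 0 < u 3) :
    ContinuousAt (fun u : E7 => ∑ i, c i • fieldX k i (proj u)) u := by
  have : (fun u : E7 => ∑ i, c i • fieldX k i (proj u)) =
      fun u => proj (∑ i, c i • fieldXt k i u) := by
    funext u; rw [proj_sum_fieldXt]
  rw [this]
  refine continuous_proj.continuousAt.comp (tendsto_finsetSum _ fun i _ => ?_)
  exact ((contDiffAt_fieldXt hq i).continuousAt).const_smul (c i)

/-- The local combinations continue across the hypersurface `t = 0`. -/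
theorem exists_agreesNear_of_eq_zero {k : ℝ} (hk1 : k - 1 ≠ 0) {Y : E7 → E7} {u : E7} {ε : ℝ}
    (hε : 0 < ε) (hq : ∀ u' ∈ Metric.ball u ε, 0 < u' 3) (ht : u 6 = 0)
    (hY : ∀ u' ∈ Metric.ball u ε, ContinuousAt Y u')
    (h : ∀ u' ∈ Metric.ball u ε, u' 6 ≠ 0 → ∃ c, AgreesNear k Y c u') :
    ∃ c, AgreesNear k Y c u := by
  -- Each of the half-balls t > 0 and t < 0 is convex and carries a single coefficient vector; by
  -- continuity of Y the identity persists on the boundary t = 0.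
  have half : ∀ σ : ℝ, σ ≠ 0 → ∃ c : Fin 7 → ℝ, ∀ u' ∈ Metric.ball u ε, 0 ≤ σ * u' 6 →
      proj (Y u') = ∑ i, c i • fieldX k i (proj u') := by
    intro σ hσ
    have hlin : IsLinearMap ℝ fun u : E7 => σ * u 6 := by
      constructor
      · intro a b; simp [mul_add]
      · intro a b; simp; ring
    have hconv : Convex ℝ (Metric.ball u ε ∩ {u | 0 < σ * u 6}) :=
      (convex_ball u ε).inter (convex_halfSpace_gt hlin 0)
    have hopen : IsOpen (Metric.ball u ε ∩ {u : E7 | 0 < σ * u 6}) :=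
      Metric.isOpen_ball.inter
        (isOpen_lt continuous_const (continuous_const.mul (continuous_apply 6)))
    obtain ⟨c, hc⟩ := exists_agreesNear_of_isPreconnected hk1 (Y := Y) hconv.isPreconnected hopen
      (fun u' hu' => hq u' hu'.1)
      (fun u' hu' => h u' hu'.1 (right_ne_zero_of_mul (ne_of_gt hu'.2)))
    refine ⟨c, fun u' hu' h0 => ?_⟩
    rcases h0.eq_or_lt with h0 | h0
    · have h6 : u' 6 = 0 := (mul_eq_zero.1 h0.symm).resolve_left hσ
      have hcont : ContinuousAt (fun u => proj (Y u) - ∑ i, c i • fieldX k i (proj u)) u' :=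
        (continuous_proj.continuousAt.comp (hY u' hu')).sub (continuousAt_sum_fieldX c (hq u' hu'))
      -- For r > 0 the curve lies in the half-ball, because u' 6 = 0 and σ · σr = σ²r > 0.
      set γ : ℝ → E7 := fun r => Function.update u' 6 (u' 6 + σ * r) with hγ
      have hγc : Continuous γ :=
        continuous_const.update 6 (continuous_const.add (continuous_const.mul continuous_id))
      have hγ0 : γ 0 = u' := by simp [hγ]
      have hlim : Filter.Tendsto (fun r => proj (Y (γ r)) - ∑ i, c i • fieldX k i (proj (γ r)))
          (𝓝[>] 0) (𝓝 (proj (Y u') - ∑ i, c i • fieldX k i (proj u'))) := by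
        refine Filter.Tendsto.mono_left ?_ nhdsWithin_le_nhds
        have : Filter.Tendsto γ (𝓝 0) (𝓝 u') := hγ0 ▸ hγc.continuousAt
        exact hcont.tendsto.comp this
      have hzero : ∀ᶠ r in 𝓝[>] (0 : ℝ),
          proj (Y (γ r)) - ∑ i, c i • fieldX k i (proj (γ r)) = 0 := by
        have hb : ∀ᶠ r in 𝓝[>] (0 : ℝ), γ r ∈ Metric.ball u ε :=
          nhdsWithin_le_nhds (hγc.continuousAt.eventually
            (Metric.isOpen_ball.mem_nhds (by rw [hγ0]; exact hu')))
        filter_upwards [hb, self_mem_nhdsWithin] with r hr hr0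
        have hr0' : 0 < r := hr0
        have : AgreesNear k Y c (γ r) := hc _ ⟨hr, by
          simp only [Set.mem_ofPred_eq, hγ, Function.update_self, h6, zero_add]
          have : σ * (σ * r) = σ ^ 2 * r := by ring
          rw [this]
          positivity⟩
        exact sub_eq_zero.2 this.self_of_nhds
      exact sub_eq_zero.1 (tendsto_nhds_unique hlim
        (tendsto_const_nhds.congr' (hzero.mono fun _ h => h.symm)))
    · exact (hc u' ⟨hu', h0⟩).self_of_nhds
  obtain ⟨c, hc⟩ := half 1 one_ne_zero
  obtain ⟨c', hc'⟩ := half (-1) (by norm_num)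
  -- On t = 0 both combinations equal the projection of Y. Neither involves the fibre coordinates,
  -- so they agree over the whole ball, and independence applies.
  have key : c = c' := by
    refine coefficients_eq (k := k) hk1 Metric.isOpen_ball ⟨u, Metric.mem_ball_self hε⟩ hq
      fun n hn => ?_
    have hm : Function.update n 6 0 ∈ Metric.ball u ε := by
      have := (isBox_ball u hε).update_mem n hn u (Metric.mem_ball_self hε) 6
      rwa [ht] at this
    have hp : proj (Function.update n 6 0) = proj n := by
      funext j; fin_cases j <;> rfl
    have e := (hc _ hm (by simp)).symm.trans (hc' _ hm (by simp))
    rwa [hp] at e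
  refine ⟨c, Filter.eventually_of_mem (Metric.ball_mem_nhds u hε) fun u' hu' => ?_⟩
  rcases le_total 0 (u' 6) with h0 | h0
  · exact hc u' hu' (by linarith)
  · rw [key]
    exact hc' u' hu' (by linarith)

theorem symmetryAlgebra_isSymmetryOn {k : ℝ} {W : Set E7} {X : E7 → E7}
    (hX : X ∈ symmetryAlgebra k W) : IsSymmetryOn k (chartPart (profile k) W) X :=
  ⟨hX.2.1, hX.2.2.2⟩

/-- Every symmetry on a connected open set is a combination of the vector fields `X̃_i`. -/
theorem exists_eq_sum_fieldXt {k : ℝ} (hk : k ∉ ({2, 2 / 3, 1 / 3, 0, 1, -1} : Set ℝ))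
    {W : Set E7} (hW : IsOpen W) (hc : IsConnected W) (hW' : W ⊆ twistorDomain) {X : E7 → E7}
    (hX : X ∈ symmetryAlgebra k W) :
    ∃ c : Fin 7 → ℝ, ∀ n ∈ chartPart (profile k) W, X n = ∑ i, c i • fieldXt k i n := by
  have hk' := hk
  simp only [Set.mem_insert_iff, Set.mem_singleton_iff, not_or] at hk'
  obtain ⟨-, -, -, hk0, hk1', -⟩ := hk'
  have hk1 : k - 1 ≠ 0 := sub_ne_zero.2 hk1'
  have hS := symmetryAlgebra_isSymmetryOn hX
  have hΩ := isOpen_chartPart hk0 hk1 hW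
  obtain ⟨-, -, ⟨Y, hY, hXY⟩, -⟩ := hX
  -- The comparison is carried out for the components of Y along M. The chart part may be
  -- disconnected (w > 0 and w < 0), but Y lives on all of the connected set W.
  have hYp : ∀ n ∈ chartPart (profile k) W, proj (Y (transition (profile k) n)) = proj (X n) := by
    intro n hn
    rw [← hXY n hn, proj_fderiv_transition hk0 hk1 hn.1 hn.2.1]
  have local_eq : ∀ n ∈ chartPart (profile k) W, ∃ c : Fin 7 → ℝ, ∀ᶠ n' in 𝓝 n,
      n' ∈ chartPart (profile k) W ∧ X n' = ∑ i, c i • fieldXt k i n' := by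
    intro n hn
    obtain ⟨ε, hε, hb⟩ := Metric.isOpen_iff.1 hΩ n hn
    obtain ⟨c, h⟩ := exists_eq_sum_fieldXt_of_isBox hk (isBox_ball n hε)
      (fun n hn => (hb hn).1) (fun n hn => (hb hn).2.1) (hS.mono hb)
    exact ⟨c, Filter.eventually_of_mem (Metric.ball_mem_nhds n hε) fun n' hn' =>
      ⟨hb hn', h n' hn'⟩⟩
  have agrees : ∀ u ∈ W, u 6 ≠ 0 → ∀ c : Fin 7 → ℝ, (∀ᶠ n' in 𝓝 (chartInv k u),
      n' ∈ chartPart (profile k) W ∧ X n' = ∑ i, c i • fieldXt k i n') → AgreesNear k Y c u := by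
    intro u hu ht c h
    have h0 := (continuousAt_chartInv (hW' hu) ht).eventually h
    filter_upwards [h0, hW.mem_nhds hu, (continuous_apply 6).continuousAt.eventually_ne ht]
      with u' h1 h2 h3
    have := hYp _ h1.1
    rwa [transition_chartInv hk0 hk1 (hW' h2) h3, h1.2, proj_sum_fieldXt, proj_chartInv] at this
  have near : ∀ u ∈ W, u 6 ≠ 0 → ∃ c, AgreesNear k Y c u := by
    intro u hu ht
    obtain ⟨c, h⟩ := local_eq _ (chartInv_mem hk0 hk1 hu (hW' hu) ht)
    exact ⟨c, agrees u hu ht c h⟩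
  obtain ⟨c, hcW⟩ := exists_agreesNear_of_isPreconnected hk1 (Y := Y) hc.isPreconnected hW
    (fun u hu => hW' hu) (fun u hu => by
      by_cases ht : u 6 = 0
      · obtain ⟨ε, hε, hb⟩ := Metric.isOpen_iff.1 hW u hu
        exact exists_agreesNear_of_eq_zero hk1 hε (fun u' hu' => hW' (hb hu')) ht
          (fun u' hu' => (hY.continuousOn.continuousAt (hW.mem_nhds (hb hu'))))
          fun u' hu' => near u' (hb hu')
      · exact near u hu ht)
  refine ⟨c, fun n hn => ?_⟩
  obtain ⟨c', h'⟩ := local_eq n hn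
  have hu := hn.2.2
  have hq : 0 < n 3 := hn.1
  have hn6 := hn.2.1
  have hr : n 3 ^ (k - 2) ≠ 0 := (Real.rpow_pos_of_pos hq _).ne'
  have ht : transition (profile k) n 6 ≠ 0 := by
    rw [transition_eq hk0 hk1 hq]
    exact div_ne_zero hr hn6
  have hinv : chartInv k (transition (profile k) n) = n := by
    rw [transition_eq hk0 hk1 hq]
    funext j
    fin_cases j
    · rfl
    · rfl
    · rfl
    · rfl
    · rfl
    · change n 5 / n 6 * (n 3 ^ (k - 2) / (n 3 ^ (k - 2) / n 6)) = n 5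
      field_simp
    · change n 3 ^ (k - 2) / (n 3 ^ (k - 2) / n 6) = n 6
      field_simp
  -- Locally X is a combination of the X̃ᵢ including its fibre components. The coefficients of this
  -- combination are those of the projected field, hence the global ones.
  have h2 := agrees _ hu ht c' (by rwa [hinv])
  rw [(hcW _ hu).eq hk1 (hW' hu) h2]
  exact h'.self_of_nhds.2

/-! ### The vector fields `X̃_i` on the twistor bundle -/

/-- The expression of `X̃_i` in the coordinates `(x, y, p, q, z, s, t)`. -/
def fieldXtGlobal (k : ℝ) (i : Fin 7) (u : E7) : E7 :=
  ![fieldX k i (proj u) 0, fieldX k i (proj u) 1, fieldX k i (proj u) 2, fieldX k i (proj u) 3,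
    fieldX k i (proj u) 4, ![0, 0, 0, 0, -u 5, 0, 0] i,
    ![0, 0, 0, 0, 2 * u 6, -u 6, (k - 1) * u 5 * u 3 ^ (k - 2)] i]

theorem contDiffAt_fieldXtGlobal {k : ℝ} {u : E7} (hq : 0 < u 3) (i : Fin 7) :
    ContDiffAt ℝ ∞ (fieldXtGlobal k i) u := by
  have h := contDiffAt_pi.1 (contDiffAt_fieldXt (k := k) hq i)
  have e : ∀ u : E7, proj (fieldXt k i u) = fieldX k i (proj u) := fun u => proj_fieldXt k i u
  have c : ∀ j : Fin 7, ContDiffAt ℝ ∞ (fun n : E7 => n j) u := fun j => contDiffAt_apply ℝ ℝ j u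
  have r : ContDiffAt ℝ ∞ (fun n : E7 => n 3 ^ (k - 2)) u :=
    ContDiffAt.comp (g := fun q : ℝ => q ^ (k - 2)) u
      (Real.contDiffAt_rpow_const_of_ne hq.ne') (c 3)
  rw [contDiffAt_pi]
  intro j
  simp only [fieldXtGlobal, ← e]
  fin_cases j
  · exact h 0
  · exact h 1
  · exact h 2
  · exact h 3
  · exact h 4
  · fin_cases i <;> simp <;> fun_prop
  · fin_cases i <;> simp <;> fun_prop

/-- In the coordinates (s, t) the fibre components of X̃ᵢ have no pole at t = 0. This provides the
smooth extension over the hypersurface missed by the (v, w)-chart. -/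
theorem fderiv_transition_fieldXt {k : ℝ} (hk0 : k ≠ 0) (hk1 : k - 1 ≠ 0) {n : E7} (hq : 0 < n 3)
    (hw : n 6 ≠ 0) (i : Fin 7) : fderiv ℝ (transition (profile k)) n (fieldXt k i n) =
      fieldXtGlobal k i (transition (profile k) n) := by
  rw [(hasFDerivAt_transition hk0 hk1 hq hw).2, fieldXtGlobal, proj_transition, ← proj_fieldXt,
    transition_eq hk0 hk1 hq]
  have hq' := hq.ne'
  have e5 : fibSDeriv n (fieldXt k i n) = ![0, 0, 0, 0, -fibS n, 0, 0] i := by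
    fin_cases i <;> simp [fieldXt, fibSDeriv, fibS] <;> field_simp <;> ring
  have e6 : fibTDeriv k n (fieldXt k i n) =
      ![0, 0, 0, 0, 2 * fibT k n, -fibT k n, (k - 1) * fibS n * n 3 ^ (k - 2)] i := by
    fin_cases i <;> simp [fieldXt, fibTDeriv, fibT, fibS] <;> field_simp <;> ring
  rw [e5, e6]
  rfl

theorem indicator_fieldXt_mem {k : ℝ} (hk0 : k ≠ 0) (hk1 : k - 1 ≠ 0) {W : Set E7} (hW : IsOpen W)
    (hW' : W ⊆ twistorDomain) (i : Fin 7) :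
    (chartPart (profile k) W).indicator (fieldXt k i) ∈ symmetryAlgebra k W := by
  have hΩ := isOpen_chartPart hk0 hk1 hW
  have e : ∀ n ∈ chartPart (profile k) W,
      (chartPart (profile k) W).indicator (fieldXt k i) =ᶠ[𝓝 n] fieldXt k i := fun n hn =>
    Filter.eventuallyEq_of_mem (hΩ.mem_nhds hn) fun m hm => Set.indicator_of_mem hm _
  refine ⟨fun n hn => Set.indicator_of_notMem hn _, fun n hn =>
    (contDiffAt_fieldXt hn.1 i).congr_of_eventuallyEq (e n hn),
    ⟨fieldXtGlobal k i, fun u hu => (contDiffAt_fieldXtGlobal (hW' hu) i).contDiffWithinAt,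
      fun n hn => ?_⟩, fun n hn => ?_⟩
  · rw [Set.indicator_of_mem hn, fderiv_transition_fieldXt hk0 hk1 hn.1 hn.2.1]
  · have h := symmetryEquationsAt_fieldXt (k := k) hk0 hk1 hn.1 hn.2.1 i
    have hL : ∀ F : E7 → E7 → ℝ, lieDerivative ((chartPart (profile k) W).indicator (fieldXt k i))
        F n = lieDerivative (fieldXt k i) F n := by
      intro F
      funext ξ
      rw [lieDerivative, lieDerivative, (e n hn).fderiv_eq, Set.indicator_of_mem hn]
    simpa only [SymmetryEquationsAt, hL] using h

theorem symmetryAlgebra_eq_span {k : ℝ} (hk : k ∉ ({2, 2 / 3, 1 / 3, 0, 1, -1} : Set ℝ))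
    {W : Set E7} (hW : IsOpen W) (hc : IsConnected W) (hW' : W ⊆ twistorDomain) :
    symmetryAlgebra k W = Submodule.span ℝ
      (Set.range fun i : Fin 7 => (chartPart (profile k) W).indicator (fieldXt k i)) := by
  have hk' := hk
  simp only [Set.mem_insert_iff, Set.mem_singleton_iff, not_or] at hk'
  obtain ⟨-, -, -, hk0, hk1', -⟩ := hk'
  have hk1 : k - 1 ≠ 0 := sub_ne_zero.2 hk1'
  refine le_antisymm (fun X hX => ?_) (Submodule.span_le.2 ?_)
  · obtain ⟨c, h⟩ := exists_eq_sum_fieldXt hk hW hc hW' hX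
    have : X = ∑ i, c i • (chartPart (profile k) W).indicator (fieldXt k i) := by
      funext n
      by_cases hn : n ∈ chartPart (profile k) W
      · rw [h n hn, Finset.sum_apply]
        simp only [Pi.smul_apply, Set.indicator_of_mem hn]
      · rw [hX.1 n hn, Finset.sum_apply]
        simp only [Pi.smul_apply, Set.indicator_of_notMem hn, smul_zero, Finset.sum_const_zero]
    rw [this]
    exact Submodule.sum_mem _ fun i _ =>
      Submodule.smul_mem _ _ (Submodule.subset_span (Set.mem_range_self i))
  · rintro _ ⟨i, rfl⟩
    exact indicator_fieldXt_mem hk0 hk1 hW hW' i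

theorem linearIndependent_fieldXt {k : ℝ} (hk0 : k ≠ 0) (hk1 : k - 1 ≠ 0) {W : Set E7}
    (hW : IsOpen W) (hne : W.Nonempty) (hW' : W ⊆ twistorDomain) :
    LinearIndependent ℝ fun i : Fin 7 => (chartPart (profile k) W).indicator (fieldXt k i) := by
  rw [Fintype.linearIndependent_iff]
  intro c h
  refine congrFun (coefficients_eq_zero (k := k) hk1 (isOpen_chartPart hk0 hk1 hW)
    (chartPart_nonempty hk0 hk1 hW hne hW') (fun n hn => hn.1) fun n hn => ?_)
  have := congrFun h n
  rw [Finset.sum_apply] at this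
  simp only [Pi.smul_apply, Set.indicator_of_mem hn] at this
  rw [← proj_sum_fieldXt, this]
  funext j; fin_cases j <;> rfl


/-! ### Symmetries of the distribution -/

theorem mem_distribution_iff {h : ℝ → ℝ} {m v : E5} :
    v ∈ distribution h m ↔ v 1 = m 2 * v 0 ∧ v 2 = m 3 * v 0 ∧ v 4 = h (m 3) * v 0 := by
  rw [distribution, Submodule.mem_span_pair]
  constructor
  · rintro ⟨a, b, rfl⟩
    simp [xi1, xi2, mul_comm]
  · rintro ⟨h1, h2, h4⟩
    refine ⟨v 0, v 3, ?_⟩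
    funext j
    fin_cases j
    · simp [xi1, xi2]
    · simp [xi1, xi2, h1, mul_comm]
    · simp [xi1, xi2, h2, mul_comm]
    · simp [xi1, xi2]
    · simp [xi1, xi2, h4, mul_comm]

theorem isOpen_base : IsOpen base := isOpen_lt continuous_const (continuous_apply 3)

/-- The projection to `M` in coordinates, as a linear map. -/
def projL : E7 →L[ℝ] E5 :=
  LinearMap.toContinuousLinearMap
    { toFun := proj, map_add' := proj_add, map_smul' := proj_smul }

theorem projL_apply (n : E7) : projL n = proj n := rfl

/-- The zero section of the projection to `M`. -/
def liftL : E5 →L[ℝ] E7 :=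
  LinearMap.toContinuousLinearMap
    { toFun := fun m => ![m 0, m 1, m 2, m 3, m 4, 0, 0]
      map_add' := fun a b => by funext j; fin_cases j <;> simp
      map_smul' := fun a b => by funext j; fin_cases j <;> simp }

theorem liftL_apply (m : E5) : liftL m = ![m 0, m 1, m 2, m 3, m 4, 0, 0] := rfl

theorem proj_liftL (m : E5) : proj (liftL m) = m := by
  funext j; fin_cases j <;> rfl

/-- The horizontal lift of a vector field on `M` in coordinates. -/
def liftField (X : E5 → E5) (n : E7) : E7 := liftL (X (proj n))

/-- Fields on M are lifted with zero fibre components so that the formulas for η₁, η₂, η₃ and the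
solution of the system for a and b apply to them unchanged. -/
theorem hasFDerivAt_liftField {X : E5 → E5} {n : E7} (hX : DifferentiableAt ℝ X (proj n)) :
    DifferentiableAt ℝ (liftField X) n ∧
    ∀ ξ, fderiv ℝ (liftField X) n ξ = liftL (fderiv ℝ X (proj n) (proj ξ)) := by
  have h : HasFDerivAt (liftField X) (liftL.comp ((fderiv ℝ X (proj n)).comp projL)) n :=
    liftL.hasFDerivAt.comp n (hX.hasFDerivAt.comp n projL.hasFDerivAt)
  exact ⟨h.differentiableAt, fun ξ => by rw [h.fderiv]; rfl⟩

theorem smoothOn_liftField {X : E5 → E5} (hX : ∀ m ∈ base, ContDiffAt ℝ ∞ X m) (i : Fin 7) :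
    SmoothOn twistorDomain fun n => liftField X n i := by
  intro n hn
  have : ContDiffAt ℝ ∞ (liftField X) n :=
    liftL.contDiff.contDiffAt.comp n ((hX (proj n) hn).comp n projL.contDiff.contDiffAt)
  exact contDiffAt_pi.1 this i

theorem fderiv_xi1 {k : ℝ} (hk0 : k ≠ 0) (hk1 : k - 1 ≠ 0) {m : E5} (hq : 0 < m 3) (ζ : E5) :
    DifferentiableAt ℝ (xi1 (profile k)) m ∧
    fderiv ℝ (xi1 (profile k)) m ζ = ![0, ζ 2, ζ 3, 0, m 3 ^ (k - 1) / (k - 1) * ζ 3] := by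
  have hpr : ∀ i : Fin 5, HasFDerivAt (fun m : E5 => m i)
      (ContinuousLinearMap.proj (R := ℝ) (φ := fun _ : Fin 5 => ℝ) i) m :=
    fun i => hasFDerivAt_apply i m
  have hφ : HasDerivAt (profile k) (m 3 ^ (k - 1) / (k - 1)) (m 3) := by
    refine ((Real.hasDerivAt_rpow_const (p := k) (Or.inl hq.ne')).div_const
      (k * (k - 1))).congr_deriv ?_
    field_simp
  have h1 : HasFDerivAt (xi1 (profile k)) (ContinuousLinearMap.pi
      ![0, ContinuousLinearMap.proj 2, ContinuousLinearMap.proj 3, 0,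
        (m 3 ^ (k - 1) / (k - 1)) •
          (ContinuousLinearMap.proj (R := ℝ) (φ := fun _ : Fin 5 => ℝ) 3)]) m := by
    rw [hasFDerivAt_pi']
    intro i
    fin_cases i
    · simpa [xi1] using hasFDerivAt_const (1 : ℝ) m
    · simpa [xi1] using hpr 2
    · simpa [xi1] using hpr 3
    · simpa [xi1] using hasFDerivAt_const (0 : ℝ) m
    · exact hφ.comp_hasFDerivAt m (hpr 3)
  refine ⟨h1.differentiableAt, ?_⟩
  rw [h1.fderiv]
  funext i
  fin_cases i <;> simp

/-- The equations for a symmetry of the distribution in terms of `η₁(X)`, `η₂(X)`, `η₃(X)`. -/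
theorem distributionSymmetries_equations {k : ℝ} (hk0 : k ≠ 0) (hk1 : k - 1 ≠ 0) {X : E5 → E5}
    (hX : X ∈ distributionSymmetries (profile k)) {n : E7} (hn : n ∈ twistorDomain) :
    pd 3 (compB (liftField X)) n = 0 ∧ pdXi k (compA k (liftField X)) n = 0 ∧
    pd 3 (compA k (liftField X)) n = -(n 3 ^ (k - 2) * pdXi k (compB (liftField X)) n) ∧
    compC (liftField X) n = pdXi k (compB (liftField X)) n ∧
    liftField X n 0 = -pd 3 (compC (liftField X)) n ∧
    liftField X n 3 = pdXi k (compC (liftField X)) n := by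
  obtain ⟨-, hs, hb⟩ := hX
  have hm : proj n ∈ base := hn
  have hq : 0 < n 3 := hn
  have hd := (hs _ hm).differentiableAt (by simp)
  obtain ⟨hL, hLd⟩ := hasFDerivAt_liftField hd
  have s2 : ContDiffOn ℝ ∞ xi2 base := contDiffOn_const
  have s1 : ContDiffOn ℝ ∞ (xi1 (profile k)) base := by
    intro m hm
    refine ContDiffAt.contDiffWithinAt (contDiffAt_pi.2 fun j => ?_)
    have c : ∀ j : Fin 5, ContDiffAt ℝ ∞ (fun n : E5 => n j) m := fun j => contDiffAt_apply ℝ ℝ j m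
    fin_cases j
    · exact contDiffAt_const
    · exact c 2
    · exact c 3
    · exact contDiffAt_const
    · exact ContDiffAt.comp (g := profile k) m
        ((Real.contDiffAt_rpow_const_of_ne (ne_of_gt hm)).div_const _) (c 3)
  -- The brackets with ∂_q and ξ₁ suffice: each lies in the distribution, which is three linear
  -- conditions.
  have b2 := hb xi2 s2 (fun m _ => Submodule.subset_span (by simp)) _ hm
  have b1 := hb _ s1 (fun m _ => Submodule.subset_span (by simp)) _ hm
  have f2 : fderiv ℝ xi2 (proj n) = 0 := by unfold xi2; simp
  rw [VectorField.lieBracket, f2, mem_distribution_iff] at b2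
  rw [VectorField.lieBracket, (fderiv_xi1 hk0 hk1 hm _).2, mem_distribution_iff] at b1
  have p3 : proj (Pi.single 3 1) = xi2 (proj n) := by
    funext j; fin_cases j <;> simp [proj, xi2]
  have pX : ∀ g : E7 → ℝ, pdXi k g n =
      fderiv ℝ g n ![1, n 2, n 3, 0, n 3 ^ k / (k * (k - 1)), 0, 0] := by
    intro g
    rw [fderiv_eq_pd]
    simp [pdXi, pdT]
  have pXi : proj ![1, n 2, n 3, 0, n 3 ^ k / (k * (k - 1)), 0, 0] = xi1 (profile k) (proj n) := by
    funext j; fin_cases j <;> simp [proj, xi1, profile]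
  have B := fun ξ => eta1_fderiv hL ξ
  have C := fun ξ => eta2_fderiv hL ξ
  have A := fun ξ => fderiv_compA hk0 hk1 hq hL ξ
  have B3 := B (Pi.single 3 1)
  have C3 := C (Pi.single 3 1)
  have A3 := A (Pi.single 3 1)
  have Bx := B ![1, n 2, n 3, 0, n 3 ^ k / (k * (k - 1)), 0, 0]
  have Cx := C ![1, n 2, n 3, 0, n 3 ^ k / (k * (k - 1)), 0, 0]
  have Ax := A ![1, n 2, n 3, 0, n 3 ^ k / (k * (k - 1)), 0, 0]
  rw [hLd, p3] at B3 C3 A3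
  rw [hLd, pXi] at Bx Cx Ax
  rw [pX, pX, pX]
  change fderiv ℝ (compB (liftField X)) n (Pi.single 3 1) = 0 ∧ _ ∧
    fderiv ℝ (compA k (liftField X)) n (Pi.single 3 1) = _ ∧ _ ∧
    _ = -fderiv ℝ (compC (liftField X)) n (Pi.single 3 1) ∧ _
  have l : ∀ i, liftField X n i = liftL (X (proj n)) i := fun _ => rfl
  have c2 : compC (liftField X) n = liftField X n 2 - n 3 * liftField X n 0 := rfl
  have hh : profile k (proj n 3) = n 3 ^ k / (k * (k - 1)) := rfl
  have m2 : proj n 2 = n 2 := rfl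
  have m3 : proj n 3 = n 3 := rfl
  rw [hh, m2, m3] at b1 b2
  rw [c2]
  simp only [l] at B3 C3 A3 Bx Cx Ax ⊢
  generalize fderiv ℝ X (proj n) (xi2 (proj n)) = F2 at *
  generalize fderiv ℝ X (proj n) (xi1 (profile k) (proj n)) = F1 at *
  generalize X (proj n) = V at *
  obtain ⟨u0, u1, -, -, -⟩ := rpow_sub_natCast_forms (k := k) hq
  obtain ⟨b21, b22, b24⟩ := b2
  obtain ⟨b11, b12, b14⟩ := b1
  generalize fderiv ℝ (compA k (liftField X)) n = DA at *
  generalize fderiv ℝ (compB (liftField X)) n = DB at *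
  generalize fderiv ℝ (compC (liftField X)) n = DC at *
  simp only [eta1, eta2, liftL_apply, Matrix.cons_val, Pi.zero_apply, Pi.sub_apply, Pi.single_apply,
    Fin.reduceEq, if_true, if_false, zero_apply] at *
  have hB : DB ![1, n 2, n 3, 0, n 3 ^ k / (k * (k - 1)), 0, 0] = V 2 - n 3 * V 0 := by
    linear_combination -Bx - b11
  refine ⟨by linear_combination -B3 - b21, ?_, ?_, hB.symm, by linear_combination -C3 - b22,
    by linear_combination Cx + b12⟩
  · rw [Ax]
    rw [u0, u1] at *
    field_simp at b12 b14 ⊢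
    linear_combination -b14 + k * n 3 * n 3 ^ (k - 2) * b12
  · rw [A3, hB]
    rw [u0, u1] at *
    field_simp at b22 b24 ⊢
    linear_combination -b24 + k * n 3 * n 3 ^ (k - 2) * b22

theorem fieldX_eq (k : ℝ) (i : Fin 7) : fieldX k i = fun m => projL (fieldXt k i (liftL m)) := by
  funext m
  rw [projL_apply, proj_fieldXt, proj_liftL]

theorem contDiffAt_fieldX {k : ℝ} {m : E5} (hm : m ∈ base) (i : Fin 7) :
    ContDiffAt ℝ ∞ (fieldX k i) m := by
  rw [fieldX_eq]
  exact projL.contDiff.contDiffAt.comp m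
    ((contDiffAt_fieldXt (k := k) (n := liftL m) hm i).comp m liftL.contDiff.contDiffAt)

theorem fderiv_fieldX {k : ℝ} (hk0 : k ≠ 0) {m : E5} (hm : m ∈ base) (i : Fin 7) (ζ : E5) :
    fderiv ℝ (fieldX k i) m ζ = proj (fieldXtDeriv k i (liftL m) (liftL ζ)) := by
  have hd := ((contDiffAt_fieldXt (k := k) (n := liftL m) hm i).differentiableAt
    (by simp)).hasFDerivAt
  have h : HasFDerivAt (fun m => projL (fieldXt k i (liftL m))) _ m :=
    projL.hasFDerivAt.comp m (hd.comp m liftL.hasFDerivAt)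
  rw [fieldX_eq, h.fderiv, ← fderiv_fieldXt (k := k) (n := liftL m) hk0 hm]
  rfl

/-- A section Z satisfies Z^y = pZ^x, Z^p = qZ^x and Z^z = hZ^x. The product rule expresses the
derivatives of these components by that of Z^x, and membership of the bracket becomes an algebraic
identity. -/
theorem lieBracket_fieldX_mem {k : ℝ} (hk0 : k ≠ 0) (hk1 : k - 1 ≠ 0) (i : Fin 7) {Z : E5 → E5}
    (hZ : ContDiffOn ℝ ∞ Z base) (hZ' : ∀ m ∈ base, Z m ∈ distribution (profile k) m) {m : E5}
    (hm : m ∈ base) : VectorField.lieBracket ℝ (fieldX k i) Z m ∈ distribution (profile k) m := by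
  have hq : 0 < m 3 := hm
  have hnhds := isOpen_base.mem_nhds hm
  have dZ := (hZ.contDiffAt hnhds).differentiableAt (by simp)
  have dZi := differentiableAt_pi.1 dZ
  have comp : ∀ j ζ, fderiv ℝ Z m ζ j = fderiv ℝ (fun m => Z m j) m ζ := by
    intro j ζ
    rw [(hasFDerivAt_pi'.1 dZ.hasFDerivAt j).fderiv]
    rfl
  have coord : ∀ j : Fin 5, HasFDerivAt (fun m : E5 => m j)
      (ContinuousLinearMap.proj (R := ℝ) (φ := fun _ : Fin 5 => ℝ) j) m :=
    fun j => hasFDerivAt_apply j m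
  have hφ : HasDerivAt (profile k) (m 3 ^ (k - 1) / (k - 1)) (m 3) := by
    refine ((Real.hasDerivAt_rpow_const (p := k) (Or.inl hq.ne')).div_const
      (k * (k - 1))).congr_deriv ?_
    field_simp
  have hφ' : HasFDerivAt (fun m : E5 => profile k (m 3))
      ((m 3 ^ (k - 1) / (k - 1)) •
        ContinuousLinearMap.proj (R := ℝ) (φ := fun _ : Fin 5 => ℝ) 3) m :=
    HasDerivAt.comp_hasFDerivAt (f := fun m : E5 => m 3) m hφ (coord 3)
  have prod : ∀ (j : Fin 5) {g : E5 → ℝ} {g' : E5 →L[ℝ] ℝ}, HasFDerivAt g g' m →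
      (∀ m ∈ base, Z m j = g m * Z m 0) → ∀ ζ,
      fderiv ℝ Z m ζ j = g m * fderiv ℝ Z m ζ 0 + Z m 0 * g' ζ := by
    intro j g g' hg h ζ
    have e : (fun m => Z m j) =ᶠ[𝓝 m] fun m => g m * Z m 0 := Filter.eventuallyEq_of_mem hnhds h
    rw [comp, comp, e.fderiv_eq, (hg.fun_mul (dZi 0).hasFDerivAt).fderiv]
    simp
  have D := fun m hm => mem_distribution_iff.1 (hZ' m hm)
  have p1 := prod 1 (coord 2) (fun m hm => (D m hm).1) (fieldX k i m)
  have p2 := prod 2 (coord 3) (fun m hm => (D m hm).2.1) (fieldX k i m)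
  have p4 := prod 4 hφ' (fun m hm => (D m hm).2.2) (fieldX k i m)
  obtain ⟨z1, z2, z4⟩ := D m hm
  have hp : profile k (m 3) = m 3 ^ k / (k * (k - 1)) := rfl
  rw [mem_distribution_iff, VectorField.lieBracket, fderiv_fieldX hk0 hm]
  simp only [Pi.sub_apply, p1, p2, p4]
  generalize fderiv ℝ Z m (fieldX k i m) = F
  rw [hp] at z4 ⊢
  obtain ⟨u0, u1, -, -, -⟩ := rpow_sub_natCast_forms (k := k) hq
  have u2 : m 3 ^ (2 * k - 2) = (m 3 * m 3 ^ (k - 2)) ^ 2 := by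
    rw [← u1, ← Real.rpow_natCast, ← Real.rpow_mul hq.le]
    ring_nf
  have hq' := hq.ne'
  refine ⟨?_, ?_, ?_⟩
  all_goals
    fin_cases i <;>
      simp [fieldX, fieldXtDeriv, proj, liftL_apply, z1, z2, z4, u0, u1, u2] <;>
      (try field_simp) <;> (try ring)

theorem indicator_fieldX_mem {k : ℝ} (hk0 : k ≠ 0) (hk1 : k - 1 ≠ 0) (i : Fin 7) :
    base.indicator (fieldX k i) ∈ distributionSymmetries (profile k) := by
  have e : ∀ m ∈ base, base.indicator (fieldX k i) =ᶠ[𝓝 m] fieldX k i := fun m hm =>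
    Filter.eventuallyEq_of_mem (isOpen_base.mem_nhds hm) fun m hm => Set.indicator_of_mem hm _
  refine ⟨fun m hm => Set.indicator_of_notMem hm _, fun m hm =>
    (contDiffAt_fieldX hm i).congr_of_eventuallyEq (e m hm), fun Z hZ hZ' m hm => ?_⟩
  have h := lieBracket_fieldX_mem hk0 hk1 i hZ hZ' hm
  rwa [VectorField.lieBracket, ← (e m hm).fderiv_eq, ← (e m hm).eq_of_nhds] at h

theorem isBox_twistorDomain : IsBox twistorDomain where
  isOpen := isOpen_twistorDomain
  convex := by
    have : IsLinearMap ℝ fun u : E7 => u 3 := ⟨fun _ _ => rfl, fun _ _ => rfl⟩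
    exact convex_halfSpace_gt this 0
  nonempty := isConnected_twistorDomain.nonempty
  update_mem := by
    intro m hm n hn i
    rcases eq_or_ne 3 i with rfl | hj
    · simpa [twistorDomain] using hn
    · simpa [twistorDomain, Function.update_of_ne hj] using hm

theorem pd_liftField_eq_zero {X : E5 → E5} {n : E7} (hX : DifferentiableAt ℝ X (proj n))
    (hq : 0 < n 3) {k : ℝ} (hk0 : k ≠ 0) (hk1 : k - 1 ≠ 0) {i : Fin 7} (hi : i = 5 ∨ i = 6) :
    pd i (compA k (liftField X)) n = 0 ∧ pd i (compB (liftField X)) n = 0 := by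
  obtain ⟨hL, hd⟩ := hasFDerivAt_liftField hX
  have hp : proj (Pi.single i 1) = 0 := by
    rcases hi with rfl | rfl <;> (funext j; fin_cases j <;> simp [proj])
  have h2 : (Pi.single i 1 : E7) 2 = 0 ∧ (Pi.single i 1 : E7) 3 = 0 := by
    rcases hi with rfl | rfl <;> simp
  have hB := eta1_fderiv hL (Pi.single i 1)
  have hA := fderiv_compA hk0 hk1 hq hL (Pi.single i 1)
  rw [hd, hp, map_zero, map_zero] at hA hB
  rw [h2.1] at hB
  rw [h2.2] at hA
  simp [eta1] at hA hB
  exact ⟨hA, hB.symm⟩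

/-- Here c = ξ₁b is one of the equations, so c vanishes with b, and the components along ∂_x and ∂_q
vanish with c. No second order argument is needed. -/
theorem distributionSymmetries_eq_zero {k : ℝ} (hk0 : k ≠ 0) (hk1 : k - 1 ≠ 0) {X : E5 → E5}
    (hX : X ∈ distributionSymmetries (profile k))
    (ha : ∀ n ∈ twistorDomain, compA k (liftField X) n = 0)
    (hb : ∀ n ∈ twistorDomain, compB (liftField X) n = 0) {n : E7} (hn : n ∈ twistorDomain) :
    liftField X n = 0 := by
  have R := fun n hn => distributionSymmetries_equations hk0 hk1 hX (n := n) hn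
  have pb := fun n hn i => pd_eq_zero_of_const isOpen_twistorDomain hb i (n := n) hn
  have hc : ∀ n ∈ twistorDomain, compC (liftField X) n = 0 := by
    intro n hn
    rw [(R n hn).2.2.2.1]
    simp [pdXi, pdT, pb n hn]
  have pc := fun i => pd_eq_zero_of_const isOpen_twistorDomain hc i hn
  obtain ⟨-, -, -, -, x0, x3⟩ := R n hn
  rw [pc, neg_zero] at x0
  simp only [pdXi, pdT, pc, mul_zero, add_zero] at x3
  have x1 := hb n hn
  have x2 := hc n hn
  have x4 := ha n hn
  simp only [compB, compC, x0, mul_zero, sub_zero] at x1 x2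
  simp only [compA, x0, x2, mul_zero, sub_zero, add_zero] at x4
  funext j
  fin_cases j
  · exact x0
  · exact x1
  · exact x2
  · exact x3
  · exact x4
  · rfl
  · rfl

theorem distributionSymmetries_eq_span {k : ℝ}
    (hk : k ∉ ({2, 2 / 3, 1 / 3, 0, 1, -1} : Set ℝ)) :
    distributionSymmetries (profile k) = Submodule.span ℝ
      (Set.range fun i : Fin 7 => base.indicator (fieldX k i)) := by
  have hk' := hk
  simp only [Set.mem_insert_iff, Set.mem_singleton_iff, not_or] at hk'
  obtain ⟨-, -, -, hk0, hk1', -⟩ := hk'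
  have hk1 : k - 1 ≠ 0 := sub_ne_zero.2 hk1'
  refine le_antisymm (fun X hX => ?_) (Submodule.span_le.2 ?_)
  · have hX0 := hX.1
    have hs := hX.2.1
    have sm := smoothOn_liftField hs
    have hq : ∀ n ∈ twistorDomain, 0 < n 3 := fun n hn => hn
    have sb : SmoothOn twistorDomain (compB (liftField X)) :=
      (sm 1).sub ((SmoothOn.coord 2).mul (sm 0))
    have sa : SmoothOn twistorDomain (compA k (liftField X)) :=
      ((sm 4).sub ((SmoothOn.comp_coord (φ := fun q => q ^ (k - 1) / (k - 1)) 3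
        fun n hn => (contDiffAt_powers (hq n hn)).1).mul (sm 2))).add
        ((SmoothOn.comp_coord (φ := fun q => q ^ k / k) 3
          fun n hn => (contDiffAt_powers (hq n hn)).2.1).mul (sm 0))
    have R := fun n hn => distributionSymmetries_equations hk0 hk1 hX (n := n) hn
    have V : ∀ {i : Fin 7}, i = 5 ∨ i = 6 → ∀ n ∈ twistorDomain, _ := fun {i} hi n hn =>
      pd_liftField_eq_zero ((hs (proj n) hn).differentiableAt (by simp)) (hq n hn) hk0 hk1 hi
    obtain ⟨c, hc⟩ := exists_coefficients hk isBox_twistorDomain hq sa sb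
      (fun n hn => (R n hn).1) (fun n hn => (V (Or.inl rfl) n hn).1)
      (fun n hn => (V (Or.inr rfl) n hn).1) (fun n hn => (V (Or.inl rfl) n hn).2)
      (fun n hn => (V (Or.inr rfl) n hn).2) (fun n hn => (R n hn).2.1)
      (fun n hn => (R n hn).2.2.1)
    have hsum : ∑ i, c i • base.indicator (fieldX k i) ∈ distributionSymmetries (profile k) :=
      Submodule.sum_mem _ fun i _ => Submodule.smul_mem _ _ (indicator_fieldX_mem hk0 hk1 i)
    have hX' := Submodule.sub_mem _ hX hsum
    have e : ∀ n ∈ twistorDomain, ∀ j : Fin 5,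
        (X - ∑ i, c i • base.indicator (fieldX k i)) (proj n) j =
          X (proj n) j - ∑ i, c i * fieldX k i (proj n) j := by
      intro n hn j
      have hm : proj n ∈ base := hn
      simp [Finset.sum_apply, hm]
    have l : ∀ (X : E5 → E5) (n : E7), liftField X n 0 = X (proj n) 0 ∧
        liftField X n 1 = X (proj n) 1 ∧ liftField X n 2 = X (proj n) 2 ∧
        liftField X n 4 = X (proj n) 4 := fun X n => ⟨rfl, rfl, rfl, rfl⟩
    have h0 : X = ∑ i, c i • base.indicator (fieldX k i) := by
      funext m
      by_cases hm : m ∈ base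
      · have hn : liftL m ∈ twistorDomain := hm
        have h := distributionSymmetries_eq_zero hk0 hk1 hX' (fun n hn => ?_) (fun n hn => ?_) hn
        · have h' := congrArg proj h
          rw [liftField, proj_liftL, proj_liftL] at h'
          have z : proj 0 = 0 := map_zero projL
          rw [z, Pi.sub_apply] at h'
          exact sub_eq_zero.1 h'
        · have ha := (hc n hn).2
          simp only [compA, (l _ n).1, (l _ n).2.2.1, (l _ n).2.2.2] at ha ⊢
          rw [e n hn, e n hn, e n hn]
          simp only [Fin.sum_univ_seven, fieldX, proj, Matrix.cons_val] at ha ⊢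
          have hq' := hq n hn
          field_simp at ha ⊢
          linear_combination ha
        · have hb := (hc n hn).1
          simp only [compB, (l _ n).1, (l _ n).2.1] at hb ⊢
          rw [e n hn, e n hn]
          simp only [Fin.sum_univ_seven, fieldX, proj, Matrix.cons_val] at hb ⊢
          linear_combination hb
      · rw [hX0 m hm, Finset.sum_apply]
        simp only [Pi.smul_apply, Set.indicator_of_notMem hm, smul_zero, Finset.sum_const_zero]
    rw [h0]
    exact Submodule.sum_mem _ fun i _ =>
      Submodule.smul_mem _ _ (Submodule.subset_span (Set.mem_range_self i))
  · rintro _ ⟨i, rfl⟩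
    exact indicator_fieldX_mem hk0 hk1 i


/-! ### The flows of the fields and their prolongations -/

/-- The differential of the flow need only map the spanning vector to a nonzero multiple c t of the
spanning vector at γ t; the lines then correspond. -/
theorem isProlongationAt_of_flow {h : ℝ → ℝ} {X : E5 → E5} {n Y : E7} {Φ : ℝ → E5 → E5}
    {γ : ℝ → E7} {c : ℝ → ℝ} (hΦ : IsLocalFlow X Φ (proj n)) (h0 : γ 0 = n)
    (hγ : HasDerivAt γ Y 0) (hp : ∀ t, proj (γ t) = Φ t (proj n))
    (hd : ∀ᶠ t in 𝓝 (0 : ℝ), c t ≠ 0 ∧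
      fderiv ℝ (Φ t) (proj n) (direction h n) = c t • direction h (γ t)) :
    IsProlongationAt h X n Y := by
  refine ⟨Φ, γ, hΦ, h0, hγ, hd.mono ?_⟩
  rintro t ⟨hc, h⟩
  simp only [twistorPoint, Submodule.map_span, Set.image_singleton, hp,
    ContinuousLinearMap.coe_coe]
  rw [h, Submodule.span_singleton_smul_eq hc.isUnit]

theorem direction_profile {k : ℝ} (hk0 : k ≠ 0) (hk1 : k - 1 ≠ 0) {n : E7} (hq : 0 < n 3) :
    direction (profile k) n = ![1, n 2, n 3 + n 6 / n 3 ^ (k - 2), n 5 / n 3 ^ (k - 2),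
      n 3 ^ 2 * n 3 ^ (k - 2) / (k * (k - 1)) + n 6 * n 3 / (k - 1)] := by
  obtain ⟨a0, a1, a2, -, -, -⟩ := profile_jet hk0 hk1 hq
  have hpos : n 3 ^ (k - 2) ≠ 0 := (Real.rpow_pos_of_pos hq _).ne'
  funext j
  fin_cases j <;> simp [direction, xi1, proj, a0, a1, a2]
  field_simp

/-- The flows of the fields `X_i`. -/
def flow (k : ℝ) (i : Fin 7) (t : ℝ) (m : E5) : E5 :=
  match i with
  | 0 => ![m 0 + t, m 1, m 2, m 3, m 4]
  | 1 => ![m 0, m 1 + t, m 2, m 3, m 4]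
  | 2 => ![m 0, m 1, m 2, m 3, m 4 + t]
  | 3 => ![m 0, m 1 + t * m 0, m 2 + t, m 3, m 4]
  | 4 => ![Real.exp t * m 0, m 1, Real.exp (-t) * m 2, Real.exp (-2 * t) * m 3,
      Real.exp ((1 - 2 * k) * t) * m 4]
  | 5 => ![m 0, Real.exp t * m 1, Real.exp t * m 2, Real.exp t * m 3, Real.exp (k * t) * m 4]
  | 6 => ![m 0 + t * m 3 ^ (k - 1),
      m 1 + t * (m 2 * m 3 ^ (k - 1) + (1 - k) * m 4)
        + t ^ 2 / 2 * ((k - 1) / k * m 3 ^ k * m 3 ^ (k - 1) + (1 - k) * zCoeff k (m 3)),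
      m 2 + t * ((k - 1) / k * m 3 ^ k), m 3, m 4 + t * zCoeff k (m 3)]

/-- The factors by which the flows stretch the vectors `direction (profile k) n`. -/
def flowFactor (k : ℝ) (i : Fin 7) (t : ℝ) (n : E7) : ℝ :=
  ![1, 1, 1, 1, Real.exp t, 1, 1 - (1 - k) * t * n 5] i

/-- The fibre coordinates of the lifts of the flows. -/
def flowFibre (k : ℝ) (i : Fin 7) (t : ℝ) (n : E7) : ℝ × ℝ :=
  match i with
  | 0 => (n 5, n 6)
  | 1 => (n 5, n 6)
  | 2 => (n 5, n 6)
  | 3 => (n 5, n 6)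
  | 4 => (Real.exp ((1 - 2 * k) * t) * n 5, Real.exp (2 * (1 - k) * t) * n 6)
  | 5 => (Real.exp ((k - 1) * t) * n 5, Real.exp ((k - 1) * t) * n 6)
  | 6 => (n 5 / (1 - (1 - k) * t * n 5), n 6 / (1 - (1 - k) * t * n 5))

/-- The lifts of the flows to the twistor bundle. -/
def flowLift (k : ℝ) (i : Fin 7) (t : ℝ) (n : E7) : E7 :=
  ![flow k i t (proj n) 0, flow k i t (proj n) 1, flow k i t (proj n) 2, flow k i t (proj n) 3,
    flow k i t (proj n) 4, (flowFibre k i t n).1, (flowFibre k i t n).2]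

theorem contDiffAt_flow {k : ℝ} (i : Fin 7) (t : ℝ) {m : E5} (hm : m ∈ base) :
    ContDiffAt ℝ ∞ (fun a : ℝ × E5 => flow k i a.1 a.2) (t, m) := by
  have hq : 0 < m 3 := hm
  have c : ∀ j : Fin 5, ContDiffAt ℝ ∞ (fun a : ℝ × E5 => a.2 j) (t, m) := fun j => by fun_prop
  have r : ∀ e : ℝ, ContDiffAt ℝ ∞ (fun a : ℝ × E5 => a.2 3 ^ e) (t, m) := fun e =>
    ContDiffAt.comp (g := fun q : ℝ => q ^ e) (t, m)
      (Real.contDiffAt_rpow_const_of_ne hq.ne') (c 3)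
  have z : ContDiffAt ℝ ∞ (fun a : ℝ × E5 => zCoeff k (a.2 3)) (t, m) :=
    ContDiffAt.comp (g := zCoeff k) (t, m) (contDiffAt_zCoeff hq) (c 3)
  have rk := r k
  have r1 := r (k - 1)
  rw [contDiffAt_pi]
  intro j
  fin_cases i <;> fin_cases j <;> simp [flow] <;> fun_prop

theorem hasDerivAt_exp_mul (a t b : ℝ) :
    HasDerivAt (fun t => Real.exp (a * t) * b) (a * (Real.exp (a * t) * b)) t := by
  refine (((hasDerivAt_id t).const_mul a).exp.mul_const b).congr_deriv ?_
  simp only [id]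
  ring

/-- Along X₇ the coordinate q is constant, so x, p and z move linearly in time and y quadratically.
The fields X₅ and X₆ are linear and have exponential flows. -/
theorem hasDerivAt_flow {k : ℝ} (i : Fin 7) (t : ℝ) (m : E5) :
    HasDerivAt (fun t => flow k i t m) (fieldX k i (flow k i t m)) t := by
  have e1 := fun b => by simpa using hasDerivAt_exp_mul 1 t b
  have e2 := fun b => by simpa using hasDerivAt_exp_mul (-1) t b
  have d := hasDerivAt_id' t
  have l : ∀ a b : ℝ, HasDerivAt (fun t => a + t * b) b t := fun a b => by
    simpa using (d.mul_const b).const_add a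
  have sq : ∀ a b c : ℝ, HasDerivAt (fun t => a + t * b + t ^ 2 / 2 * c) (b + t * c) t := by
    intro a b c
    refine ((l a b).add (((d.pow 2).div_const 2).mul_const c)).congr_deriv ?_
    simp
  have c0 : ∀ a : ℝ, HasDerivAt (fun _ : ℝ => a) 0 t := hasDerivAt_const t
  rw [hasDerivAt_pi]
  intro j
  fin_cases i <;> fin_cases j <;>
    simp only [flow, fieldX, Matrix.cons_val, Fin.mk_one, Fin.zero_eta, Fin.reduceFinMk] <;>
    first
    | exact c0 _
    | exact d.const_add _
    | exact l _ _
    | exact e1 _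
    | exact e2 _
    | exact hasDerivAt_exp_mul _ _ _
    | (refine (sq _ _ _).congr_deriv ?_; ring)

theorem isLocalFlow_flow {k : ℝ} (i : Fin 7) {m : E5} (hm : m ∈ base) :
    IsLocalFlow (fieldX k i) (flow k i) m where
  smooth := contDiffAt_flow i 0 hm
  initial := Filter.Eventually.of_forall fun m => by
    funext j
    fin_cases i <;> fin_cases j <;> simp [flow]
  hasDerivAt := Filter.Eventually.of_forall fun a => hasDerivAt_flow i a.1 a.2

/-- Since `direction` has ∂_x-component 1, the stretching factor is the ∂_x-component of the
transported vector. For X₇ it is 1 + t(k − 1)q^(k−2) · v/h'' = 1 − (1 − k)tv. -/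
theorem fderiv_flow_direction {k : ℝ} (hk0 : k ≠ 0) (hk1 : k - 1 ≠ 0) (i : Fin 7) (t : ℝ) {n : E7}
    (hq : 0 < n 3) (hc : flowFactor k i t n ≠ 0) :
    fderiv ℝ (flow k i t) (proj n) (direction (profile k) n) =
      flowFactor k i t n • direction (profile k) (flowLift k i t n) := by
  have hd : DifferentiableAt ℝ (flow k i t) (proj n) :=
    ((contDiffAt_flow i t (show proj n ∈ base from hq)).comp (proj n) (f := fun m => (t, m))
      (by fun_prop)).differentiableAt (by simp)
  have hq' : 0 < flowLift k i t n 3 := by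
    fin_cases i <;> simp [flowLift, flow, proj] <;> positivity
  rw [direction_profile hk0 hk1 hq, direction_profile hk0 hk1 hq']
  generalize hζ : (![1, n 2, n 3 + n 6 / n 3 ^ (k - 2), n 5 / n 3 ^ (k - 2),
      n 3 ^ 2 * n 3 ^ (k - 2) / (k * (k - 1)) + n 6 * n 3 / (k - 1)] : E5) = ζ
  have D : ∀ i, HasDerivAt (fun r : ℝ => (proj n + r • ζ) i) (ζ i) 0 := fun i => by
    simpa using ((hasDerivAt_id (0 : ℝ)).mul_const (ζ i)).const_add (proj n i)
  have z : proj n + (0 : ℝ) • ζ = proj n := by simp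
  have z3 : (proj n + (0 : ℝ) • ζ) 3 = n 3 := by rw [z]; rfl
  have hr : ∀ e : ℝ, HasDerivAt (fun r : ℝ => (proj n + r • ζ) 3 ^ e)
      (e * n 3 ^ (e - 1) * ζ 3) 0 := by
    intro e
    refine ((D 3).rpow_const (p := e) (Or.inl (by rw [z3]; exact hq.ne'))).congr_deriv ?_
    rw [z3]
    ring
  have hz : HasDerivAt (fun r : ℝ => zCoeff k ((proj n + r • ζ) 3))
      (n 3 ^ (2 * k - 2) / k * ζ 3) 0 :=
    HasDerivAt.comp (h₂ := zCoeff k) (0 : ℝ) (by rw [z3]; exact hasDerivAt_zCoeff hk0 hq) (D 3)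
  have key : ∀ d : E5, (∀ j, HasDerivAt (fun r : ℝ => flow k i t (proj n + r • ζ) j) (d j) 0) →
      fderiv ℝ (flow k i t) (proj n) ζ = d := by
    intro d h
    have h1 : HasDerivAt (fun r : ℝ => proj n + r • ζ) ζ 0 := hasDerivAt_pi.2 D
    have h2 : HasFDerivAt (flow k i t) (fderiv ℝ (flow k i t) (proj n))
        (proj n + (0 : ℝ) • ζ) := by rw [z]; exact hd.hasFDerivAt
    exact (h2.comp_hasDerivAt (0 : ℝ) h1).unique
      (hasDerivAt_pi (φ := fun r j => flow k i t (proj n + r • ζ) j) |>.2 h)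
  obtain ⟨u0, u1, -, -, -⟩ := rpow_sub_natCast_forms (k := k) hq
  have u2 : n 3 ^ (2 * k - 2) = (n 3 * n 3 ^ (k - 2)) ^ 2 := by
    rw [← u1, ← Real.rpow_natCast, ← Real.rpow_mul hq.le]
    ring_nf
  have u3 : n 3 ^ (k - 1 - 1) = n 3 ^ (k - 2) := by ring_nf
  have z0 : ∀ j, (proj n + (0 : ℝ) • ζ) j = proj n j := fun j => by rw [z]
  have hpos : n 3 ^ (k - 2) ≠ 0 := (Real.rpow_pos_of_pos hq _).ne'
  have hq0 := hq.ne'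
  refine key _ fun j => ?_
  have hζ' : ζ = ![1, n 2, n 3 + n 6 / n 3 ^ (k - 2), n 5 / n 3 ^ (k - 2),
      n 3 ^ 2 * n 3 ^ (k - 2) / (k * (k - 1)) + n 6 * n 3 / (k - 1)] := hζ.symm
  have s0 : ζ 0 = 1 := by rw [hζ']; rfl
  have s1 : ζ 1 = n 2 := by rw [hζ']; rfl
  have s2 : ζ 2 = n 3 + n 6 / n 3 ^ (k - 2) := by rw [hζ']; rfl
  have s3 : ζ 3 = n 5 / n 3 ^ (k - 2) := by rw [hζ']; rfl
  have s4 : ζ 4 = n 3 ^ 2 * n 3 ^ (k - 2) / (k * (k - 1)) + n 6 * n 3 / (k - 1) := by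
    rw [hζ']; rfl
  have hE : ∀ a : ℝ, (Real.exp a * n 3) ^ (k - 2) = Real.exp (a * (k - 2)) * n 3 ^ (k - 2) := by
    intro a
    rw [Real.mul_rpow (Real.exp_pos a).le hq.le, ← Real.exp_mul]
  -- All exponentials are reduced to e^t and e^(kt), after which the identities are rational.
  have x1 : Real.exp ((1 - 2 * k) * t) = Real.exp t / Real.exp (k * t) ^ 2 := by
    rw [← Real.exp_nat_mul, ← Real.exp_sub]; push_cast; ring_nf
  have x2 : Real.exp (2 * (1 - k) * t) = Real.exp t ^ 2 / Real.exp (k * t) ^ 2 := by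
    rw [← Real.exp_nat_mul, ← Real.exp_nat_mul, ← Real.exp_sub]; push_cast; ring_nf
  have x3 : Real.exp ((k - 1) * t) = Real.exp (k * t) / Real.exp t := by
    rw [← Real.exp_sub]; ring_nf
  have x4 : Real.exp (-t) = 1 / Real.exp t := by rw [Real.exp_neg, one_div]
  have x5 : Real.exp (-2 * t) = 1 / Real.exp t ^ 2 := by
    rw [← Real.exp_nat_mul, one_div, ← Real.exp_neg]; push_cast; ring_nf
  have x6 : Real.exp (-2 * t * (k - 2)) = Real.exp t ^ 4 / Real.exp (k * t) ^ 2 := by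
    rw [← Real.exp_nat_mul, ← Real.exp_nat_mul, ← Real.exp_sub]; push_cast; ring_nf
  have x7 : Real.exp (t * (k - 2)) = Real.exp (k * t) / Real.exp t ^ 2 := by
    rw [← Real.exp_nat_mul, ← Real.exp_sub]; push_cast; ring_nf
  have y1 := Real.exp_pos t
  have y2 := Real.exp_pos (k * t)
  have c1 : ∀ j (b : ℝ), HasDerivAt (fun r : ℝ => b * (proj n + r • ζ) j) (b * ζ j) 0 :=
    fun j b => (D j).const_mul b
  have yy := (((D 1).add ((((D 2).fun_mul (hr (k - 1))).fun_add
      ((D 4).const_mul (1 - k))).const_mul t)).add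
      (((((hr k).const_mul ((k - 1) / k)).fun_mul (hr (k - 1))).fun_add
        (hz.const_mul (1 - k))).const_mul (t ^ 2 / 2)))
  simp only [z0] at yy
  obtain ⟨σ, hσ⟩ : ∃ σ, σ = 1 - (1 - k) * t * n 5 := ⟨_, rfl⟩
  fin_cases i <;> fin_cases j
  all_goals
    first
    | refine (D _).congr_deriv ?_
    | refine ((D _).add_const _).congr_deriv ?_
    | refine (c1 _ _).congr_deriv ?_
    | refine ((D 1).add (c1 0 t)).congr_deriv ?_
    | refine ((D 0).add ((hr (k - 1)).const_mul t)).congr_deriv ?_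
    | refine yy.congr_deriv ?_
    | refine ((D 2).add (((hr k).const_mul ((k - 1) / k)).const_mul t)).congr_deriv ?_
    | refine ((D 4).add (hz.const_mul t)).congr_deriv ?_
  all_goals
    simp only [Matrix.cons_val, Fin.mk_one, Fin.zero_eta, Fin.reduceFinMk, flowFactor] at hc
    simp only [flowFactor, flowLift, flow, flowFibre, proj, Matrix.cons_val, Pi.smul_apply,
      smul_eq_mul, Fin.mk_one, Fin.zero_eta, Fin.reduceFinMk, s0, s1, s2, s3, s4, hE, u3, u0, u1,
      u2]
    try simp only [x1, x2, x3, x4, x5, x6, x7]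
    try simp only [← hσ] at hc ⊢
    try field_simp
    try simp only [hσ]
    try ring

theorem isProlongationAt_fieldXt {k : ℝ} (hk0 : k ≠ 0) (hk1 : k - 1 ≠ 0) (i : Fin 7) {n : E7}
    (hq : 0 < n 3) : IsProlongationAt (profile k) (fieldX k i) n (fieldXt k i n) := by
  have hF := hasDerivAt_pi.1 (hasDerivAt_flow (k := k) i 0 (proj n))
  have hF0 : flow k i 0 (proj n) = proj n := by
    funext j
    fin_cases i <;> fin_cases j <;> simp [flow]
  rw [hF0] at hF
  refine isProlongationAt_of_flow (γ := fun t => flowLift k i t n)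
    (c := fun t => flowFactor k i t n) (isLocalFlow_flow i hq) ?_ ?_ ?_ ?_
  · funext j
    fin_cases j
    · exact congrFun hF0 0
    · exact congrFun hF0 1
    · exact congrFun hF0 2
    · exact congrFun hF0 3
    · exact congrFun hF0 4
    all_goals fin_cases i <;> simp [flowLift, flowFibre]
  · have d : HasDerivAt (fun t => 1 - (1 - k) * t * n 5) (-((1 - k) * n 5)) 0 := by
      simpa using (((hasDerivAt_id (0 : ℝ)).const_mul (1 - k)).mul_const (n 5)).const_sub 1
    have hdiv : ∀ b : ℝ, HasDerivAt (fun t => b / (1 - (1 - k) * t * n 5)) ((1 - k) * n 5 * b)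
        0 := by
      intro b
      refine ((hasDerivAt_const (0 : ℝ) b).fun_div d (by simp)).congr_deriv ?_
      simp
      ring
    have hexp : ∀ a b : ℝ, HasDerivAt (fun t => Real.exp (a * t) * b) (a * b) 0 := fun a b => by
      simpa using hasDerivAt_exp_mul a 0 b
    have c0 : ∀ a : ℝ, HasDerivAt (fun _ : ℝ => a) 0 (0 : ℝ) := hasDerivAt_const 0
    have hproj : ∀ j, fieldX k i (proj n) j = proj (fieldXt k i n) j := by
      intro j
      fin_cases i <;> fin_cases j <;> rfl
    rw [hasDerivAt_pi]
    intro j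
    fin_cases j
    · exact (hF 0).congr_deriv (hproj 0)
    · exact (hF 1).congr_deriv (hproj 1)
    · exact (hF 2).congr_deriv (hproj 2)
    · exact (hF 3).congr_deriv (hproj 3)
    · exact (hF 4).congr_deriv (hproj 4)
    all_goals
      fin_cases i <;>
        simp only [flowLift, flowFibre, fieldXt, Matrix.cons_val, Fin.mk_one, Fin.zero_eta,
          Fin.reduceFinMk] <;>
        first
        | exact c0 _
        | exact hexp _ _
        | (refine (hdiv _).congr_deriv ?_; ring)
  · intro t
    funext j
    fin_cases j <;> rfl
  · have hcont : ContinuousAt (fun t => flowFactor k i t n) 0 := by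
      fin_cases i <;> simp [flowFactor] <;> fun_prop
    have h0 : flowFactor k i 0 n ≠ 0 := by
      fin_cases i <;> simp [flowFactor]
    exact (hcont.eventually_ne h0).mono fun t ht => ⟨ht, fderiv_flow_direction hk0 hk1 i t hq ht⟩

end TwistorLieContact

end

open TwistorLieContact in
theorem proposition4p2 (k : ℝ) (hk : k ∉ ({2, 2 / 3, 1 / 3, 0, 1, -1} : Set ℝ)) :
    (∀ W : Set E7, IsOpen W → IsConnected W → W ⊆ twistorDomain →
      Module.finrank ℝ (symmetryAlgebra k W) = 7 ∧
      symmetryAlgebra k W = Submodule.span ℝ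
        (Set.range fun i : Fin 7 => (chartPart (profile k) W).indicator (fieldXt k i))) ∧
    distributionSymmetries (profile k) = Submodule.span ℝ
      (Set.range fun i : Fin 7 => base.indicator (fieldX k i)) ∧
    ∀ i : Fin 7, ∀ n ∈ chartPart (profile k) twistorDomain,
      IsProlongationAt (profile k) (fieldX k i) n (fieldXt k i n) := by
  have hk0 : k ≠ 0 := fun h => hk (by simp [h])
  have hk1 : k - 1 ≠ 0 := fun h => hk (by simp [sub_eq_zero.1 h])
  refine ⟨fun W hW hc hW' => ?_, distributionSymmetries_eq_span hk,
    fun i n hn => isProlongationAt_fieldXt hk0 hk1 i hn.1⟩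
  have hspan := symmetryAlgebra_eq_span hk hW hc hW'
  refine ⟨?_, hspan⟩
  rw [hspan, finrank_span_eq_card (linearIndependent_fieldXt hk0 hk1 hW hc.nonempty hW')]
  rfl
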